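/- Let $K$ be a complete discrete valuation field of characteristic $0$ with valuation ring $\mathcal O_K$, maximal ideal $\mathfrak m_K$, normalized valuation $v_K$ and perfect residue field of characteristic $p>0$, and let $\bar K$ be an algebraic closure of $K$. For a commutative one-dimensional formal group $F$ over $\mathcal O_K$ let $F(K)$ and $F(\bar K)$ be the groups with underlying sets $\mathfrak m_K$ and $\mathfrak m_{\bar K}$ and operation $x+y:=F(x,y)$, and let $F^m(K)\subset F(K)$ be the subgroup $\mathfrak m_K^m$. A homomorphism of formal groups $\phi(T)\in\mathcal O_K[[T]]$ is an isogeny of height $h\ge 1$ if $\phi(T)\equiv\psi(T^{p^h})\pmod{\mathfrak m_K}$ for some $\psi\in\mathcal O_K[[T]]$ whose coefficient of $T$ is a unit. Let $n\ge 1$ and let $\phi:F\to G$ be an isogeny over $\mathcal O_K$ of height $n$ between commutative one-dimensional formal groups whose kernel $F[\phi]\subset F(\bar K)$ is cyclic and contained in $F(K)$. Let $\phi=\phi_1\circ\cdots\circ\phi_n$ be its factorization into isogenies $\phi_i:G_i\to G_{i-1}$ of height $1$ over $\mathcal O_K$, where $G_i=F/p^iF[\phi]$ (that is, $p^iF[\phi]$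 is the kernel of $\phi_{i+1}\circ\cdots\circ\phi_n:F\to G_i$), $G_n=F$ and $G_0=G$. Let $t_i$ be the valuation $v_K$ of the coefficient of $T$ in $\phi_i(T)$, and put $c_i(\phi)=t_1+\cdots+t_i+\frac{t_i}{p-1}$ for $1\le i\le n$. Let $G^m(\phi)$ be the image of $G^m(K)$ in $G(\phi):=G(K)/\phi(F(K))$. **Proposition 2.9.** Let $m$ be an integer with $1\le m<c_1(\phi)$ and $p\nmid m$, let $y\in G^m(\phi)\setminus G^{m+1}(\phi)$, and let $x\in F(\bar K)$ be such that $\phi(x)$ lies in $G(K)$ and has class $y$ in $G(\phi)$. Then $L=K(x)$ is a totally ramified Galois extension of $K$ of degree $p^n$. The jumps of the ramification filtration in the upper numbering of $H=\mathrm{Gal}(L/K)$, i.e. the real numbers $v\ge -1$ with $H^v\ne H^{v+\varepsilon}$ for all $\varepsilon>0$, are exactly $c_1(\phi)-m,\dots,c_n(\phi)-m$. In particular, $H^{c_n(\phi)-m}\ne 1$. -/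

import Mathlib

open Filter IsLocalRing

noncomputable section

namespace FormalIsogeny

/-! ### Power series over a discrete valuation ring `R`, evaluated in an `R`-algebra `A`

`R` is the valuation ring of a discretely valued field `K`. The algebra `A` is `R` itself or the
integral closure of `R` in an algebraic extension of `K`, which is the valuation ring of the unique
extension of the valuation when `R` is complete. -/

section Evaluation

variable {R : Type*} [CommRing R] {A : Type*} [CommRing A] [Algebra R A]

variable (R) in
/-- The sequence `s` in `A` converges to `y` in the valuation topology, i.e. the topology whose
basic neighbourhoods of `0` are the ideals `r A` with `r` a nonzero element of `R`. -/
def ConvergesTo (s : ℕ → A) (y : A) : Prop :=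
  ∀ r : R, r ≠ 0 → ∀ᶠ N in atTop, algebraMap R A r ∣ s N - y

/-- `f(x) = y`: the series `∑ aᵢ xⁱ` converges to `y`. -/
def HasValue (f : PowerSeries R) (x y : A) : Prop :=
  ConvergesTo R (fun N => ∑ i ∈ Finset.range N, algebraMap R A (PowerSeries.coeff i f) * x ^ i) y

/-- `F(x, y) = z`, i.e. `x + y = z` in the group of points of the formal group `F`: the series
`∑ aᵢⱼ xⁱ yʲ` converges to `z`. -/
def HasFormalSum (F : FormalGroup R) (x y z : A) : Prop :=
  ConvergesTo R (fun N => ∑ i ∈ Finset.range N, ∑ j ∈ Finset.range N,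
    algebraMap R A (MvPowerSeries.coeff (Finsupp.single 0 i + Finsupp.single 1 j) F.toPowerSeries)
      * x ^ i * y ^ j) z

/-- `[k] x = z` in the group of points of the formal group `F`, for a natural number `k`. -/
def HasMultiple (F : FormalGroup R) (x : A) : ℕ → A → Prop
  | 0, z => z = 0
  | k + 1, z => ∃ w, HasMultiple F x k w ∧ HasFormalSum F w x z

variable (A) in
/-- The kernel of `f` on points with values in the maximal ideal of the local ring `A`
(for a local ring the Jacobson radical is the maximal ideal). -/
def kernel (f : PowerSeries R) : Set A :=
  {z | z ∈ Ring.jacobson A ∧ HasValue f z 0}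

/-- The subset `q S = {[q] w | w ∈ S}` of the group of points of `F`. -/
def multiples (F : FormalGroup R) (q : ℕ) (S : Set A) : Set A :=
  {z | ∃ w ∈ S, HasMultiple F w q z}

end Evaluation

/-! ### Isogenies of formal groups -/

section Isogeny

variable {R : Type*} [CommRing R]

/-- `φ : F → G` is a homomorphism of formal groups: `φ(0) = 0` and `φ(F(X, Y)) = G(φ(X), φ(Y))`. -/
structure IsHom (F G : FormalGroup R) (φ : PowerSeries R) : Prop where
  constantCoeff_eq_zero : PowerSeries.constantCoeff φ = 0
  map_add : PowerSeries.subst F.toPowerSeries φ =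
    MvPowerSeries.subst
      ![PowerSeries.subst (MvPowerSeries.X 0 : MvPowerSeries (Fin 2) R) φ,
        PowerSeries.subst (MvPowerSeries.X 1 : MvPowerSeries (Fin 2) R) φ]
      G.toPowerSeries

/-- `φ` has height `h`: `φ(T) ≡ ψ(T ^ (p ^ h))` modulo the maximal ideal for some power series `ψ`
whose coefficient of `T` is a unit. -/
def HasHeight [IsLocalRing R] (p h : ℕ) (φ : PowerSeries R) : Prop :=
  ∃ ψ : PowerSeries R, IsUnit (PowerSeries.coeff 1 ψ) ∧
    ∀ i, PowerSeries.coeff i φ -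
      PowerSeries.coeff i (PowerSeries.subst (PowerSeries.X ^ (p ^ h) : PowerSeries R) ψ)
        ∈ maximalIdeal R

/-- `φ : F → G` is an isogeny of height `h`. -/
structure IsIsogeny [IsLocalRing R] (p h : ℕ) (F G : FormalGroup R) (φ : PowerSeries R) :
    Prop where
  isHom : IsHom F G φ
  hasHeight : HasHeight p h φ

/-- The composite `φ_{i+1} ∘ φ_{i+2} ∘ ⋯ ∘ φ_{i+k}`. -/
def comp (φ : ℕ → PowerSeries R) (i : ℕ) : ℕ → PowerSeries R
  | 0 => PowerSeries.X
  | k + 1 => PowerSeries.subst (φ (i + k + 1)) (comp φ i k)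

/-- The kernel of `φ` on the points of the formal group `F` over `O`, the valuation ring of the
algebraic closure of `K`, is a cyclic group (a finite one, so that natural multiples of a generator
exhaust it), and all its elements are points over `R`. -/
structure HasRationalCyclicKernel (O : Type*) [CommRing O] [Algebra R O]
    (F : FormalGroup R) (φ : PowerSeries R) : Prop where
  rational : ∀ z ∈ kernel O φ, ∃ a : R, algebraMap R O a = z
  cyclic : ∃ x₀ ∈ kernel O φ, ∀ z ∈ kernel O φ, ∃ k : ℕ, HasMultiple F x₀ k z

/-- The factorization `φ = φ₁ ∘ ⋯ ∘ φₙ` of an isogeny `φ : F → G` of height `n` with cyclic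
kernel `F[φ]` into isogenies `φᵢ : Gᵢ → Gᵢ₋₁` of height `1`, where `Gₙ = F`, `G₀ = G` and
`Gᵢ = F / pⁱ F[φ]`, the quotient map `F → Gᵢ` being `φ_{i+1} ∘ ⋯ ∘ φₙ`. -/
structure IsFactorization [IsLocalRing R] (O : Type*) [CommRing O] [Algebra R O] (p n : ℕ)
    (F G : FormalGroup R) (φ : PowerSeries R)
    (Gs : ℕ → FormalGroup R) (φs : ℕ → PowerSeries R) : Prop where
  source : Gs n = F
  target : Gs 0 = G
  isComm : ∀ i ≤ n, (Gs i).IsComm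
  isIsogeny : ∀ i, 1 ≤ i → i ≤ n → IsIsogeny p 1 (Gs i) (Gs (i - 1)) (φs i)
  comp_eq : comp φs 0 n = φ
  kernel_comp : ∀ i ≤ n, kernel O (comp φs i (n - i)) = multiples F (p ^ i) (kernel O φ)

/-- The set of `y ∈ G(K)` whose class in `G(φ) = G(K) / φ F(K)` lies in `Gᵐ(φ)`, the image of
`Gᵐ(K) = 𝔪ᵐ`: those of the form `u + φ(z)` in `G(K)`, with `u ∈ 𝔪ᵐ` and `z ∈ F(K) = 𝔪`. -/
def cokernelFiltration [IsLocalRing R] (G : FormalGroup R) (φ : PowerSeries R) (m : ℕ) : Set R :=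
  {y | y ∈ maximalIdeal R ∧ ∃ u ∈ maximalIdeal R ^ m, ∃ z ∈ maximalIdeal R, ∃ w,
    HasValue φ z w ∧ HasFormalSum G u w y}

variable [IsDomain R] [IsDiscreteValuationRing R]

/-- `tᵢ`, the valuation of the coefficient of `T` in `φᵢ` (which is nonzero in characteristic zero),
for `1 ≤ i`. -/
def t (φ : ℕ → PowerSeries R) (i : ℕ) : ℕ :=
  (IsDiscreteValuationRing.addVal R (PowerSeries.coeff 1 (φ i))).toNat

/-- `cᵢ = t₁ + ⋯ + tᵢ + tᵢ / (p - 1)`, for `1 ≤ i`. -/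
def c (p : ℕ) (φ : ℕ → PowerSeries R) (i : ℕ) : ℝ :=
  ∑ j ∈ Finset.Icc 1 i, (t φ j : ℝ) + (t φ i : ℝ) / ((p : ℝ) - 1)

end Isogeny

/-! ### Ramification -/

section Ramification

variable (R K L : Type*) [CommRing R] [Field K] [Algebra R K] [Field L] [Algebra K L] [Algebra R L]
  [IsScalarTower R K L]

/-- `L / K` is totally ramified: in the integral closure of `R` in `L`, the maximal ideal of `R`
generates the power of a maximal ideal with exponent the degree `[L : K]`. -/
def IsTotallyRamified [IsLocalRing R] : Prop :=
  ∃ P : Ideal (integralClosure R L), P.IsMaximal ∧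
    (maximalIdeal R).map (algebraMap R (integralClosure R L)) = P ^ Module.finrank K L

instance smulCommClass_gal : SMulCommClass (L ≃ₐ[K] L) R L where
  smul_comm σ r x := by
    rw [← algebraMap_smul K r x, ← algebraMap_smul K r (σ • x)]
    exact map_smul σ _ _

/-- The ramification group `H_u` in the lower numbering, for real `u ≥ -1`: the `σ` with
`σ a - a ∈ 𝔪_L ^ (⌈u⌉ + 1)` for all `a` in the valuation ring of `L`. -/
def lowerRamificationGroup (u : ℝ) : Subgroup (L ≃ₐ[K] L) :=
  (Ring.jacobson (integralClosure R L) ^ (⌈u⌉ + 1).toNat).inertia (L ≃ₐ[K] L)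

/-- The Herbrand function `u ↦ ∫₀ᵘ dt / (H₀ : H_t)`, for `u ≥ -1`. -/
def herbrand (u : ℝ) : ℝ :=
  ∫ s in (0 : ℝ)..u, (((lowerRamificationGroup R K L s).relIndex
    (lowerRamificationGroup R K L 0) : ℕ) : ℝ)⁻¹

/-- The ramification group `H^v` in the upper numbering, for real `v ≥ -1`: it is `H_u`, where
`u ≥ -1` has Herbrand function equal to `v`. -/
def upperRamificationGroup (v : ℝ) : Subgroup (L ≃ₐ[K] L) :=
  lowerRamificationGroup R K L (Function.invFunOn (herbrand R K L) (Set.Ici (-1)) v)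

/-- The jumps of the filtration `(H^v)_{v ≥ -1}`. -/
def upperJumps : Set ℝ :=
  {v | -1 ≤ v ∧ ∀ ε > 0, upperRamificationGroup R K L v ≠ upperRamificationGroup R K L (v + ε)}

end Ramification

end FormalIsogeny

end

/-!
Let `x₀` generate the kernel of `φ`. The image of `[pʲ] x₀` in `G_{j+1}` generates the kernel of
`φ_{j+1}`; if `s_j` is its valuation, then the Newton polygon of `φ_{j+1}` gives
`t_{j+1} = (p - 1) s_j`, and `φ_{j+1}` multiplies valuations by `p` below `s_j` and adds `t_{j+1}`
to them above it. Hence the valuation of `[pʲ] x₀` is `s_j / p ^ (n - 1 - j)`, and `c₁ = p s₀`.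

Changing `x` by a point of `F(K)` does not change `L`, so we may assume that `φ(x) = u` has
valuation `m`. Since `m < p s₀`, each step of the chain from `x` to `u` multiplies valuations by
`p`, so `x` has valuation `m / p ^ n` in the normalization of `K`. As `p ∤ m`, the extension is
totally ramified of degree at least `p ^ n`, and Weierstrass preparation bounds the degree by
`p ^ n`.

The conjugates of `x` are the `x + [k] x₀` with `k < p ^ n`. If `p ^ j` exactly divides `k`, then
`σ x - x` has valuation `p ^ (j + 1) s_j` in `L`, while `x` has valuation `m` prime to `p`; writing
a uniformizer as a power of `x` times a power of an element of `K` shows that `σ` has ramification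
number `p ^ (j + 1) s_j - m`. The Herbrand function takes these lower jumps to
`t₁ + ⋯ + t_{j+1} + s_j - m = c_{j+1} - m`.
-/

noncomputable section

namespace FormalIsogeny

/-! ### Evaluation of power series in complete local rings -/

section Evaluation

variable {R : Type*} [CommRing R] {A : Type*} [CommRing A] [IsLocalRing A] [Algebra R A]
  {B : Type*} [CommRing B] [IsLocalRing B] [Algebra R B] {σ τ : Type*}

/-- The value of the multivariate power series `f` at the point `a` of the local ring `A` with its
adic topology; it is meaningful when `A` is complete and the coordinates of `a` lie in the maximal
ideal. -/
def evalMv (a : σ → A) (f : MvPowerSeries σ R) : A :=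
  letI : UniformSpace R := ⊥
  letI : WithIdeal A := ⟨maximalIdeal A⟩
  MvPowerSeries.eval₂ (algebraMap R A) a f

lemma hasEval_of_mem_maximalIdeal [Finite σ] {a : σ → A} (ha : ∀ s, a s ∈ maximalIdeal A) :
    letI : WithIdeal A := ⟨maximalIdeal A⟩
    MvPowerSeries.HasEval a := by
  let : WithIdeal A := ⟨maximalIdeal A⟩
  refine ⟨fun s => ?_, by simp only [cofinite_eq_bot, tendsto_bot]⟩
  refine (maximalIdeal A).hasBasis_nhds_zero_adic.tendsto_right_iff.2 fun k _ => ?_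
  filter_upwards [eventually_ge_atTop k] with n hn
  exact Ideal.pow_le_pow_right hn (Ideal.pow_mem_pow (ha s) n)

lemma evalMv_X (a : σ → A) (s : σ) : evalMv a (MvPowerSeries.X s : MvPowerSeries σ R) = a s := by
  let : UniformSpace R := ⊥
  let : WithIdeal A := ⟨maximalIdeal A⟩
  exact MvPowerSeries.eval₂_X _ _ s

lemma algHom_mem_maximalIdeal (θ : A →ₐ[R] B) [IsLocalHom θ] {x : A} (hx : x ∈ maximalIdeal A) :
    θ x ∈ maximalIdeal B :=
  (mem_maximalIdeal _).2 fun h => (mem_maximalIdeal _).1 hx (isUnit_of_map_unit θ x h)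

lemma algHom_mem_maximalIdeal_pow (θ : A →ₐ[R] B) [IsLocalHom θ] {k : ℕ} {x : A}
    (hx : x ∈ maximalIdeal A ^ k) : θ x ∈ maximalIdeal B ^ k := by
  have hle : maximalIdeal A ≤ (maximalIdeal B).comap θ := fun _ => algHom_mem_maximalIdeal θ
  exact Ideal.le_comap_pow θ k (Ideal.pow_right_mono hle k hx)

variable [IsAdicComplete (maximalIdeal A) A] [IsAdicComplete (maximalIdeal B) B]

omit [IsLocalRing A] [IsAdicComplete (maximalIdeal A) A] in
lemma eq_of_forall_sub_mem_pow {I : Ideal A} [IsHausdorff I A] {x y : A}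
    (h : ∀ k, x - y ∈ I ^ k) : x = y := by
  rw [← sub_eq_zero]
  exact IsHausdorff.haus (I := I) inferInstance _ fun k => by simpa [SModEq.zero] using h k

variable (A) in
lemma completeSpace_t2Space_adic :
    letI : WithIdeal A := ⟨maximalIdeal A⟩
    CompleteSpace A ∧ T2Space A := by
  let : WithIdeal A := ⟨maximalIdeal A⟩
  exact (IsAdic.isAdicComplete_iff (I := maximalIdeal A) rfl).1 inferInstance

/-- Evaluation at a point with coordinates in the maximal ideal, as an algebra homomorphism. -/
def evalMvHom [Finite σ] (a : σ → A) (ha : ∀ s, a s ∈ maximalIdeal A) :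
    MvPowerSeries σ R →ₐ[R] A :=
  letI : UniformSpace R := ⊥
  letI : WithIdeal A := ⟨maximalIdeal A⟩
  haveI := (completeSpace_t2Space_adic A).1
  haveI := (completeSpace_t2Space_adic A).2
  haveI : ContinuousSMul R A := DiscreteTopology.instContinuousSMul R A
  MvPowerSeries.aeval (R := R) (hasEval_of_mem_maximalIdeal ha)

lemma coe_evalMvHom [Finite σ] (a : σ → A) (ha : ∀ s, a s ∈ maximalIdeal A) :
    ⇑(evalMvHom (R := R) a ha) = evalMv a := by
  let : UniformSpace R := ⊥
  let : WithIdeal A := ⟨maximalIdeal A⟩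
  have := (completeSpace_t2Space_adic A).1
  have := (completeSpace_t2Space_adic A).2
  have : ContinuousSMul R A := DiscreteTopology.instContinuousSMul R A
  exact MvPowerSeries.coe_aeval (R := R) (hasEval_of_mem_maximalIdeal ha)

section Mv

variable [Finite σ] {a b : σ → A} (ha : ∀ s, a s ∈ maximalIdeal A)
include ha

lemma evalMv_add (f g : MvPowerSeries σ R) : evalMv a (f + g) = evalMv a f + evalMv a g := by
  simp only [← coe_evalMvHom a ha, map_add]

lemma evalMv_mul (f g : MvPowerSeries σ R) : evalMv a (f * g) = evalMv a f * evalMv a g := by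
  simp only [← coe_evalMvHom a ha, map_mul]

lemma evalMv_one : evalMv a (1 : MvPowerSeries σ R) = 1 := by
  simp only [← coe_evalMvHom a ha, map_one]

lemma evalMv_subst {c : τ → MvPowerSeries σ R} (hc : MvPowerSeries.HasSubst c)
    (f : MvPowerSeries τ R) :
    evalMv a (MvPowerSeries.subst c f) = evalMv (fun s => evalMv a (c s)) f := by
  let : UniformSpace R := ⊥
  let : WithIdeal A := ⟨maximalIdeal A⟩
  have := (completeSpace_t2Space_adic A).1
  have := (completeSpace_t2Space_adic A).2
  exact MvPowerSeries.eval₂_subst (S := R) (R := R) hc (hasEval_of_mem_maximalIdeal ha) f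

lemma eventually_sum_sub_evalMv_mem (f : MvPowerSeries σ R) (k : ℕ) :
    ∀ᶠ s : Finset (σ →₀ ℕ) in atTop,
      ∑ d ∈ s, algebraMap R A (MvPowerSeries.coeff d f) * d.prod (fun i e => a i ^ e)
        - evalMv a f ∈ maximalIdeal A ^ k := by
  let : UniformSpace R := ⊥
  let : WithIdeal A := ⟨maximalIdeal A⟩
  have := (completeSpace_t2Space_adic A).1
  have := (completeSpace_t2Space_adic A).2
  have h : Tendsto (fun s : Finset (σ →₀ ℕ) => ∑ d ∈ s,
      algebraMap R A (MvPowerSeries.coeff d f) * d.prod (fun i e => a i ^ e)) atTop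
      (nhds (evalMv a f)) :=
    MvPowerSeries.hasSum_eval₂ (φ := algebraMap R A) continuous_of_discreteTopology
      (hasEval_of_mem_maximalIdeal ha) f
  filter_upwards [((maximalIdeal A).hasBasis_nhds_adic _).tendsto_right_iff.1 h k trivial]
    with s ⟨z, hz, hzs⟩
  rw [← hzs, add_sub_cancel_left]
  exact hz

lemma evalMv_sub_mem_pow (hb : ∀ s, b s ∈ maximalIdeal A) {k : ℕ}
    (hab : ∀ s, a s - b s ∈ maximalIdeal A ^ k) (f : MvPowerSeries σ R) :
    evalMv a f - evalMv b f ∈ maximalIdeal A ^ k := by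
  obtain ⟨s, h₁, h₂⟩ := ((eventually_sum_sub_evalMv_mem ha f k).and
    (eventually_sum_sub_evalMv_mem hb f k)).exists
  simp only [← Ideal.Quotient.eq] at hab h₁ h₂ ⊢
  rw [← h₁, ← h₂]
  simp only [map_sum, map_mul, Finsupp.prod, map_prod, map_pow, hab]

lemma evalMv_sub_constantCoeff_mem_pow {k : ℕ} (hk : ∀ s, a s ∈ maximalIdeal A ^ k)
    (f : MvPowerSeries σ R) :
    evalMv a f - algebraMap R A (MvPowerSeries.constantCoeff f) ∈ maximalIdeal A ^ k := by
  have h0 : ∀ s : σ, (0 : σ → A) s ∈ maximalIdeal A := fun _ => zero_mem _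
  have hzero : ∀ l, evalMv (0 : σ → A) f - algebraMap R A (MvPowerSeries.constantCoeff f) ∈
      maximalIdeal A ^ l := fun l => by
    obtain ⟨s, hs, h⟩ := ((eventually_ge_atTop {0}).and
      (eventually_sum_sub_evalMv_mem h0 f l)).exists
    rw [Finset.sum_eq_single_of_mem 0 (hs (Finset.mem_singleton_self 0)) fun d _ hd => ?_] at h
    · simpa using neg_mem h
    · obtain ⟨i, hi⟩ := Finsupp.ne_iff.1 hd
      exact mul_eq_zero_of_right _
        (Finset.prod_eq_zero (Finsupp.mem_support_iff.2 hi) (zero_pow hi))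
  rw [← eq_of_forall_sub_mem_pow hzero]
  exact evalMv_sub_mem_pow ha h0 (fun s => by simpa using hk s) f

lemma evalMv_mem_pow {k : ℕ} (hk : ∀ s, a s ∈ maximalIdeal A ^ k) {f : MvPowerSeries σ R}
    (hf : MvPowerSeries.constantCoeff f = 0) : evalMv a f ∈ maximalIdeal A ^ k := by
  simpa [hf] using evalMv_sub_constantCoeff_mem_pow ha hk f

lemma evalMv_mem {f : MvPowerSeries σ R} (hf : MvPowerSeries.constantCoeff f = 0) :
    evalMv a f ∈ maximalIdeal A := by
  simpa using evalMv_mem_pow ha (k := 1) (by simpa using ha) hf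

lemma map_evalMv (θ : A →ₐ[R] B) [IsLocalHom θ] (f : MvPowerSeries σ R) :
    θ (evalMv a f) = evalMv (fun s => θ (a s)) f := by
  refine eq_of_forall_sub_mem_pow (I := maximalIdeal B) fun k => ?_
  obtain ⟨s, h₁, h₂⟩ := ((eventually_sum_sub_evalMv_mem ha f k).and
    (eventually_sum_sub_evalMv_mem (fun s => algHom_mem_maximalIdeal θ (ha s)) f k)).exists
  have h₃ := algHom_mem_maximalIdeal_pow θ h₁
  simp only [map_sub, map_sum, map_mul, AlgHom.commutes, Finsupp.prod, map_prod, map_pow] at h₂ h₃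
  simpa only [sub_sub_sub_cancel_left] using sub_mem h₂ h₃

end Mv

/-- The value of the power series `f` at the element `a` of the local ring `A`; it is meaningful
when `A` is complete and `a` lies in the maximal ideal. -/
def ev (f : PowerSeries R) (a : A) : A := evalMv (fun _ : Unit => a) f

/-- Evaluation at an element of the maximal ideal, as an algebra homomorphism. -/
def evHom (a : A) (ha : a ∈ maximalIdeal A) : PowerSeries R →ₐ[R] A :=
  evalMvHom (fun _ : Unit => a) fun _ => ha

lemma evHom_apply (a : A) (ha : a ∈ maximalIdeal A) (f : PowerSeries R) :
    evHom a ha f = ev f a := congrFun (coe_evalMvHom (R := R) (fun _ : Unit => a) fun _ => ha) f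

omit [IsAdicComplete (maximalIdeal A) A] in
lemma ev_X (a : A) : ev (PowerSeries.X : PowerSeries R) a = a := evalMv_X _ _

lemma evalMv_subst_X [Finite σ] {a : σ → A} (ha : ∀ s, a s ∈ maximalIdeal A) (s : σ)
    (f : PowerSeries R) :
    evalMv a (PowerSeries.subst (MvPowerSeries.X s : MvPowerSeries σ R) f) = ev f (a s) := by
  rw [PowerSeries.subst, evalMv_subst ha (PowerSeries.HasSubst.X s).const, evalMv_X, ev]

section Univariate

variable {a : A} (ha : a ∈ maximalIdeal A)
include ha

lemma ev_mul (f g : PowerSeries R) : ev (f * g) a = ev f a * ev g a := by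
  simp only [← evHom_apply a ha, map_mul]

lemma isUnit_ev {f : PowerSeries R} (hf : IsUnit f) : IsUnit (ev f a) := by
  rw [← evHom_apply a ha]
  exact hf.map (evHom a ha)

lemma ev_coe (f : Polynomial R) : ev (f : PowerSeries R) a = Polynomial.aeval a f := by
  have h : (evHom (R := R) a ha).comp (Polynomial.coeToPowerSeries.algHom R) =
      Polynomial.aeval a := by
    ext
    simp [evHom_apply a ha, ev_X]
  simpa [evHom_apply a ha] using DFunLike.congr_fun h f

lemma ev_subst {g : PowerSeries R} (hg : PowerSeries.constantCoeff g = 0) (f : PowerSeries R) :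
    ev (PowerSeries.subst g f) a = ev f (ev g a) :=
  evalMv_subst (fun _ => ha) (PowerSeries.HasSubst.of_constantCoeff_zero' hg).const f

lemma exists_ev_eq_constantCoeff_add_mul (f : PowerSeries R) :
    ∃ b, ev f a = algebraMap R A (PowerSeries.constantCoeff f) + a * b := by
  obtain ⟨g, hg⟩ : PowerSeries.X ∣ f - PowerSeries.C (PowerSeries.constantCoeff f) := by
    simp [PowerSeries.X_dvd_iff]
  refine ⟨ev g a, ?_⟩
  rw [sub_eq_iff_eq_add'.1 hg, ← evHom_apply a ha, map_add, evHom_apply, evHom_apply, ev_mul ha,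
    ev_X, ← evHom_apply a ha, ← PowerSeries.algebraMap_eq, AlgHom.commutes]
  simp

lemma ev_mem {f : PowerSeries R} (hf : PowerSeries.constantCoeff f = 0) :
    ev f a ∈ maximalIdeal A :=
  evalMv_mem (fun _ => ha) hf

lemma map_ev (θ : A →ₐ[R] B) [IsLocalHom θ] (f : PowerSeries R) : θ (ev f a) = ev f (θ a) :=
  map_evalMv (fun _ => ha) θ f

lemma eventually_sum_sub_ev_mem (f : PowerSeries R) (k : ℕ) : ∀ᶠ N in atTop,
    ∑ i ∈ Finset.range N, algebraMap R A (PowerSeries.coeff i f) * a ^ i - ev f a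
      ∈ maximalIdeal A ^ k := by
  have htendsto : Tendsto (fun N => (Finset.range N).map
      ⟨fun i => Finsupp.single () i, Finsupp.single_injective ()⟩) atTop atTop :=
    Monotone.tendsto_atTop_finset
      (fun M N h => Finset.map_subset_map.2 (Finset.range_subset_range.2 h))
      fun d => ⟨d () + 1, by
        rw [Finset.mem_map]
        exact ⟨d (), by simp, Finsupp.ext fun _ => Finsupp.single_eq_same⟩⟩
  filter_upwards [htendsto.eventually (eventually_sum_sub_evalMv_mem
    (a := fun _ : Unit => a) (fun _ => ha) f k)] with N hN
  simpa [Finset.sum_map, Finsupp.prod_single_index, PowerSeries.coeff, ev] using hN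

end Univariate

end Evaluation

/-! ### The group of points of a formal group -/

section Points

variable {R : Type*} [CommRing R] {A : Type*} [CommRing A] [IsLocalRing A] [Algebra R A]
  {B : Type*} [CommRing B] [IsLocalRing B] [Algebra R B] {τ : Type*}

/-- The sum `F(x, y)` of points of a formal group with values in the maximal ideal of `A`. -/
def fadd (F : FormalGroup R) (x y : A) : A := evalMv ![x, y] F.toPowerSeries

omit [IsLocalRing A] [Algebra R A] in
lemma cons_mem_ideal {I : Ideal A} {x y : A} (hx : x ∈ I) (hy : y ∈ I) :
    ∀ s, (![x, y] : Fin 2 → A) s ∈ I := by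
  intro s; fin_cases s <;> simpa

omit [Algebra R A] in
lemma hasSubst_cons {f g : MvPowerSeries τ R}
    (hf : MvPowerSeries.constantCoeff f = 0) (hg : MvPowerSeries.constantCoeff g = 0) :
    MvPowerSeries.HasSubst ![f, g] :=
  MvPowerSeries.hasSubst_of_constantCoeff_zero fun s => by fin_cases s <;> simpa

lemma constantCoeff_subst_cons (F : FormalGroup R) {f g : MvPowerSeries τ R}
    (hf : MvPowerSeries.constantCoeff f = 0) (hg : MvPowerSeries.constantCoeff g = 0) :
    MvPowerSeries.constantCoeff (MvPowerSeries.subst ![f, g] F.toPowerSeries) = 0 :=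
  MvPowerSeries.constantCoeff_subst_eq_zero (hasSubst_cons hf hg)
    (fun s => by fin_cases s <;> simpa) F.zero_constantCoeff

lemma coeff_formalGroup_of_apply_one_eq_zero (F : FormalGroup R) {d : Fin 2 →₀ ℕ} (hd : d 1 = 0) :
    MvPowerSeries.coeff d F.toPowerSeries =
      MvPowerSeries.coeff d (MvPowerSeries.X 0 : MvPowerSeries (Fin 2) R) := by
  have h0 : MvPowerSeries.constantCoeff (MvPowerSeries.X 0 : MvPowerSeries (Fin 2) R) = 0 :=
    MvPowerSeries.constantCoeff_X 0
  have hprod : ∀ e : Fin 2 →₀ ℕ, e.prod (fun s k =>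
      (![MvPowerSeries.X 0, 0] : Fin 2 → MvPowerSeries (Fin 2) R) s ^ k) =
        MvPowerSeries.X 0 ^ e 0 * 0 ^ e 1 := fun e => by
    rw [Finsupp.prod_fintype _ _ (by simp)]; simp
  have hdX : ∀ e : Fin 2 →₀ ℕ, MvPowerSeries.coeff d
      ((MvPowerSeries.X 0 : MvPowerSeries (Fin 2) R) ^ e 0 * 0 ^ e 1) = if e = d then 1 else 0 := by
    intro e
    have hed : e = d ↔ e 0 = d 0 ∧ e 1 = 0 := by
      rw [Finsupp.ext_iff, Fin.forall_fin_two, hd]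
    have hdX : d = Finsupp.single 0 (e 0) ↔ e 0 = d 0 := by
      rw [Finsupp.ext_iff, Fin.forall_fin_two]
      simp [hd, eq_comm]
    rcases eq_or_ne (e 1) 0 with h | h
    · simp [h, hed, MvPowerSeries.coeff_X_pow, hdX]
    · simp [h, hed]
  have hadd := congrArg (MvPowerSeries.coeff d)
    (F.add_zero (PowerSeries.HasSubst.X (0 : Fin 2) : PowerSeries.HasSubst
      (MvPowerSeries.X 0 : MvPowerSeries (Fin 2) R)))
  rw [MvPowerSeries.coeff_subst (hasSubst_cons h0 (map_zero _))] at hadd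
  rw [← hadd, finsum_eq_single _ d fun e he => by simp [hprod, hdX, he]]
  simp [hprod, hdX]

lemma exists_formalGroup_eq_X_add_X_mul (F : FormalGroup R) : ∃ g : MvPowerSeries (Fin 2) R,
    MvPowerSeries.constantCoeff g = 1 ∧
      F.toPowerSeries = MvPowerSeries.X 0 + MvPowerSeries.X 1 * g := by
  obtain ⟨g, hg⟩ : MvPowerSeries.X 1 ∣ F.toPowerSeries - MvPowerSeries.X 0 :=
    MvPowerSeries.X_dvd_iff.2 fun d hd => by
      rw [map_sub, coeff_formalGroup_of_apply_one_eq_zero F hd, sub_self]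
  have hF := sub_eq_iff_eq_add'.1 hg
  refine ⟨g, ?_, hF⟩
  have h1 := F.lin_coeff_Y
  rw [hF, map_add, MvPowerSeries.coeff_index_single_X, if_neg one_ne_zero, zero_add] at h1
  have hcoeff := MvPowerSeries.coeff_add_monomial_mul (Finsupp.single 1 1) 0 g (1 : R)
  rw [add_zero, one_mul, MvPowerSeries.coeff_zero_eq_constantCoeff_apply] at hcoeff
  exact hcoeff.symm.trans h1

variable [IsAdicComplete (maximalIdeal A) A] [IsAdicComplete (maximalIdeal B) B]

lemma evalMv_subst_cons (F : FormalGroup R) [Finite τ] {a : τ → A}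
    (ha : ∀ s, a s ∈ maximalIdeal A) {f g : MvPowerSeries τ R}
    (hf : MvPowerSeries.constantCoeff f = 0) (hg : MvPowerSeries.constantCoeff g = 0) :
    evalMv a (MvPowerSeries.subst ![f, g] F.toPowerSeries) =
      fadd F (evalMv a f) (evalMv a g) := by
  rw [evalMv_subst ha (hasSubst_cons hf hg), fadd]
  congr 1
  ext s; fin_cases s <;> rfl

lemma fadd_mem (F : FormalGroup R) {x y : A} (hx : x ∈ maximalIdeal A) (hy : y ∈ maximalIdeal A) :
    fadd F x y ∈ maximalIdeal A :=
  evalMv_mem (cons_mem_ideal hx hy) F.zero_constantCoeff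

lemma map_fadd (θ : A →ₐ[R] B) [IsLocalHom θ] (F : FormalGroup R) {x y : A}
    (hx : x ∈ maximalIdeal A) (hy : y ∈ maximalIdeal A) :
    θ (fadd F x y) = fadd F (θ x) (θ y) := by
  rw [fadd, map_evalMv (cons_mem_ideal hx hy), fadd]
  congr 1
  ext s; fin_cases s <;> rfl

lemma fadd_assoc (F : FormalGroup R) {x y z : A} (hx : x ∈ maximalIdeal A)
    (hy : y ∈ maximalIdeal A) (hz : z ∈ maximalIdeal A) :
    fadd F (fadd F x y) z = fadd F x (fadd F y z) := by
  have ha : ∀ s, (![x, y, z] : Fin 3 → A) s ∈ maximalIdeal A := by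
    intro s; fin_cases s <;> simpa
  have hX : ∀ i : Fin 3, MvPowerSeries.constantCoeff
    (MvPowerSeries.X i : MvPowerSeries (Fin 3) R) = 0 := MvPowerSeries.constantCoeff_X
  have h := congrArg (evalMv ![x, y, z]) F.assoc
  rw [evalMv_subst_cons F ha (constantCoeff_subst_cons F (hX _) (hX _)) (hX _),
    evalMv_subst_cons F ha (hX _) (hX _),
    evalMv_subst_cons F ha (hX _) (constantCoeff_subst_cons F (hX _) (hX _)),
    evalMv_subst_cons F ha (hX _) (hX _)] at h
  simpa [evalMv_X] using h

lemma IsHom.ev_fadd {F G : FormalGroup R} {φ : PowerSeries R} (hφ : IsHom F G φ) {x y : A}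
    (hx : x ∈ maximalIdeal A) (hy : y ∈ maximalIdeal A) :
    ev φ (fadd F x y) = fadd G (ev φ x) (ev φ y) := by
  have ha := cons_mem_ideal hx hy
  have hφX : ∀ i : Fin 2, MvPowerSeries.constantCoeff
      (PowerSeries.subst (MvPowerSeries.X i : MvPowerSeries (Fin 2) R) φ) = 0 := fun i =>
    PowerSeries.constantCoeff_subst_eq_zero (MvPowerSeries.constantCoeff_X i) _
      hφ.constantCoeff_eq_zero
  have h := congrArg (evalMv ![x, y]) hφ.map_add
  rw [evalMv_subst_cons G ha (hφX 0) (hφX 1), evalMv_subst_X ha, evalMv_subst_X ha,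
    PowerSeries.subst,
    evalMv_subst ha (PowerSeries.HasSubst.of_constantCoeff_zero F.zero_constantCoeff).const] at h
  exact h

lemma eventually_sum_sub_fadd_mem (F : FormalGroup R) {x y : A} (hx : x ∈ maximalIdeal A)
    (hy : y ∈ maximalIdeal A) (k : ℕ) : ∀ᶠ N in atTop,
    ∑ i ∈ Finset.range N, ∑ j ∈ Finset.range N,
    algebraMap R A (MvPowerSeries.coeff (Finsupp.single 0 i + Finsupp.single 1 j) F.toPowerSeries)
      * x ^ i * y ^ j - fadd F x y ∈ maximalIdeal A ^ k := by
  have hinj : Function.Injective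
      fun q : ℕ × ℕ => (Finsupp.single (0 : Fin 2) q.1 + Finsupp.single 1 q.2) := fun q q' h =>
    Prod.ext (by simpa using DFunLike.congr_fun h 0) (by simpa using DFunLike.congr_fun h 1)
  have htendsto : Tendsto (fun N => (Finset.range N ×ˢ Finset.range N).map ⟨_, hinj⟩) atTop atTop :=
    Monotone.tendsto_atTop_finset
      (fun M N h => Finset.map_subset_map.2 (Finset.product_subset_product
        (Finset.range_subset_range.2 h) (Finset.range_subset_range.2 h)))
      fun d => ⟨d 0 + d 1 + 1, by
        refine Finset.mem_map.2 ⟨(d 0, d 1), ?_, Finsupp.ext fun i => ?_⟩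
        · rw [Finset.mem_product, Finset.mem_range, Finset.mem_range]
          omega
        · fin_cases i <;> simp⟩
  have hprod : ∀ i j, (Finsupp.single (0 : Fin 2) i + Finsupp.single 1 j).prod
      (fun s e => (![x, y] : Fin 2 → A) s ^ e) = x ^ i * y ^ j := fun i j => by
    rw [Finsupp.prod_fintype _ _ (by simp)]; simp
  filter_upwards [htendsto.eventually (eventually_sum_sub_evalMv_mem
    (cons_mem_ideal hx hy) F.toPowerSeries k)] with N hN
  simpa only [fadd, Finset.sum_map, Finset.sum_product, Function.Embedding.coeFn_mk, hprod,
    ← mul_assoc] using hN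

lemma exists_fadd_eq_add_mul (F : FormalGroup R) : ∃ g : MvPowerSeries (Fin 2) R,
    MvPowerSeries.constantCoeff g = 0 ∧ ∀ x ∈ maximalIdeal A, ∀ y ∈ maximalIdeal A,
      fadd F x y = x + y * (1 + evalMv ![x, y] g) := by
  obtain ⟨g, hg, hF⟩ := exists_formalGroup_eq_X_add_X_mul F
  refine ⟨g - 1, by simp [hg], fun x hx y hy => ?_⟩
  have ha := cons_mem_ideal hx hy
  have hg1 : evalMv ![x, y] g = 1 + evalMv ![x, y] (g - 1) := by
    rw [← evalMv_one (R := R) ha, ← evalMv_add ha, add_sub_cancel]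
  rw [fadd, hF, evalMv_add ha, evalMv_mul ha, evalMv_X, evalMv_X, hg1]
  rfl

lemma fadd_zero (F : FormalGroup R) {x : A} (hx : x ∈ maximalIdeal A) : fadd F x 0 = x := by
  obtain ⟨g, -, hg⟩ := exists_fadd_eq_add_mul (A := A) F
  rw [hg x hx 0 (zero_mem _), zero_mul, add_zero]

omit [IsLocalRing A] [IsAdicComplete (maximalIdeal A) A] in
lemma exists_fixedPoint_of_adic_contraction {I : Ideal A} [IsAdicComplete I A] {T : A → A}
    (hT : ∀ y ∈ I, T y ∈ I) (hc : ∀ k, ∀ y ∈ I, ∀ z ∈ I, y - z ∈ I ^ k → T y - T z ∈ I ^ (k + 1)) :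
    ∃ y ∈ I, T y = y := by
  have hmem : ∀ n, T^[n] 0 ∈ I := fun n => by
    induction n with
    | zero => exact zero_mem _
    | succ n ih => rw [Function.iterate_succ_apply']; exact hT _ ih
  have hstep : ∀ n, T^[n] 0 - T^[n + 1] 0 ∈ I ^ n := fun n => by
    induction n with
    | zero => simp
    | succ n ih =>
      rw [Function.iterate_succ_apply', Function.iterate_succ_apply']
      exact hc n _ (hmem _) _ (hmem _) ih
  obtain ⟨y, hy⟩ := IsPrecomplete.prec (I := I) (M := A) inferInstance
    (f := fun n => T^[n] 0) fun {a b} hab => by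
      induction b, hab using Nat.le_induction with
      | base => exact SModEq.refl _
      | succ b hab ih =>
        refine ih.trans (SModEq.sub_mem.2 ?_)
        simpa using Ideal.pow_le_pow_right hab (hstep b)
  have hy : ∀ n, T^[n] 0 - y ∈ I ^ n := fun n => by simpa [SModEq.sub_mem] using hy n
  have hyI : y ∈ I := by simpa using sub_mem (hmem 1) (by simpa using hy 1 : T^[1] 0 - y ∈ I)
  refine ⟨y, hyI, eq_of_forall_sub_mem_pow (I := I) fun n => ?_⟩
  have hTy : T^[n + 1] 0 - T y ∈ I ^ n := by
    rw [Function.iterate_succ_apply']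
    exact Ideal.pow_le_pow_right n.le_succ (hc n _ (hmem n) _ hyI (hy n))
  simpa using sub_mem (Ideal.pow_le_pow_right n.le_succ (hy (n + 1))) hTy

lemma exists_fadd_eq_zero (F : FormalGroup R) {x : A} (hx : x ∈ maximalIdeal A) :
    ∃ y ∈ maximalIdeal A, fadd F x y = 0 := by
  obtain ⟨g, hg0, hg⟩ := exists_fadd_eq_add_mul (A := A) F
  let c : A → A := fun y => evalMv ![x, y] g
  have hc : ∀ y ∈ maximalIdeal A, c y ∈ maximalIdeal A := fun y hy =>
    evalMv_mem (cons_mem_ideal hx hy) hg0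
  -- `F(x, y) = 0` says that `y` is fixed by `y ↦ y - F(x, y) = -x - y c(y)`.
  obtain ⟨y, hy, hfix⟩ := exists_fixedPoint_of_adic_contraction (I := maximalIdeal A)
    (T := fun y => -x - y * c y)
    (fun y hy => sub_mem (neg_mem hx) (Ideal.mul_mem_right _ _ hy)) fun k y hy z hz hyz => by
      have hcc : c z - c y ∈ maximalIdeal A ^ k := by
        refine evalMv_sub_mem_pow (cons_mem_ideal hx hz) (cons_mem_ideal hx hy)
          (fun s => ?_) g
        fin_cases s
        · simp
        · simpa using neg_mem hyz
      have hsplit : -x - y * c y - (-x - z * c z) = (c z - c y) * z - (y - z) * c y := by ring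
      rw [hsplit, pow_succ]
      exact sub_mem (Ideal.mul_mem_mul hcc hz) (Ideal.mul_mem_mul hyz (hc y hy))
  refine ⟨y, hy, ?_⟩
  rw [hg x hx y hy]
  linear_combination -hfix

variable (A) in
/-- The group of points of a formal group with values in the maximal ideal of `A`. -/
@[ext]
structure Points (F : FormalGroup R) where
  val : A
  mem : val ∈ maximalIdeal A

variable {F G : FormalGroup R}

namespace Points

instance : Zero (Points A F) := ⟨⟨0, zero_mem _⟩⟩

omit [Algebra R A] [IsAdicComplete (maximalIdeal A) A] in
@[simp] lemma val_zero : (0 : Points A F).1 = 0 := rfl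

instance : Add (Points A F) := ⟨fun x y => ⟨fadd F x.1 y.1, fadd_mem F x.2 y.2⟩⟩
instance : Neg (Points A F) := ⟨fun x =>
  ⟨(exists_fadd_eq_zero F x.2).choose, (exists_fadd_eq_zero F x.2).choose_spec.1⟩⟩

instance : AddGroup (Points A F) :=
  AddGroup.ofRightAxioms (fun x y z => Points.ext (fadd_assoc F x.2 y.2 z.2))
    (fun x => Points.ext (fadd_zero F x.2))
    (fun x => Points.ext (exists_fadd_eq_zero F x.2).choose_spec.2)

omit [Algebra R A] [IsAdicComplete (maximalIdeal A) A] in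
lemma val_eq_zero {x : Points A F} : x.1 = 0 ↔ x = 0 :=
  ⟨fun h => Points.ext h, fun h => by rw [h, val_zero]⟩

lemma exists_val_add_eq (x y : Points A F) :
    ∃ c ∈ maximalIdeal A, (∀ k, x.1 ∈ maximalIdeal A ^ k → y.1 ∈ maximalIdeal A ^ k →
      c ∈ maximalIdeal A ^ k) ∧ (x + y).1 = x.1 + y.1 * (1 + c) := by
  obtain ⟨g, hg0, hg⟩ := exists_fadd_eq_add_mul (A := A) F
  have hxy := cons_mem_ideal x.2 y.2
  exact ⟨evalMv ![x.1, y.1] g, evalMv_mem hxy hg0,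
    fun k hx hy => evalMv_mem_pow hxy (cons_mem_ideal hx hy) hg0, hg _ x.2 _ y.2⟩

lemma exists_val_nsmul_eq (x : Points A F) (k : ℕ) :
    ∃ c ∈ maximalIdeal A, (∀ l, x.1 ∈ maximalIdeal A ^ l → c ∈ maximalIdeal A ^ l) ∧
      (k • x).1 = x.1 * (k + c) := by
  induction k with
  | zero => exact ⟨0, zero_mem _, fun _ _ => zero_mem _, by simp⟩
  | succ k ih =>
    obtain ⟨c, hc, hcpow, hk⟩ := ih
    obtain ⟨c', hc', hcpow', hadd⟩ := exists_val_add_eq x (k • x)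
    refine ⟨c + (k + c) * c', add_mem hc (Ideal.mul_mem_left _ _ hc'), fun l hx => ?_, ?_⟩
    · exact add_mem (hcpow l hx)
        (Ideal.mul_mem_left _ _ (hcpow' l hx (hk ▸ Ideal.mul_mem_right _ _ hx)))
    · rw [succ_nsmul', hadd, hk]
      push_cast
      ring

/-- The homomorphism on points induced by a local homomorphism of coefficient rings. -/
def map (θ : A →ₐ[R] B) [IsLocalHom θ] : Points A F →+ Points B F :=
  AddMonoidHom.mk' (fun x => ⟨θ x.1, algHom_mem_maximalIdeal θ x.2⟩)
    fun x y => Points.ext (map_fadd θ F x.2 y.2)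

lemma val_map (θ : A →ₐ[R] B) [IsLocalHom θ] (x : Points A F) : (map θ x).1 = θ x.1 := rfl

end Points

/-- The homomorphism on points induced by a homomorphism of formal groups. -/
def IsHom.onPoints {φ : PowerSeries R} (hφ : IsHom F G φ) : Points A F →+ Points A G :=
  AddMonoidHom.mk' (fun x => ⟨ev φ x.1, ev_mem x.2 hφ.constantCoeff_eq_zero⟩)
    fun x y => Points.ext (hφ.ev_fadd x.2 y.2)

lemma IsHom.val_onPoints {φ : PowerSeries R} (hφ : IsHom F G φ) (x : Points A F) :
    (hφ.onPoints x).1 = ev φ x.1 := rfl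

end Points

section LocalRing

variable {A : Type*} [CommRing A] [IsLocalRing A]

lemma isUnit_add_of_isUnit_of_mem {u c : A} (hu : IsUnit u) (hc : c ∈ maximalIdeal A) :
    IsUnit (u + c) := by
  by_contra h
  have hmem := sub_mem ((mem_maximalIdeal _).2 h) hc
  rw [add_sub_cancel_right] at hmem
  exact (mem_maximalIdeal _).1 hmem hu

lemma isUnit_natCast_of_coprime {p k : ℕ} (hp : (p : A) ∈ maximalIdeal A) (h : p.Coprime k) :
    IsUnit (k : A) := by
  obtain ⟨a, b, hab⟩ := (Nat.isCoprime_iff_coprime.2 h).map (Int.castRingHom A)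
  simp only [eq_intCast, Int.cast_natCast] at hab
  have hu := isUnit_add_of_isUnit_of_mem isUnit_one (neg_mem (Ideal.mul_mem_left _ (a : A) hp))
  rw [← hab, add_comm ((a : A) * p), add_neg_cancel_right] at hu
  exact isUnit_of_mul_isUnit_right hu

end LocalRing

section Valuation

open IsDiscreteValuationRing hiding maximalIdeal

variable {R : Type*} [CommRing R] {A : Type*} [CommRing A] [IsDomain A]
  [IsDiscreteValuationRing A] [Algebra R A] [IsAdicComplete (maximalIdeal A) A]
  {F : FormalGroup R}

namespace Points

lemma addVal_val_add_sub (x d : Points A F) :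
    addVal A ((x + d).1 - x.1) = addVal A d.1 := by
  obtain ⟨c, hc, -, h⟩ := exists_val_add_eq x d
  rw [h, add_sub_cancel_left, addVal_mul,
    addVal_eq_zero_iff.2 (isUnit_add_of_isUnit_of_mem isUnit_one hc), add_zero]

lemma addVal_nsmul_of_isUnit (x : Points A F) {k : ℕ} (hk : IsUnit (k : A)) :
    addVal A (k • x).1 = addVal A x.1 := by
  obtain ⟨c, hc, -, h⟩ := exists_val_nsmul_eq x k
  rw [h, addVal_mul, addVal_eq_zero_iff.2 (isUnit_add_of_isUnit_of_mem hk hc), add_zero]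

lemma addVal_lt_addVal_nsmul {x : Points A F} (hx : x ≠ 0) {k : ℕ}
    (hk : (k : A) ∈ maximalIdeal A) : addVal A x.1 < addVal A (k • x).1 := by
  obtain ⟨c, hc, -, h⟩ := exists_val_nsmul_eq x k
  have hx' : addVal A x.1 ≠ ⊤ := by rwa [Ne, addVal_eq_top_iff, val_eq_zero]
  have hkc : addVal A ((k : A) + c) ≠ 0 := by
    rw [Ne, addVal_eq_zero_iff]
    exact (mem_maximalIdeal _).1 (add_mem hk hc)
  rw [h, addVal_mul]
  simpa using (ENat.add_lt_add_iff_left hx').2 (pos_iff_ne_zero.2 hkc)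

end Points

end Valuation

/-! ### Isogenies of height one -/

section Height

variable {R : Type*} [CommRing R]

open Polynomial in
lemma exists_weierstrass [IsLocalRing R] [IsAdicComplete (maximalIdeal R) R] {g : PowerSeries R}
    {d : ℕ} (hd : PowerSeries.coeff d g ∉ maximalIdeal R)
    (hlt : ∀ i < d, PowerSeries.coeff i g ∈ maximalIdeal R) :
    ∃ (f : R[X]) (h : PowerSeries R), f.Monic ∧ f.natDegree = d ∧
      (∀ i < d, f.coeff i ∈ maximalIdeal R) ∧ IsUnit h ∧ g = f * h := by
  have hord : (g.map (residue R)).order = d := by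
    simpa only [PowerSeries.order_eq_nat, PowerSeries.coeff_map, Ne, residue_eq_zero_iff]
      using ⟨hd, hlt⟩
  have hne : g.map (residue R) ≠ 0 := fun h => by simp [h] at hord
  obtain ⟨f, h, H⟩ := PowerSeries.exists_isWeierstrassFactorization hne
  have hdeg : f.natDegree = d := by rw [H.natDegree_eq_toNat_order_map, hord]; rfl
  exact ⟨f, h, H.isDistinguishedAt.monic, hdeg,
    fun i hi => H.isDistinguishedAt.mem (hdeg ▸ hi), H.isUnit, H.eq_mul⟩

section Coefficients

variable [IsLocalRing R] {p h : ℕ} {φ : PowerSeries R}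

lemma HasHeight.coeff_pow_notMem (hφ : HasHeight p h φ) (hp : p ≠ 0) :
    PowerSeries.coeff (p ^ h) φ ∉ maximalIdeal R := by
  obtain ⟨ψ, hψ, hc⟩ := hφ
  intro hmem
  have hψmem := sub_mem hmem (hc (p ^ h))
  rw [PowerSeries.coeff_subst_X_pow (pow_ne_zero h hp), if_pos dvd_rfl, sub_sub_cancel,
    Nat.div_self (pow_pos (Nat.pos_of_ne_zero hp) h)] at hψmem
  exact (mem_maximalIdeal _).1 hψmem hψ

lemma HasHeight.coeff_mem_of_lt (hφ : HasHeight p h φ) (h0 : PowerSeries.constantCoeff φ = 0)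
    {i : ℕ} (hi : i < p ^ h) : PowerSeries.coeff i φ ∈ maximalIdeal R := by
  obtain ⟨ψ, -, hc⟩ := hφ
  rcases Nat.eq_zero_or_pos i with rfl | hi0
  · simp [h0]
  · simpa [PowerSeries.coeff_subst_X_pow (Nat.ne_zero_of_lt hi), Nat.not_dvd_of_pos_of_lt hi0 hi]
      using hc i

end Coefficients

open IsDiscreteValuationRing hiding maximalIdeal

section AddVal

variable {A : Type*} [CommRing A] [IsDomain A] [IsDiscreteValuationRing A] {a b : A}

lemma addVal_add_eq_of_lt (h : addVal A a < addVal A b) : addVal A (a + b) = addVal A a :=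
  AddValuation.map_add_eq_of_lt_left _ h

lemma natCast_le_addVal_iff {n : ℕ} : n ≤ addVal A a ↔ a ∈ maximalIdeal A ^ n := by
  obtain ⟨ϖ, hϖ⟩ := exists_irreducible A
  rw [hϖ.maximalIdeal_eq, Ideal.span_singleton_pow, Ideal.mem_span_singleton,
    ← addVal_le_iff_dvd, addVal_pow, addVal_uniformizer hϖ]
  simp

lemma one_le_addVal_iff : 1 ≤ addVal A a ↔ a ∈ maximalIdeal A := by
  simpa using natCast_le_addVal_iff (a := a) (n := 1)

lemma exists_nat_addVal (h : a ≠ 0) : ∃ n : ℕ, addVal A a = n :=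
  (ENat.ne_top_iff_exists.1 (addVal_eq_top_iff.not.2 h)).imp fun _ => Eq.symm

lemma addVal_prod {ι : Type*} (s : Finset ι) (f : ι → A) :
    addVal A (∏ k ∈ s, f k) = ∑ k ∈ s, addVal A (f k) := by
  classical
  induction s using Finset.induction_on with
  | empty => simp
  | insert a s ha ih => rw [Finset.prod_insert ha, Finset.sum_insert ha, addVal_mul, ih]

variable [IsAdicComplete (maximalIdeal A) A]

lemma Points.addVal_nsmul_of_lt [Algebra R A] {F : FormalGroup R} {x : Points A F} {k n : ℕ}
    (hx : addVal A x.1 = n) (h : addVal A (k : A) < n) :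
    addVal A (k • x).1 = n + addVal A (k : A) := by
  obtain ⟨c, -, hc, hk⟩ := x.exists_val_nsmul_eq k
  rw [hk, addVal_mul, hx, addVal_add_eq_of_lt
    (h.trans_le (natCast_le_addVal_iff.2 (hc n (natCast_le_addVal_iff.1 hx.ge))))]

lemma exists_addVal_ev_eq {φ : PowerSeries A} (hne : φ ≠ 0)
    (h0 : PowerSeries.constantCoeff φ = 0) : ∃ k c : ℕ, 1 ≤ k ∧ PowerSeries.coeff k φ ≠ 0 ∧
      ∀ y : A, ∀ n : ℕ, addVal A y = n → c < n → addVal A (ev φ y) = (k * n + c : ℕ) := by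
  obtain ⟨g, hg⟩ := PowerSeries.X_pow_order_dvd (φ := φ)
  set k := φ.order.toNat
  have hk : PowerSeries.coeff k φ ≠ 0 := PowerSeries.coeff_order hne
  have hgk : PowerSeries.constantCoeff g = PowerSeries.coeff k φ := by
    rw [hg, PowerSeries.coeff_X_pow_mul', if_pos le_rfl, Nat.sub_self,
      PowerSeries.coeff_zero_eq_constantCoeff]
  obtain ⟨c, hc⟩ := exists_nat_addVal hk
  refine ⟨k, c, Nat.one_le_iff_ne_zero.2 fun hk0 => ?_, hk, fun y n hn hcn => ?_⟩
  · exact hk (by rw [hk0, PowerSeries.coeff_zero_eq_constantCoeff, h0])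
  have hy : y ∈ maximalIdeal A := by
    rw [← one_le_addVal_iff, hn]
    exact_mod_cast Nat.one_le_of_lt hcn
  obtain ⟨b, hb⟩ := exists_ev_eq_constantCoeff_add_mul hy g
  have hlt : addVal A (PowerSeries.coeff k φ) < addVal A (y * b) := by
    rw [addVal_mul, hc, hn]
    exact lt_of_lt_of_le (by exact_mod_cast hcn) le_self_add
  have hev : ev φ y = y ^ k * (PowerSeries.coeff k φ + y * b) := by
    have hpow : ev (PowerSeries.X ^ k : PowerSeries A) y = y ^ k := by
      rw [← evHom_apply y hy, map_pow, evHom_apply, ev_X]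
    rw [congrArg (ev · y) hg, ev_mul hy, hpow, hb, hgk, Algebra.algebraMap_self_apply]
  rw [hev, addVal_mul, addVal_pow, addVal_add_eq_of_lt hlt, hn, hc]
  push_cast
  rw [nsmul_eq_mul]

/-- On points of large valuation `n`, multiplication by a nonunit `l` acts by `n ↦ n + v(l)` and
`φ` by `n ↦ k n + c`, where `k` is the order of `φ`; these maps commute only for `k = 1`. -/
lemma IsHom.coeff_one_ne_zero {F G : FormalGroup A} {φ : PowerSeries A} (hφ : IsHom F G φ)
    (hne : φ ≠ 0) {l : ℕ} (hl : (l : A) ∈ maximalIdeal A) (hl0 : (l : A) ≠ 0) :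
    PowerSeries.coeff 1 φ ≠ 0 := by
  obtain ⟨k, c, hk, hcoeff, hev⟩ := exists_addVal_ev_eq hne hφ.constantCoeff_eq_zero
  obtain ⟨e, he⟩ := exists_nat_addVal hl0
  have he1 : 1 ≤ e := by
    have := one_le_addVal_iff.2 hl
    rw [he] at this
    exact_mod_cast this
  have hmul : ∀ (H : FormalGroup A) (y : Points A H), ∀ n : ℕ, addVal A y.1 = n → e < n →
      addVal A (l • y).1 = (n + e : ℕ) := fun H y n hn hen => by
    rw [Points.addVal_nsmul_of_lt hn (by rw [he]; exact_mod_cast hen), he]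
    norm_cast
  obtain ⟨ϖ, hϖ⟩ := exists_irreducible A
  let x : Points A F := ⟨ϖ ^ (c + e + 1), by
    simpa [hϖ.maximalIdeal_eq] using
      Ideal.mem_span_singleton.2 (dvd_pow_self ϖ (Nat.succ_ne_zero _))⟩
  have hx : addVal A x.1 = (c + e + 1 : ℕ) := by
    rw [addVal_pow, addVal_uniformizer hϖ]
    simp
  have hkn : c + e + 1 ≤ k * (c + e + 1) := Nat.le_mul_of_pos_left _ hk
  have h₁ := hev (l • x).1 _ (hmul F x _ hx (by omega)) (by omega)
  have h₂ := hmul G (hφ.onPoints x) _ (hev x.1 _ hx (by omega)) (by omega)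
  rw [← map_nsmul, hφ.val_onPoints, h₁] at h₂
  have hcomm : k * (c + e + 1 + e) + c = k * (c + e + 1) + c + e := by exact_mod_cast h₂
  have hk1 : k = 1 := Nat.eq_of_mul_eq_mul_right he1 (by
    rw [mul_add k (c + e + 1) e] at hcomm
    omega)
  rwa [hk1] at hcoeff

end AddVal

section Kernel

variable [IsDomain R] [IsLocalRing R] [IsAdicComplete (maximalIdeal R) R]

open Polynomial in
lemma exists_eq_prod_mul {φ : PowerSeries R} {d : ℕ}
    (hd : PowerSeries.coeff d φ ∉ maximalIdeal R)
    (hlt : ∀ i < d, PowerSeries.coeff i φ ∈ maximalIdeal R) {s : Finset R} (hs : s.card = d)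
    (hmem : ∀ a ∈ s, a ∈ maximalIdeal R) (hzero : ∀ a ∈ s, ev φ a = 0) :
    ∃ h : PowerSeries R, IsUnit h ∧ φ = ((∏ a ∈ s, (X - C a) : R[X]) : PowerSeries R) * h := by
  obtain ⟨f, h, hf, hdeg, -, hu, hfh⟩ := exists_weierstrass hd hlt
  have hroot : ∀ a ∈ s, a ∈ f.roots := fun a ha => by
    have hev := hzero a ha
    rw [hfh, ev_mul (hmem a ha), (isUnit_ev (hmem a ha) hu).mul_left_eq_zero, ev_coe (hmem a ha),
      coe_aeval_eq_eval] at hev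
    exact (mem_roots hf.ne_zero).2 hev
  have hmonic : (∏ a ∈ s, (X - C a)).Monic := monic_prod_of_monic _ _ fun a _ => monic_X_sub_C a
  have hdvd : (∏ a ∈ s, (X - C a)) ∣ f :=
    (Multiset.prod_X_sub_C_dvd_iff_le_roots hf.ne_zero s.1).2
      ((Multiset.le_iff_subset s.2).2 hroot)
  refine ⟨h, hu, ?_⟩
  rw [hfh, eq_of_monic_of_dvd_of_natDegree_le hmonic hf hdvd]
  rw [hdeg, natDegree_prod_of_monic _ _ fun a _ => monic_X_sub_C a]
  simp [hs]

lemma IsIsogeny.exists_eq_prod {p h : ℕ} {F G : FormalGroup R} {φ : PowerSeries R}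
    (hφ : IsIsogeny p h F G φ) (hp : p ≠ 0) {z : Points R F}
    (hinj : Set.InjOn (fun k : ℕ => k • z) (Set.Iio (p ^ h))) (hz0 : ev φ z.1 = 0) :
    ∃ f : PowerSeries R, IsUnit f ∧ φ = ((∏ k ∈ Finset.range (p ^ h),
      (Polynomial.X - Polynomial.C ((k • z).1)) : Polynomial R) : PowerSeries R) * f := by
  classical
  have hinj' : Set.InjOn (fun k : ℕ => (k • z).1) (Finset.range (p ^ h)) := fun k hk l hl hkl =>
    hinj (by simpa using hk) (by simpa using hl) (Points.ext hkl)
  have hker : ∀ k : ℕ, ev φ (k • z).1 = 0 := fun k => by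
    rw [← hφ.isHom.val_onPoints, map_nsmul, show hφ.isHom.onPoints z = 0 from Points.ext hz0,
      nsmul_zero, Points.val_zero]
  obtain ⟨f, hu, hφf⟩ := exists_eq_prod_mul (hφ.hasHeight.coeff_pow_notMem hp)
    (fun i hi => hφ.hasHeight.coeff_mem_of_lt hφ.isHom.constantCoeff_eq_zero hi)
    (s := (Finset.range (p ^ h)).image fun k => (k • z).1)
    (by rw [Finset.card_image_of_injOn hinj', Finset.card_range])
    (by simpa using fun k _ => (k • z).2) (by simpa using fun k _ => hker k)
  exact ⟨f, hu, by rwa [Finset.prod_image hinj'] at hφf⟩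

end Kernel

section HeightOne

variable {A : Type*} [CommRing A] [IsDomain A] [IsDiscreteValuationRing A]
  [IsAdicComplete (maximalIdeal A) A] {p : ℕ} [Fact p.Prime] [CharP (ResidueField A) p]
  {F G : FormalGroup A} {φ : PowerSeries A} {z : Points A F}

omit [IsDomain A] [IsDiscreteValuationRing A] [IsAdicComplete (maximalIdeal A) A]
  [Fact p.Prime] [CharP (ResidueField A) p] in
variable (A p) in
lemma natCast_mem_maximalIdeal [IsLocalRing A] [CharP (ResidueField A) p] :
    (p : A) ∈ maximalIdeal A := by
  rw [← residue_eq_zero_iff, map_natCast, CharP.cast_eq_zero]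

variable (p) in
lemma Points.addVal_nsmul_of_lt_prime (z : Points A F) {k : ℕ} (hk0 : k ≠ 0) (hk : k < p) :
    addVal A (k • z).1 = addVal A z.1 :=
  z.addVal_nsmul_of_isUnit (isUnit_natCast_of_coprime (natCast_mem_maximalIdeal A p)
    (Nat.coprime_of_lt_prime hk0 hk Fact.out))

lemma Points.injOn_nsmul (hz : z ≠ 0) : Set.InjOn (fun k : ℕ => k • z) (Set.Iio p) := by
  have hne : ∀ k l : ℕ, k < l → l < p → k • z ≠ l • z := fun k l hkl hl h => by
    have hval := z.addVal_nsmul_of_lt_prime p (k := l - k) (by omega) (by omega)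
    rw [← Nat.add_sub_cancel' hkl.le, add_nsmul, left_eq_add] at h
    rw [h, val_zero, addVal_zero, eq_comm, addVal_eq_top_iff, val_eq_zero] at hval
    exact hz hval
  intro k hk l hl h
  by_contra hkl
  rcases lt_or_gt_of_ne hkl with hlt | hlt
  · exact hne k l hlt hl h
  · exact hne l k hlt hk h.symm

lemma IsIsogeny.exists_eq_prod_of_ne_zero (hφ : IsIsogeny p 1 F G φ) (hz : z ≠ 0)
    (hz0 : ev φ z.1 = 0) :
    ∃ h : PowerSeries A, IsUnit h ∧ φ = ((∏ k ∈ Finset.range p,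
      (Polynomial.X - Polynomial.C ((k • z).1)) : Polynomial A) : PowerSeries A) * h := by
  simpa only [pow_one] using hφ.exists_eq_prod (Fact.out : p.Prime).ne_zero
    (by simpa only [pow_one] using Points.injOn_nsmul hz) hz0

lemma IsIsogeny.addVal_coeff_one (hφ : IsIsogeny p 1 F G φ) (hz : z ≠ 0) (hz0 : ev φ z.1 = 0) :
    addVal A (PowerSeries.coeff 1 φ) = (p - 1 : ℕ) * addVal A z.1 := by
  obtain ⟨h, hu, hφh⟩ := hφ.exists_eq_prod_of_ne_zero hz hz0
  have hp : p - 1 + 1 = p := Nat.sub_add_cancel (Fact.out : p.Prime).one_le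
  have hcoeff : PowerSeries.coeff 1 φ =
      (∏ k ∈ Finset.range (p - 1), -((k + 1) • z).1) * PowerSeries.constantCoeff h := by
    rw [← hp, Finset.prod_range_succ'] at hφh
    simp only [zero_nsmul, Points.val_zero, map_zero, sub_zero, Polynomial.coe_mul,
      Polynomial.coe_X] at hφh
    rw [hφh, mul_right_comm, ← zero_add 1, PowerSeries.coeff_succ_mul_X,
      PowerSeries.coeff_zero_eq_constantCoeff, map_mul,
      ← PowerSeries.coeff_zero_eq_constantCoeff_apply, Polynomial.coeff_coe,
      Polynomial.coeff_zero_prod]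
    simp
  have hval : ∀ k ∈ Finset.range (p - 1), addVal A (-((k + 1) • z).1) = addVal A z.1 :=
    fun k hk => by
      rw [AddValuation.map_neg]
      exact z.addVal_nsmul_of_lt_prime p k.succ_ne_zero (by rw [Finset.mem_range] at hk; omega)
  rw [hcoeff, addVal_mul, addVal_eq_zero_iff.2 (hu.map _), add_zero, addVal_prod,
    Finset.sum_congr rfl hval]
  simp

end HeightOne

end Height

/-! ### Chains of isogenies of height one -/

section Chain

variable {R A : Type*} [CommRing R] [CommRing A] [IsLocalRing A] [Algebra R A]
  [IsAdicComplete (maximalIdeal A) A] {φs : ℕ → PowerSeries R} {n i : ℕ} {a : A}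

lemma ev_comp_succ (ha : a ∈ maximalIdeal A) {k : ℕ}
    (hc : PowerSeries.constantCoeff (φs (i + k + 1)) = 0) :
    ev (comp φs i (k + 1)) a = ev (comp φs i k) (ev (φs (i + k + 1)) a) :=
  ev_subst ha hc _

lemma ev_comp_succ' (hc : ∀ i < n, PowerSeries.constantCoeff (φs (i + 1)) = 0) {k : ℕ}
    (hik : i + k < n) (ha : a ∈ maximalIdeal A) :
    ev (comp φs i (k + 1)) a = ev (φs (i + 1)) (ev (comp φs (i + 1) k) a) := by
  induction k generalizing a with
  | zero =>
    rw [ev_comp_succ ha (hc _ hik)]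
    simp only [comp, ev_X, Nat.add_zero]
  | succ k ih =>
    have hidx : i + (k + 1) + 1 = i + 1 + k + 1 := by omega
    rw [ev_comp_succ ha (hc _ hik), ih (by omega) (ev_mem ha (hc _ hik)), hidx,
      ev_comp_succ ha (hidx ▸ hc _ hik)]

/-- The image of the point `a` of `Gₙ` in `Gᵢ`, under `φ_{i+1} ∘ ⋯ ∘ φₙ`. -/
def chain (φs : ℕ → PowerSeries R) (n i : ℕ) (a : A) : A := ev (comp φs i (n - i)) a

omit [IsAdicComplete (maximalIdeal A) A] in
lemma chain_self (a : A) : chain φs n n a = a := by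
  rw [chain, Nat.sub_self]
  exact ev_X a

lemma chain_eq_ev_chain_succ (hc : ∀ i < n, PowerSeries.constantCoeff (φs (i + 1)) = 0)
    (hi : i < n) (ha : a ∈ maximalIdeal A) :
    chain φs n i a = ev (φs (i + 1)) (chain φs n (i + 1) a) := by
  rw [chain, show n - i = n - (i + 1) + 1 by omega, ev_comp_succ' hc (by omega) ha]
  rfl

lemma chain_mem (hc : ∀ i < n, PowerSeries.constantCoeff (φs (i + 1)) = 0) (hi : i ≤ n)
    (ha : a ∈ maximalIdeal A) : chain φs n i a ∈ maximalIdeal A := by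
  induction hi using Nat.decreasingInduction with
  | of_succ i hi ih =>
    rw [chain_eq_ev_chain_succ hc hi ha]
    exact ev_mem ih (hc i hi)
  | self => rwa [chain_self]

variable {Gs : ℕ → FormalGroup R}

lemma chain_fadd (hom : ∀ i < n, IsHom (Gs (i + 1)) (Gs i) (φs (i + 1))) (hi : i ≤ n) {b : A}
    (ha : a ∈ maximalIdeal A) (hb : b ∈ maximalIdeal A) :
    chain φs n i (fadd (Gs n) a b) = fadd (Gs i) (chain φs n i a) (chain φs n i b) := by
  have hc := fun i hi => (hom i hi).constantCoeff_eq_zero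
  induction hi using Nat.decreasingInduction with
  | of_succ i hi ih =>
    rw [chain_eq_ev_chain_succ hc hi (fadd_mem _ ha hb), ih, chain_eq_ev_chain_succ hc hi ha,
      chain_eq_ev_chain_succ hc hi hb,
      (hom i hi).ev_fadd (chain_mem hc hi ha) (chain_mem hc hi hb)]
  | self => simp only [chain_self]

variable (A) in
/-- `φ_{i+1} ∘ ⋯ ∘ φₙ` as a homomorphism between the groups of points of `Gₙ` and `Gᵢ`. -/
def chainHom (hom : ∀ i < n, IsHom (Gs (i + 1)) (Gs i) (φs (i + 1))) (hi : i ≤ n) :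
    Points A (Gs n) →+ Points A (Gs i) :=
  AddMonoidHom.mk' (fun x => ⟨chain φs n i x.1,
    chain_mem (fun i hi => (hom i hi).constantCoeff_eq_zero) hi x.2⟩)
    fun x y => Points.ext (chain_fadd hom hi x.2 y.2)

lemma val_chainHom (hom : ∀ i < n, IsHom (Gs (i + 1)) (Gs i) (φs (i + 1))) (hi : i ≤ n)
    (x : Points A (Gs n)) : (chainHom A hom hi x).1 = chain φs n i x.1 := rfl

end Chain

section Valuation

open IsDiscreteValuationRing hiding maximalIdeal

variable {R : Type*} [CommRing R] [IsDomain R] [IsDiscreteValuationRing R]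
  [IsAdicComplete (maximalIdeal R) R] {p : ℕ} [Fact p.Prime] [CharP (ResidueField R) p]
  {A : Type*} [CommRing A] [IsDomain A] [IsDiscreteValuationRing A] [Algebra R A]
  [IsAdicComplete (maximalIdeal A) A] {e : ℕ}
  {F G : FormalGroup R} {φ : PowerSeries R} {z : Points R F} {a : A}

lemma IsIsogeny.addVal_ev (hφ : IsIsogeny p 1 F G φ) (hz : z ≠ 0) (hz0 : ev φ z.1 = 0)
    (ha : a ∈ maximalIdeal A) :
    addVal A (ev φ a) = ∑ k ∈ Finset.range p, addVal A (a - algebraMap R A (k • z).1) := by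
  obtain ⟨h, hu, hφh⟩ := hφ.exists_eq_prod_of_ne_zero hz hz0
  rw [hφh, ev_mul ha, ev_coe ha, addVal_mul, addVal_eq_zero_iff.2 (isUnit_ev ha hu), add_zero,
    map_prod, addVal_prod]
  simp

lemma IsIsogeny.addVal_ev_of_lt (hφ : IsIsogeny p 1 F G φ)
    (he : ∀ r : R, addVal A (algebraMap R A r) = e * addVal R r) (hz : z ≠ 0)
    (hz0 : ev φ z.1 = 0) (ha : a ∈ maximalIdeal A) (hlt : addVal A a < e * addVal R z.1) :
    addVal A (ev φ a) = p * addVal A a := by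
  have hterm : ∀ k ∈ Finset.range p,
      addVal A (a - algebraMap R A (k • z).1) = addVal A a := fun k hk => by
    rcases eq_or_ne k 0 with rfl | hk0
    · simp
    · rw [sub_eq_add_neg, addVal_add_eq_of_lt]
      rwa [AddValuation.map_neg, he, z.addVal_nsmul_of_lt_prime p hk0 (Finset.mem_range.1 hk)]
  rw [hφ.addVal_ev hz hz0 ha, Finset.sum_congr rfl hterm]
  simp

lemma IsIsogeny.addVal_lt_of_addVal_ev_lt (hφ : IsIsogeny p 1 F G φ)
    (he : ∀ r : R, addVal A (algebraMap R A r) = e * addVal R r) (hz : z ≠ 0)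
    (hz0 : ev φ z.1 = 0) (ha : a ∈ maximalIdeal A)
    (hlt : addVal A (ev φ a) < p * (e * addVal R z.1)) : addVal A a < e * addVal R z.1 := by
  contrapose! hlt with hge
  have hterm : ∀ k ∈ Finset.range p,
      e * addVal R z.1 ≤ addVal A (a - algebraMap R A (k • z).1) := fun k hk => by
    rcases eq_or_ne k 0 with rfl | hk0
    · simpa using hge
    · refine le_trans (le_min hge ?_) ((addVal A).map_sub _ _)
      rw [he, z.addVal_nsmul_of_lt_prime p hk0 (Finset.mem_range.1 hk)]
  rw [hφ.addVal_ev hz hz0 ha]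
  simpa using Finset.card_nsmul_le_sum _ _ _ hterm

end Valuation

section KernelGenerator

open IsDiscreteValuationRing hiding maximalIdeal

variable {R : Type*} [CommRing R] [IsDomain R] [IsDiscreteValuationRing R]
  [IsAdicComplete (maximalIdeal R) R] {p n : ℕ} {Gs : ℕ → FormalGroup R}
  {φs : ℕ → PowerSeries R}

/-- The point `x₀` of `Gₙ` generates the kernel of `φ₁ ∘ ⋯ ∘ φₙ`, as a cyclic group of order `pⁿ`,
in such a way that `[pʲ] x₀` generates the kernel of `φ_{j+1} ∘ ⋯ ∘ φₙ`. -/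
structure IsKernelGenerator (p n : ℕ) (Gs : ℕ → FormalGroup R) (φs : ℕ → PowerSeries R)
    (x₀ : Points R (Gs n)) : Prop where
  isIsogeny : ∀ i < n, IsIsogeny p 1 (Gs (i + 1)) (Gs i) (φs (i + 1))
  pow_nsmul : p ^ n • x₀ = 0
  chain_ne_zero : ∀ j < n, chain φs n (j + 1) (p ^ j • x₀).1 ≠ 0
  chain_eq_zero : ∀ j < n, chain φs n j (p ^ j • x₀).1 = 0

/-- The valuation of the image of `[pʲ] x₀` in `G_{j+1}`, which generates the kernel of `φ_{j+1}`
when `x₀` generates the kernel of `φ₁ ∘ ⋯ ∘ φₙ`. -/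
def level (p : ℕ) (φs : ℕ → PowerSeries R) (x₀ : Points R (Gs n)) (j : ℕ) : ℕ :=
  (addVal R (chain φs n (j + 1) (p ^ j • x₀).1)).toNat

namespace IsKernelGenerator

variable {x₀ : Points R (Gs n)} (H : IsKernelGenerator p n Gs φs x₀) {i j : ℕ}
include H

lemma isHom : ∀ i < n, IsHom (Gs (i + 1)) (Gs i) (φs (i + 1)) :=
  fun i hi => (H.isIsogeny i hi).isHom

lemma constantCoeff : ∀ i < n, PowerSeries.constantCoeff (φs (i + 1)) = 0 :=
  fun i hi => (H.isHom i hi).constantCoeff_eq_zero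

/-- The generator of the kernel of `φ_{j+1}`. -/
def generator (hj : j < n) : Points R (Gs (j + 1)) := chainHom R H.isHom hj (p ^ j • x₀)

lemma generator_ne_zero (hj : j < n) : H.generator hj ≠ 0 :=
  Points.val_eq_zero.not.1 (H.chain_ne_zero j hj)

lemma ev_generator (hj : j < n) : ev (φs (j + 1)) (H.generator hj).1 = 0 := by
  rw [generator, val_chainHom, ← chain_eq_ev_chain_succ H.constantCoeff hj (p ^ j • x₀).2]
  exact H.chain_eq_zero j hj

lemma addVal_generator (hj : j < n) : addVal R (H.generator hj).1 = level p φs x₀ j := by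
  obtain ⟨s, hs⟩ := exists_nat_addVal (H.chain_ne_zero j hj)
  rw [generator, val_chainHom, level, hs, ENat.toNat_natCast]

variable [Fact p.Prime] [CharP (ResidueField R) p]

lemma t_eq (hj : j < n) : t φs (j + 1) = (p - 1) * level p φs x₀ j := by
  rw [t, (H.isIsogeny j hj).addVal_coeff_one (H.generator_ne_zero hj) (H.ev_generator hj),
    H.addVal_generator hj]
  norm_cast

lemma level_lt (hj : j + 1 < n) : level p φs x₀ j < p * level p φs x₀ (j + 1) := by
  have hp := (Fact.out : p.Prime).pos
  set y : Points R (Gs (j + 2)) := chainHom R H.isHom hj (p ^ j • x₀)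
  have hy : p • y = H.generator hj := by
    rw [generator, pow_succ, mul_nsmul, map_nsmul]
  have hev : ev (φs (j + 2)) y.1 = (H.generator (j.lt_succ_self.trans hj)).1 :=
    (chain_eq_ev_chain_succ H.constantCoeff hj (p ^ j • x₀).2).symm
  have hy0 : y ≠ 0 := fun h => H.generator_ne_zero hj (by rw [← hy, h, nsmul_zero])
  have hlt := Points.addVal_lt_addVal_nsmul hy0 (natCast_mem_maximalIdeal R p)
  rw [hy] at hlt
  have hval := (H.isIsogeny (j + 1) hj).addVal_ev_of_lt (A := R) (e := 1) (by simp)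
    (H.generator_ne_zero hj) (H.ev_generator hj) y.2 (by simpa using hlt)
  obtain ⟨v, hv⟩ := exists_nat_addVal (Points.val_eq_zero.not.2 hy0)
  rw [hev, H.addVal_generator, hv] at hval
  rw [hv, H.addVal_generator] at hlt
  rw [show level p φs x₀ j = p * v by exact_mod_cast hval]
  exact Nat.mul_lt_mul_of_pos_left (by exact_mod_cast hlt) hp

variable {A : Type*} [CommRing A] [IsDomain A] [IsDiscreteValuationRing A] [Algebra R A]
  [IsAdicComplete (maximalIdeal A) A] {e : ℕ} {a : A}

lemma addVal_chain_succ (he : ∀ r : R, addVal A (algebraMap R A r) = e * addVal R r)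
    (ha : a ∈ maximalIdeal A) (hj : j < n)
    (hlt : addVal A (chain φs n j a) < (p * (e * level p φs x₀ j) : ℕ)) :
    addVal A (chain φs n j a) = p * addVal A (chain φs n (j + 1) a) ∧
      addVal A (chain φs n (j + 1) a) < (e * level p φs x₀ j : ℕ) := by
  push_cast at hlt ⊢
  have hmem := chain_mem H.constantCoeff (Nat.succ_le_of_lt hj) ha
  rw [chain_eq_ev_chain_succ H.constantCoeff hj ha, ← H.addVal_generator hj] at hlt ⊢
  have hlt' := (H.isIsogeny j hj).addVal_lt_of_addVal_ev_lt he (H.generator_ne_zero hj)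
    (H.ev_generator hj) hmem hlt
  exact ⟨(H.isIsogeny j hj).addVal_ev_of_lt he (H.generator_ne_zero hj) (H.ev_generator hj) hmem
    hlt', hlt'⟩

lemma addVal_chain_add (he : ∀ r : R, addVal A (algebraMap R A r) = e * addVal R r) (he0 : e ≠ 0)
    (ha : a ∈ maximalIdeal A)
    (hlt : i < n → addVal A (chain φs n i a) < (p * (e * level p φs x₀ i) : ℕ)) {l : ℕ}
    (hl : i + l ≤ n) :
    addVal A (chain φs n i a) = (p ^ l : ℕ) * addVal A (chain φs n (i + l) a) ∧
      (i + l < n → addVal A (chain φs n (i + l) a) < (p * (e * level p φs x₀ (i + l)) : ℕ)) := by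
  induction l with
  | zero => exact ⟨by simp, hlt⟩
  | succ l ih =>
    obtain ⟨hval, hbound⟩ := ih (by omega)
    obtain ⟨hsucc, hlt_succ⟩ := H.addVal_chain_succ he ha (by omega) (hbound (by omega))
    refine ⟨by rw [hval, hsucc, pow_succ, Nat.cast_mul, mul_assoc]; rfl, fun hl' =>
      hlt_succ.trans ?_⟩
    rw [Nat.cast_lt, mul_left_comm]
    exact Nat.mul_lt_mul_of_pos_left (H.level_lt (by omega)) (Nat.pos_of_ne_zero he0)

lemma level_eq (hj : j < n) :
    (level p φs x₀ j : ℕ∞) = (p ^ (n - (j + 1)) : ℕ) * addVal R (p ^ j • x₀).1 := by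
  have hval : addVal R (chain φs n (j + 1) (p ^ j • x₀).1) = level p φs x₀ j :=
    H.addVal_generator hj
  have hadd := (H.addVal_chain_add (A := R) (e := 1) (by simp) one_ne_zero (p ^ j • x₀).2
    (i := j + 1) (fun h => by
      rw [hval, one_mul, Nat.cast_lt]
      exact H.level_lt h) (l := n - (j + 1)) (by omega)).1
  rwa [hval, Nat.add_sub_cancel' hj, chain_self] at hadd

end IsKernelGenerator

end KernelGenerator

/-! ### Integral extensions of complete discrete valuation rings -/

section AdicCompletion

lemma isAdicComplete_of_linearEquiv {R M N : Type*} [CommRing R] [AddCommGroup M] [Module R M]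
    [AddCommGroup N] [Module R N] (I : Ideal R) (f : M ≃ₗ[R] N) [IsAdicComplete I M] :
    IsAdicComplete I N := by
  rw [← AdicCompletion.of_bijective_iff]
  have hof : ⇑(AdicCompletion.of I N) =
      AdicCompletion.congr I f ∘ AdicCompletion.of I M ∘ f.symm := by
    ext x
    simp
  rw [hof]
  exact (AdicCompletion.congr I f).bijective.comp
    ((AdicCompletion.of_bijective I M).comp f.symm.bijective)

lemma isAdicComplete_pi {R ι : Type*} [CommRing R] [Finite ι] {M : ι → Type*}
    [∀ i, AddCommGroup (M i)] [∀ i, Module R (M i)] (I : Ideal R)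
    [∀ i, IsAdicComplete I (M i)] :
    IsAdicComplete I (∀ i, M i) := by
  classical
  have := Fintype.ofFinite ι
  rw [← AdicCompletion.of_bijective_iff,
    ← (AdicCompletion.piEquivOfFintype I M).bijective.of_comp_iff']
  exact Function.Bijective.piMap fun i => AdicCompletion.of_bijective I (M i)

lemma isAdicComplete_of_free {R M : Type*} [CommRing R] [AddCommGroup M] [Module R M]
    [Module.Free R M] [Module.Finite R M] (I : Ideal R) [IsAdicComplete I R] :
    IsAdicComplete I M :=
  have := isAdicComplete_pi (M := fun _ : Module.Free.ChooseBasisIndex R M => R) I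
  isAdicComplete_of_linearEquiv I (Module.Free.chooseBasis R M).equivFun.symm

lemma isAdicComplete_of_pow {A : Type*} [CommRing A] {I : Ideal A} {e : ℕ} (he : e ≠ 0)
    [IsAdicComplete (I ^ e) A] : IsAdicComplete I A := by
  refine { haus' := fun x hx => ?_, prec' := fun f hf => ?_ }
  · refine IsHausdorff.haus (I := I ^ e) inferInstance _ fun n => ?_
    rw [← pow_mul]
    exact hx _
  · obtain ⟨l, hl⟩ := IsPrecomplete.prec (I := I ^ e) inferInstance (f := fun n => f (e * n))
      fun {m n} hmn => by
        rw [← pow_mul]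
        exact hf (Nat.mul_le_mul_left e hmn)
    refine ⟨l, fun n => (hf (Nat.le_mul_of_pos_left n (Nat.pos_of_ne_zero he))).trans ?_⟩
    exact (hl n).mono (Submodule.smul_mono_left (Ideal.pow_right_mono (Ideal.pow_le_self he) n))

end AdicCompletion

section Henselian

lemma exists_isIdempotentElem_pow_mul {B : Type*} [CommRing B] [IsArtinianRing B] (b : B) :
    ∃ k ≠ 0, ∃ c, IsIdempotentElem (b ^ k * c) ∧ b ^ k * (b ^ k * c) = b ^ k := by
  obtain ⟨n, y, hy⟩ := IsArtinian.exists_pow_succ_smul_dvd b (1 : B)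
  simp only [smul_eq_mul, mul_one] at hy
  have hpow : ∀ j, b ^ n * (b * y) ^ j = b ^ n := fun j => by
    induction j with
    | zero => simp
    | succ j ih => rw [pow_succ, ← mul_assoc, ih, ← mul_assoc, ← pow_succ, hy]
  have hk : b ^ (n + 1) * (b ^ (n + 1) * y ^ (n + 1)) = b ^ (n + 1) := by
    calc b ^ (n + 1) * (b ^ (n + 1) * y ^ (n + 1)) = b ^ n * (b * y) ^ (n + 1) * b := by ring
      _ = b ^ (n + 1) := by rw [hpow, pow_succ]
  refine ⟨n + 1, n.succ_ne_zero, y ^ (n + 1), ?_, hk⟩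
  calc b ^ (n + 1) * y ^ (n + 1) * (b ^ (n + 1) * y ^ (n + 1))
    _ = b ^ (n + 1) * (b ^ (n + 1) * y ^ (n + 1)) * y ^ (n + 1) := by ring
    _ = b ^ (n + 1) * y ^ (n + 1) := by rw [hk]

open Polynomial in
lemma exists_isIdempotentElem_sub_mem {A : Type*} [CommRing A] {J : Ideal A} [HenselianRing A J]
    {e : A} (he : e * e - e ∈ J) : ∃ r, IsIdempotentElem r ∧ r - e ∈ J := by
  have hderiv : IsUnit (Ideal.Quotient.mk J ((X ^ 2 - X : A[X]).derivative.eval e)) := by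
    refine .of_mul_eq_one (Ideal.Quotient.mk J (2 * e - 1)) ?_
    rw [← map_mul, ← map_one (Ideal.Quotient.mk J), Ideal.Quotient.mk_eq_mk_iff_sub_mem,
      show (X ^ 2 - X : A[X]).derivative.eval e * (2 * e - 1) - 1 = 4 * (e * e - e) by simp; ring]
    exact Ideal.mul_mem_left _ _ he
  obtain ⟨r, hr, hre⟩ := HenselianRing.is_henselian (I := J) (X ^ 2 - X : A[X]) (by monicity!) e
    (by simpa [sq] using he) hderiv
  refine ⟨r, ?_, hre⟩
  rwa [IsRoot, eval_sub, eval_pow, eval_X, sq, sub_eq_zero] at hr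

lemma isLocalRing_of_henselianRing {A : Type*} [CommRing A] [IsDomain A] (J : Ideal A)
    [HenselianRing A J] [IsArtinianRing (A ⧸ J)] : IsLocalRing A := by
  set q := Ideal.Quotient.mk J
  have hJ : J ≤ Ideal.jacobson ⊥ := HenselianRing.jac
  refine .of_isUnit_or_isUnit_one_sub_self fun a => ?_
  obtain ⟨k, hk, c, hidem, hpow⟩ := exists_isIdempotentElem_pow_mul (q a)
  obtain ⟨c, rfl⟩ := Ideal.Quotient.mk_surjective c
  rw [← map_pow, ← map_mul] at hidem hpow
  obtain ⟨r, hr, hre⟩ := exists_isIdempotentElem_sub_mem (e := a ^ k * c) (J := J) <| by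
    rw [← Ideal.Quotient.mk_eq_mk_iff_sub_mem, map_mul]
    exact hidem
  have hqr : q (a ^ k * c) = q r := ((Ideal.Quotient.mk_eq_mk_iff_sub_mem _ _).2 hre).symm
  rcases IsIdempotentElem.iff_eq_zero_or_one.1 hr with rfl | rfl
  · right
    rw [hqr, map_zero, mul_zero, eq_comm, Ideal.Quotient.eq_zero_iff_mem] at hpow
    have ha : a ∈ Ideal.jacobson (⊥ : Ideal A) :=
      Ideal.mem_sInf.2 fun _ hM => hM.2.isPrime.mem_of_pow_mem k (Ideal.mem_sInf.1 (hJ hpow) hM)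
    simpa [neg_add_eq_sub] using Ideal.mem_jacobson_bot.1 ha (-1)
  · left
    have := isLocalHom_of_le_jacobson_bot J hJ
    refine isUnit_of_map_unit q a (isUnit_of_dvd_one ?_)
    rw [← map_one q, ← hqr, map_mul, map_pow]
    exact (dvd_pow_self _ hk).mul_right _

end Henselian

section Ramification

open IsDiscreteValuationRing hiding maximalIdeal

variable {R A : Type*} [CommRing R] [IsDomain R] [IsDiscreteValuationRing R] [CommRing A]
  [IsDomain A] [IsDiscreteValuationRing A] [Algebra R A] [FaithfulSMul R A]
  [IsLocalHom (algebraMap R A)]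

variable (R A) in
lemma map_maximalIdeal_eq_pow_ramificationIdx :
    (maximalIdeal R).map (algebraMap R A) =
      maximalIdeal A ^ (maximalIdeal A).ramificationIdx R := by
  have hJ : (maximalIdeal R).map (algebraMap R A) ≠ ⊥ := by
    rw [Ne, Ideal.map_eq_bot_iff_of_injective (FaithfulSMul.algebraMap_injective R A)]
    exact IsDiscreteValuationRing.not_a_field R
  obtain ⟨ϖ, hϖ⟩ := exists_irreducible A
  obtain ⟨k, hk⟩ := ideal_eq_span_pow_irreducible hJ hϖ
  rw [← Ideal.span_singleton_pow, ← hϖ.maximalIdeal_eq] at hk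
  have hprime : Prime (maximalIdeal A) :=
    Ideal.prime_of_isPrime (IsDiscreteValuationRing.not_a_field A) inferInstance
  rw [Ideal.IsDedekindDomain.ramificationIdx_eq_multiplicity (maximalIdeal R) _ hJ, hk,
    multiplicity_pow_self_of_prime hprime]

variable (R A) in
lemma ramificationIdx_maximalIdeal_ne_zero : (maximalIdeal A).ramificationIdx R ≠ 0 := fun h => by
  have hlt := map_maximalIdeal_lt_top (algebraMap R A)
  rw [map_maximalIdeal_eq_pow_ramificationIdx, h, pow_zero, Ideal.one_eq_top] at hlt
  exact lt_irrefl _ hlt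

lemma addVal_algebraMap (r : R) :
    addVal A (algebraMap R A r) = (maximalIdeal A).ramificationIdx R * addVal R r := by
  have he0 := ramificationIdx_maximalIdeal_ne_zero R A
  have hmap := map_maximalIdeal_eq_pow_ramificationIdx R A
  set e := (maximalIdeal A).ramificationIdx R
  rcases eq_or_ne r 0 with rfl | hr
  · simp [he0]
  obtain ⟨π, hπ⟩ := exists_irreducible R
  obtain ⟨ϖ, hϖ⟩ := exists_irreducible A
  rw [hπ.maximalIdeal_eq, Ideal.map_span, Set.image_singleton, hϖ.maximalIdeal_eq,
    Ideal.span_singleton_pow, Ideal.span_singleton_eq_span_singleton] at hmap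
  have hval : addVal A (algebraMap R A π) = e := by
    rw [(addVal_eq_iff_associated _ _).2 hmap, addVal_pow, addVal_uniformizer hϖ]
    simp
  obtain ⟨k, u, rfl⟩ := eq_unit_mul_pow_irreducible hr hπ
  rw [map_mul, map_pow, addVal_mul, addVal_mul, addVal_pow, addVal_pow, hval,
    addVal_uniformizer hπ, addVal_eq_zero_iff.2 u.isUnit, addVal_eq_zero_iff.2 (u.isUnit.map _)]
  simp [mul_comm]

end Ramification

section IntegralClosure

variable (R K L : Type*) [CommRing R] [Field K] [Algebra R K] [IsFractionRing R K]
  [Field L] [Algebra K L] [Algebra R L] [IsScalarTower R K L]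

include K in
lemma faithfulSMul_of_isFractionRing : FaithfulSMul R L := by
  rw [faithfulSMul_iff_algebraMap_injective, IsScalarTower.algebraMap_eq R K L]
  exact (algebraMap K L).injective.comp (IsFractionRing.injective R K)

variable [IsDomain R] [IsDiscreteValuationRing R] [CharZero K] [FiniteDimensional K L]

include K in
lemma isDiscreteValuationRing_integralClosure [IsAdicComplete (maximalIdeal R) R] :
    IsDiscreteValuationRing (integralClosure R L) := by
  have := IsIntegralClosure.finite R K L (integralClosure R L)
  have := faithfulSMul_of_isFractionRing R K L
  set J := (maximalIdeal R).map (algebraMap R (integralClosure R L))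
  have : IsAdicComplete J (integralClosure R L) :=
    (IsAdicComplete.map_algebraMap_iff _ _).2 (isAdicComplete_of_free _)
  have : IsArtinianRing (integralClosure R L ⧸ J) := by
    let : Field (R ⧸ maximalIdeal R) := Ideal.Quotient.field _
    have : Module.Finite (R ⧸ maximalIdeal R) (integralClosure R L ⧸ J) :=
      .of_restrictScalars_finite R _ _
    exact .of_finite (R ⧸ maximalIdeal R) _
  have := isLocalRing_of_henselianRing J
  have hfield : ¬ IsField (integralClosure R L) := fun h =>
    IsDiscreteValuationRing.not_isField R
      (isField_of_isIntegral_of_isField (FaithfulSMul.algebraMap_injective _ _) h)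
  have := integralClosure.isDedekindDomain R K L
  exact ((IsDiscreteValuationRing.TFAE _ hfield).out 0 2).2 this

include K in
lemma isAdicComplete_integralClosure [IsAdicComplete (maximalIdeal R) R]
    [IsDiscreteValuationRing (integralClosure R L)] :
    IsAdicComplete (maximalIdeal (integralClosure R L)) (integralClosure R L) := by
  have := IsIntegralClosure.finite R K L (integralClosure R L)
  have := faithfulSMul_of_isFractionRing R K L
  have : IsAdicComplete
      (maximalIdeal (integralClosure R L) ^ (maximalIdeal (integralClosure R L)).ramificationIdx R)
      (integralClosure R L) := by
    rw [← map_maximalIdeal_eq_pow_ramificationIdx]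
    exact (IsAdicComplete.map_algebraMap_iff _ _).2 (isAdicComplete_of_free _)
  exact isAdicComplete_of_pow (ramificationIdx_maximalIdeal_ne_zero R (integralClosure R L))

lemma ramificationIdx_mul_inertiaDeg_integralClosure [IsLocalRing (integralClosure R L)] :
    (maximalIdeal (integralClosure R L)).ramificationIdx R *
      (maximalIdeal (integralClosure R L)).inertiaDeg R = Module.finrank K L := by
  have := IsIntegralClosure.finite R K L (integralClosure R L)
  have := faithfulSMul_of_isFractionRing R K L
  have := integralClosure.isDedekindDomain R K L
  have := integralClosure.isFractionRing_of_finite_extension K L (A := R)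
  have hover : Ideal.primesOver (maximalIdeal R) (integralClosure R L) =
      {maximalIdeal (integralClosure R L)} :=
    primesOver_eq _ (IsDiscreteValuationRing.not_a_field R)
  let : Fintype ((maximalIdeal R).primesOver (integralClosure R L)) := by
    rw [hover]
    infer_instance
  have hmem : maximalIdeal (integralClosure R L) ∈
      (maximalIdeal R).primesOver (integralClosure R L) := hover ▸ rfl
  rw [IsFractionRing.finrank_eq R K (integralClosure R L) L,
    ← Ideal.sum_ramification_inertia_eq_finrank (maximalIdeal R) (integralClosure R L),
    Fintype.sum_eq_single ⟨_, hmem⟩]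
  rintro ⟨q, hq⟩ hne
  exact absurd (Subtype.ext (by rwa [hover] at hq)) hne

end IntegralClosure

section Residue

variable {R A : Type*} [CommRing R] [IsLocalRing R] [CommRing A] [IsLocalRing A] [Algebra R A]
  [IsLocalHom (algebraMap R A)]

lemma exists_sub_algebraMap_mem_of_inertiaDeg_eq_one (h : (maximalIdeal A).inertiaDeg R = 1)
    (a : A) : ∃ r : R, a - algebraMap R A r ∈ maximalIdeal A := by
  rw [Ideal.inertiaDeg_eq_of_isMaximal (maximalIdeal R)] at h
  let : Field (R ⧸ maximalIdeal R) := Ideal.Quotient.field _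
  obtain ⟨c, hc⟩ := (finrank_eq_one_iff_of_nonzero' (K := R ⧸ maximalIdeal R)
    (1 : A ⧸ maximalIdeal A) one_ne_zero).1 h (Ideal.Quotient.mk _ a)
  obtain ⟨r, rfl⟩ := Ideal.Quotient.mk_surjective c
  refine ⟨r, ?_⟩
  rw [← Ideal.Quotient.eq_zero_iff_mem, map_sub, ← hc, Algebra.smul_def, mul_one, sub_eq_zero]
  rfl

end Residue

/-! ### Convergence of power series and their evaluation -/

section Convergence

variable {R : Type*} [CommRing R] {A : Type*} [CommRing A] [Algebra R A] {B : Type*} [CommRing B]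
  [Algebra R B]

lemma ConvergesTo.map (θ : A →ₐ[R] B) {s : ℕ → A} {y : A} (h : ConvergesTo R s y) :
    ConvergesTo R (fun N => θ (s N)) (θ y) := by
  intro r hr
  filter_upwards [h r hr] with N hN
  simpa using map_dvd θ hN

lemma HasValue.map (θ : A →ₐ[R] B) {f : PowerSeries R} {x y : A} (h : HasValue f x y) :
    HasValue f (θ x) (θ y) := by
  simpa [HasValue] using ConvergesTo.map θ h

lemma HasFormalSum.map (θ : A →ₐ[R] B) {F : FormalGroup R} {x y z : A}
    (h : HasFormalSum F x y z) : HasFormalSum F (θ x) (θ y) (θ z) := by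
  simpa [HasFormalSum] using ConvergesTo.map θ h

lemma map_mem_ringJacobson_iff [IsLocalRing A] [Nontrivial B] [Algebra.IsIntegral R B]
    (θ : A →ₐ[R] B) {x : A} :
    θ x ∈ Ring.jacobson B ↔ x ∈ maximalIdeal A := by
  have hint : (θ : A →+* B).IsIntegral := RingHom.IsIntegral.tower_top (algebraMap R A) _ (by
    rw [θ.comp_algebraMap]
    exact Algebra.IsIntegral.isIntegral)
  have hcomap (M : Ideal B) [M.IsMaximal] : M.comap (θ : A →+* B) = maximalIdeal A :=
    eq_maximalIdeal (Ideal.isMaximal_comap_of_isIntegral_of_isMaximal' (θ : A →+* B) hint M)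
  rw [Ring.jacobson_eq_sInf_isMaximal, Ideal.mem_sInf]
  constructor
  · intro h
    obtain ⟨M, hM⟩ := Ideal.exists_maximal B
    exact (hcomap M).le (h hM)
  · intro hx M hM
    have : M.IsMaximal := hM
    exact (hcomap M).ge hx

section Unique

variable [IsDomain R] [IsDiscreteValuationRing R] [IsDomain B] [FaithfulSMul R B]
  [Algebra.IsIntegral R B]

lemma eq_zero_of_forall_algebraMap_dvd {y : B} (hy : ∀ r : R, r ≠ 0 → algebraMap R B r ∣ y) :
    y = 0 := by
  by_contra hy0
  obtain ⟨π, hπ⟩ := IsDiscreteValuationRing.exists_irreducible R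
  obtain ⟨c, hc, hyc⟩ := (Algebra.IsIntegral.isIntegral (R := R) y).isAlgebraic.exists_nonzero_dvd
    (mem_nonZeroDivisors_of_ne_zero hy0)
  obtain ⟨w, hw⟩ := (hy (c * π) (mul_ne_zero hc hπ.ne_zero)).trans hyc
  have hc' : algebraMap R B c ≠ 0 := by rwa [Ne, FaithfulSMul.algebraMap_eq_zero_iff]
  rw [map_mul, mul_assoc, eq_comm, mul_eq_left₀ hc'] at hw
  exact hπ.not_isUnit (isUnit_of_map_unit (algebraMap R B) π (.of_mul_eq_one w hw))

lemma ConvergesTo.unique {s : ℕ → B} {y z : B} (h : ConvergesTo R s y) (h' : ConvergesTo R s z) :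
    y = z := by
  rw [← sub_eq_zero]
  refine eq_zero_of_forall_algebraMap_dvd (R := R) fun r hr => ?_
  obtain ⟨N, h₁, h₂⟩ := ((h r hr).and (h' r hr)).exists
  simpa using dvd_sub h₂ h₁

end Unique

variable [IsDomain A] [IsDiscreteValuationRing A] [FaithfulSMul R A]

lemma exists_maximalIdeal_pow_le_span {r : R} (hr : r ≠ 0) :
    ∃ k, maximalIdeal A ^ k ≤ Ideal.span {algebraMap R A r} := by
  obtain ⟨ϖ, hϖ⟩ := IsDiscreteValuationRing.exists_irreducible A
  obtain ⟨k, hk⟩ := IsDiscreteValuationRing.associated_pow_irreducible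
    ((FaithfulSMul.algebraMap_eq_zero_iff R A).not.2 hr) hϖ
  refine ⟨k, ?_⟩
  rw [hϖ.maximalIdeal_eq, Ideal.span_singleton_pow, Ideal.span_singleton_le_span_singleton]
  exact hk.dvd

lemma convergesTo_of_forall_eventually_sub_mem {s : ℕ → A} {y : A}
    (h : ∀ k, ∀ᶠ N in atTop, s N - y ∈ maximalIdeal A ^ k) : ConvergesTo R s y := by
  intro r hr
  obtain ⟨k, hk⟩ := exists_maximalIdeal_pow_le_span (A := A) hr
  exact (h k).mono fun N hN => Ideal.mem_span_singleton.1 (hk hN)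

variable [IsAdicComplete (maximalIdeal A) A]

lemma hasValue_ev (f : PowerSeries R) {a : A} (ha : a ∈ maximalIdeal A) : HasValue f a (ev f a) :=
  convergesTo_of_forall_eventually_sub_mem (eventually_sum_sub_ev_mem ha f)

lemma hasFormalSum_fadd (F : FormalGroup R) {x y : A} (hx : x ∈ maximalIdeal A)
    (hy : y ∈ maximalIdeal A) : HasFormalSum F x y (fadd F x y) :=
  convergesTo_of_forall_eventually_sub_mem (eventually_sum_sub_fadd_mem F hx hy)

variable [IsDomain R] [IsDiscreteValuationRing R] [IsDomain B] [FaithfulSMul R B]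
  [Algebra.IsIntegral R B] (θ : A →ₐ[R] B)

lemma hasValue_map_iff {f : PowerSeries R} {a : A} (ha : a ∈ maximalIdeal A) {z : B} :
    HasValue f (θ a) z ↔ z = θ (ev f a) :=
  ⟨fun h => h.unique ((hasValue_ev f ha).map θ), fun h => h ▸ (hasValue_ev f ha).map θ⟩

lemma hasFormalSum_map_iff {F : FormalGroup R} (x y : Points A F) {z : B} :
    HasFormalSum F (θ x.1) (θ y.1) z ↔ z = θ (x + y).1 :=
  have h := (hasFormalSum_fadd F x.2 y.2).map θ
  ⟨fun h' => h'.unique h, fun h' => h' ▸ h⟩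

lemma hasMultiple_map_iff {F : FormalGroup R} (x : Points A F) {k : ℕ} {z : B} :
    HasMultiple F (θ x.1) k z ↔ z = θ (k • x).1 := by
  induction k generalizing z with
  | zero => simp [HasMultiple]
  | succ k ih => simp only [HasMultiple, ih, exists_eq_left, hasFormalSum_map_iff, succ_nsmul]

lemma map_mem_kernel_iff (hθ : Function.Injective θ) {f : PowerSeries R} {a : A} :
    θ a ∈ kernel B f ↔ a ∈ maximalIdeal A ∧ ev f a = 0 := by
  rw [kernel, Set.mem_ofPred_eq, map_mem_ringJacobson_iff θ]
  refine and_congr_right fun ha => ?_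
  rw [hasValue_map_iff θ ha, eq_comm, map_eq_zero_iff θ hθ]

end Convergence

section Reduction

lemma subst_ne_zero {k : Type*} [Field k] {f g : PowerSeries k} (hf : f ≠ 0) (hg : g ≠ 0)
    (hg0 : PowerSeries.constantCoeff g = 0) : PowerSeries.subst g f ≠ 0 := by
  have hs := PowerSeries.HasSubst.of_constantCoeff_zero' hg0
  obtain ⟨d, hd⟩ := IsDiscreteValuationRing.associated_pow_irreducible hf
    PowerSeries.X_prime.irreducible
  have hsubst := hd.map (PowerSeries.substAlgHom (R := k) hs)
  rw [PowerSeries.coe_substAlgHom, PowerSeries.subst_pow hs, PowerSeries.subst_X hs] at hsubst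
  exact hsubst.ne_zero_iff.2 (pow_ne_zero d hg)

variable {R : Type*} [CommRing R] [IsLocalRing R] {φs : ℕ → PowerSeries R} {n i k : ℕ}

lemma map_residue_subst_ne_zero {f g : PowerSeries R} (hf : f.map (residue R) ≠ 0)
    (hg : g.map (residue R) ≠ 0) (hg0 : PowerSeries.constantCoeff g = 0) :
    (PowerSeries.subst g f).map (residue R) ≠ 0 := by
  have hmap : (PowerSeries.subst g f).map (residue R) =
      PowerSeries.subst (g.map (residue R)) (f.map (residue R)) :=
    PowerSeries.map_subst (PowerSeries.HasSubst.of_constantCoeff_zero' hg0) f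
  rw [hmap]
  refine subst_ne_zero hf hg ?_
  rw [← PowerSeries.coeff_zero_eq_constantCoeff_apply, PowerSeries.coeff_map,
    PowerSeries.coeff_zero_eq_constantCoeff_apply, hg0, map_zero]

lemma map_residue_comp_ne_zero (hc : ∀ i < n, PowerSeries.constantCoeff (φs (i + 1)) = 0)
    (hr : ∀ i < n, (φs (i + 1)).map (residue R) ≠ 0) (h : i + k ≤ n) :
    (comp φs i k).map (residue R) ≠ 0 := by
  induction k with
  | zero => simp [comp, PowerSeries.X_ne_zero]
  | succ k ih =>
    exact map_residue_subst_ne_zero (ih (by omega)) (hr _ (by omega)) (hc _ (by omega))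

omit [IsLocalRing R] in
lemma constantCoeff_comp (hc : ∀ i < n, PowerSeries.constantCoeff (φs (i + 1)) = 0)
    (h : i + k ≤ n) : PowerSeries.constantCoeff (comp φs i k) = 0 := by
  induction k with
  | zero => simp [comp]
  | succ k ih =>
    exact PowerSeries.constantCoeff_subst_eq_zero (hc _ (by omega)) _ (ih (by omega))

lemma HasHeight.map_residue_ne_zero {p h : ℕ} {φ : PowerSeries R} (hφ : HasHeight p h φ)
    (hp : p ≠ 0) : φ.map (residue R) ≠ 0 := fun h0 => by
  refine hφ.coeff_pow_notMem hp ?_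
  rw [← residue_eq_zero_iff, ← PowerSeries.coeff_map, h0, map_zero]

end Reduction

section AlgebraicClosure

open Polynomial in
lemma mem_maximalIdeal_of_aeval_eq_zero {R A : Type*} [CommRing R] [IsLocalRing R] [CommRing A]
    [IsLocalRing A] [Algebra R A] [IsLocalHom (algebraMap R A)] {f : R[X]} (hf : f.Monic)
    (hcoeff : ∀ i < f.natDegree, f.coeff i ∈ maximalIdeal R) {a : A} (ha : aeval a f = 0) :
    a ∈ maximalIdeal A := by
  have hweak : f.IsWeaklyEisensteinAt (maximalIdeal R) := ⟨fun {i} => hcoeff i⟩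
  have hpow := hweak.pow_natDegree_le_of_aeval_zero_of_monic_mem_map ha hf _ le_rfl
  have hle : (maximalIdeal R).map (algebraMap R A) ≤ maximalIdeal A :=
    ((local_hom_TFAE (algebraMap R A)).out 0 2 :).1 inferInstance
  exact (maximalIdeal.isMaximal A).isPrime.mem_of_pow_mem _ (hle hpow)

variable {R : Type*} [CommRing R] {K : Type*} [Field K] [Algebra R K]
  {Kbar : Type*} [Field Kbar] [Algebra K Kbar] [Algebra R Kbar] [IsScalarTower R K Kbar]

/-- The inclusion of the ring of integers of an intermediate field of `Kbar / K` in that of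
`Kbar`. -/
def integralInclusion (L : IntermediateField K Kbar) :
    integralClosure R L →ₐ[R] integralClosure R Kbar :=
  (L.val.restrictScalars R).mapIntegralClosure

lemma coe_integralInclusion (L : IntermediateField K Kbar) (a : integralClosure R L) :
    (integralInclusion L a : Kbar) = (a : L) := rfl

lemma integralInclusion_injective (L : IntermediateField K Kbar) :
    Function.Injective (integralInclusion (R := R) L) := fun _ _ h =>
  Subtype.ext (Subtype.ext (congrArg (Subtype.val : integralClosure R Kbar → Kbar) h))

lemma exists_integralInclusion_eq (L : IntermediateField K Kbar) {x : integralClosure R Kbar}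
    (hx : (x : Kbar) ∈ L) : ∃ a, integralInclusion L a = x :=
  ⟨⟨⟨x, hx⟩, (isIntegral_algHom_iff (L.val.restrictScalars R) L.val.injective).1 x.2⟩, rfl⟩

variable [IsDomain R] [IsDiscreteValuationRing R] [IsAdicComplete (maximalIdeal R) R]
  [IsFractionRing R K] [CharZero K] [IsAlgClosure K Kbar]

variable (K Kbar) in
lemma exists_ev_eq_zero {Q : PowerSeries R} (hQ : Q.map (residue R) ≠ 0)
    (hQ0 : PowerSeries.constantCoeff Q ∈ maximalIdeal R) :
    ∃ (L : IntermediateField K Kbar) (_ : FiniteDimensional K L)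
      (_ : IsDiscreteValuationRing (integralClosure R L))
      (_ : IsAdicComplete (maximalIdeal (integralClosure R L)) (integralClosure R L))
      (a : integralClosure R L), a ∈ maximalIdeal (integralClosure R L) ∧ ev Q a = 0 := by
  set d := (Q.map (residue R)).order.toNat
  have hd : PowerSeries.coeff d Q ∉ maximalIdeal R := fun h =>
    PowerSeries.coeff_order hQ (by rw [PowerSeries.coeff_map, residue_eq_zero_iff]; exact h)
  have hlt : ∀ i < d, PowerSeries.coeff i Q ∈ maximalIdeal R := fun i hi => by
    rw [← residue_eq_zero_iff, ← PowerSeries.coeff_map]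
    exact PowerSeries.coeff_of_lt_order_toNat _ hi
  have hd0 : d ≠ 0 := fun h => by
    rw [h, PowerSeries.coeff_zero_eq_constantCoeff_apply] at hd
    exact hd hQ0
  obtain ⟨f, h, hf, hdeg, hcoeff, -, hfh⟩ := exists_weierstrass hd hlt
  have := faithfulSMul_of_isFractionRing R K Kbar
  have := IsAlgClosure.isAlgebraic (R := K) (K := Kbar)
  have := IsAlgClosure.isAlgClosed (K := Kbar) K
  obtain ⟨w, hw⟩ := IsAlgClosed.exists_aeval_eq_zero Kbar f (by
    rw [Polynomial.degree_eq_natDegree hf.ne_zero, hdeg]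
    exact_mod_cast hd0)
  let L := IntermediateField.adjoin K {w}
  have : FiniteDimensional K L :=
    IntermediateField.adjoin.finiteDimensional (Algebra.IsIntegral.isIntegral w)
  have := isDiscreteValuationRing_integralClosure R K L
  have := isAdicComplete_integralClosure R K L
  have := faithfulSMul_of_isFractionRing R K L
  obtain ⟨a, ha⟩ := exists_integralInclusion_eq (x := (⟨w, f, hf, hw⟩ : integralClosure R Kbar)) L
    (IntermediateField.mem_adjoin_simple_self K _)
  have hfa : Polynomial.aeval a f = 0 := by
    apply integralInclusion_injective L
    apply Subtype.ext
    rw [← Polynomial.aeval_algHom_apply, ha, map_zero, ← Subalgebra.coe_val,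
      ← Polynomial.aeval_algHom_apply]
    exact hw
  have ham := mem_maximalIdeal_of_aeval_eq_zero hf (by rwa [hdeg]) hfa
  refine ⟨L, inferInstance, inferInstance, inferInstance, a, ham, ?_⟩
  rw [hfh, ev_mul ham, ev_coe ham, hfa, zero_mul]

end AlgebraicClosure

/-! ### Generators of a rational cyclic kernel -/

section Factorization

lemma constantCoeff_subst_of_constantCoeff_eq_zero {R : Type*} [CommRing R] {g : PowerSeries R}
    (hg : PowerSeries.constantCoeff g = 0) (f : PowerSeries R) :
    PowerSeries.constantCoeff (PowerSeries.subst g f) = PowerSeries.constantCoeff f := by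
  have hs := PowerSeries.HasSubst.of_constantCoeff_zero' hg
  have h := PowerSeries.constantCoeff_subst hs f
  rw [finsum_eq_single _ 0 fun d hd => ?_] at h
  · exact h.trans (by simp)
  · change _ • PowerSeries.constantCoeff (g ^ d) = _
    rw [map_pow, hg, zero_pow hd, smul_zero]

instance {R A : Type*} [CommRing R] [CommRing A] [Algebra R A] [IsLocalHom (algebraMap R A)] :
    IsLocalHom (Algebra.ofId R A) := ⟨fun r hr => isUnit_of_map_unit (algebraMap R A) r hr⟩

variable {R : Type*} [CommRing R] [IsDomain R] [IsDiscreteValuationRing R]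
  [IsAdicComplete (maximalIdeal R) R] {p n j : ℕ} {Gs : ℕ → FormalGroup R}
  {φs : ℕ → PowerSeries R}

section Extension

variable (K Kbar : Type*) [Field K] [Algebra R K] [IsFractionRing R K] [CharZero K]
  [Field Kbar] [Algebra K Kbar] [Algebra R Kbar] [IsScalarTower R K Kbar] [IsAlgClosure K Kbar]
  [hp : Fact p.Prime] [CharP (ResidueField R) p]

lemma exists_chain_eq_zero_and_chain_succ_ne_zero
    (hφ : ∀ i < n, IsIsogeny p 1 (Gs (i + 1)) (Gs i) (φs (i + 1))) (hj : j < n) :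
    ∃ (L : IntermediateField K Kbar) (_ : FiniteDimensional K L)
      (_ : IsDiscreteValuationRing (integralClosure R L))
      (_ : IsAdicComplete (maximalIdeal (integralClosure R L)) (integralClosure R L))
      (a : integralClosure R L), a ∈ maximalIdeal (integralClosure R L) ∧
        chain φs n j a = 0 ∧ chain φs n (j + 1) a ≠ 0 := by
  have := (algebraMap R K).charZero
  have hc := fun i hi => (hφ i hi).isHom.constantCoeff_eq_zero
  have hr := fun i hi => (hφ i hi).hasHeight.map_residue_ne_zero hp.out.ne_zero
  obtain ⟨q, hq⟩ : PowerSeries.X ∣ φs (j + 1) := PowerSeries.X_dvd_iff.2 (hc j hj)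
  have hq0 : PowerSeries.constantCoeff q = PowerSeries.coeff 1 (φs (j + 1)) := by
    rw [hq, ← zero_add 1, PowerSeries.coeff_succ_X_mul,
      PowerSeries.coeff_zero_eq_constantCoeff_apply]
  have hq0_ne : PowerSeries.constantCoeff q ≠ 0 := by
    rw [hq0]
    exact (hφ j hj).isHom.coeff_one_ne_zero (fun h => hr j hj (by rw [h, map_zero]))
      (natCast_mem_maximalIdeal R p) (Nat.cast_ne_zero.2 hp.out.ne_zero)
  have hcomp : PowerSeries.constantCoeff (comp φs (j + 1) (n - (j + 1))) = 0 :=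
    constantCoeff_comp hc (by omega)
  obtain ⟨L, hfin, hdvr, hcomplete, a, ha, hev⟩ := exists_ev_eq_zero K Kbar
    (Q := PowerSeries.subst (comp φs (j + 1) (n - (j + 1))) q)
    (map_residue_subst_ne_zero (fun h => hr j hj (by rw [hq, map_mul, h, mul_zero]))
      (map_residue_comp_ne_zero hc hr (by omega)) hcomp)
    (by
      rw [constantCoeff_subst_of_constantCoeff_eq_zero hcomp, hq0]
      exact (hφ j hj).hasHeight.coeff_mem_of_lt (hc j hj) (by simpa using hp.out.one_lt))
  have := faithfulSMul_of_isFractionRing R K L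
  rw [ev_subst ha hcomp] at hev
  change ev q (chain φs n (j + 1) a) = 0 at hev
  have hmem := chain_mem hc hj ha
  refine ⟨L, hfin, hdvr, hcomplete, a, ha, ?_, fun h => hq0_ne ?_⟩
  · rw [chain_eq_ev_chain_succ hc hj ha, hq, ev_mul hmem, hev, mul_zero]
  · obtain ⟨b, hb⟩ := exists_ev_eq_constantCoeff_add_mul hmem q
    rw [hev, h, zero_mul, add_zero, eq_comm] at hb
    exact (FaithfulSMul.algebraMap_eq_zero_iff R (integralClosure R L)).1 hb

end Extension

section Kernel

variable {O : Type*} [CommRing O] [IsDomain O] [Algebra R O] [FaithfulSMul R O]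
  [Algebra.IsIntegral R O] {G : FormalGroup R} {φ : PowerSeries R} {x₀ : Points R (Gs n)}

namespace IsFactorization

variable (hfac : IsFactorization O p n (Gs n) G φ Gs φs)
include hfac

lemma chain_pow_nsmul_eq_zero (hx₀ : algebraMap R O x₀.1 ∈ kernel O φ) (hj : j ≤ n) :
    chain φs n j (p ^ j • x₀).1 = 0 := by
  refine ((map_mem_kernel_iff (Algebra.ofId R O) (FaithfulSMul.algebraMap_injective R O)).1 ?_).2
  rw [hfac.kernel_comp j hj]
  exact ⟨_, hx₀, (hasMultiple_map_iff (Algebra.ofId R O) x₀).2 rfl⟩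

lemma exists_eq_algebraMap_of_chain_eq_zero
    (hgen : ∀ z ∈ kernel O φ, ∃ k : ℕ, HasMultiple (Gs n) (algebraMap R O x₀.1) k z)
    {A : Type*} [CommRing A] [IsDomain A] [IsDiscreteValuationRing A] [Algebra R A]
    [FaithfulSMul R A] [IsAdicComplete (maximalIdeal A) A] (θ : A →ₐ[R] O)
    (hθ : Function.Injective θ) {a : A} (ha : a ∈ maximalIdeal A) (hj : j ≤ n)
    (hchain : chain φs n j a = 0) : ∃ k : ℕ, a = algebraMap R A (p ^ j • k • x₀).1 := by
  have hmem := (map_mem_kernel_iff θ hθ).2 ⟨ha, hchain⟩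
  rw [hfac.kernel_comp j hj] at hmem
  obtain ⟨w, hw, hwa⟩ := hmem
  obtain ⟨k, hk⟩ := hgen w hw
  obtain rfl := (hasMultiple_map_iff (Algebra.ofId R O) x₀).1 hk
  have ha := (hasMultiple_map_iff (Algebra.ofId R O) (k • x₀)).1 hwa
  exact ⟨k, hθ (ha.trans (θ.commutes _).symm)⟩

end IsFactorization

end Kernel

lemma chain_algebraMap {A : Type*} [CommRing A] [IsDomain A] [IsDiscreteValuationRing A]
    [Algebra R A] [IsLocalHom (algebraMap R A)] [IsAdicComplete (maximalIdeal A) A] {i : ℕ}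
    {r : R} (hr : r ∈ maximalIdeal R) :
    chain φs n i (algebraMap R A r) = algebraMap R A (chain φs n i r) :=
  (map_ev hr (Algebra.ofId R A) _).symm

lemma IsFactorization.exists_isKernelGenerator (K : Type*) {Kbar : Type*} [Field K] [Algebra R K]
    [IsFractionRing R K] [CharZero K] [Field Kbar] [Algebra K Kbar] [Algebra R Kbar]
    [IsScalarTower R K Kbar] [IsAlgClosure K Kbar] [Fact p.Prime] [CharP (ResidueField R) p]
    {G : FormalGroup R} {φ : PowerSeries R}
    (hker : HasRationalCyclicKernel (integralClosure R Kbar) (Gs n) φ)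
    (hfac : IsFactorization (integralClosure R Kbar) p n (Gs n) G φ Gs φs) :
    ∃ x₀ : Points R (Gs n), IsKernelGenerator p n Gs φs x₀ := by
  have := faithfulSMul_of_isFractionRing R K Kbar
  have hφ : ∀ i < n, IsIsogeny p 1 (Gs (i + 1)) (Gs i) (φs (i + 1)) := fun i hi =>
    hfac.isIsogeny (i + 1) (by omega) hi
  obtain ⟨x₁, hx₁, hgen⟩ := hker.cyclic
  obtain ⟨r₀, rfl⟩ := hker.rational x₁ hx₁
  let x₀ : Points R (Gs n) := ⟨r₀, (map_mem_ringJacobson_iff (Algebra.ofId R _)).1 hx₁.1⟩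
  have hzero (j : ℕ) (hj : j ≤ n) : chain φs n j (p ^ j • x₀).1 = 0 :=
    hfac.chain_pow_nsmul_eq_zero hx₁ hj
  refine ⟨x₀, hφ, ?_, fun j hj hj0 => ?_, fun j hj => hzero j hj.le⟩
  · exact Points.val_eq_zero.1 (by simpa only [chain_self] using hzero n le_rfl)
  · obtain ⟨L, _, _, _, a, ha, ha0, hane⟩ :=
      exists_chain_eq_zero_and_chain_succ_ne_zero K Kbar hφ hj
    have := faithfulSMul_of_isFractionRing R K L
    obtain ⟨k, rfl⟩ := hfac.exists_eq_algebraMap_of_chain_eq_zero (x₀ := x₀) hgen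
      (integralInclusion L) (integralInclusion_injective L) ha hj.le ha0
    have hker_gen : chainHom R (fun i hi => (hφ i hi).isHom) hj (p ^ j • x₀) = 0 :=
      Points.val_eq_zero.1 hj0
    refine hane ?_
    rw [chain_algebraMap (p ^ j • k • x₀).2, ← val_chainHom (fun i hi => (hφ i hi).isHom) hj,
      nsmul_left_comm, map_nsmul, hker_gen, nsmul_zero, Points.val_zero, map_zero]

end Factorization

/-! ### Automorphisms moving an element of coprime valuation -/

section RamificationNumber

open IsDiscreteValuationRing hiding maximalIdeal

variable {R : Type*} [CommRing R] {A : Type*} [CommRing A] [IsDomain A]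
  [IsDiscreteValuationRing A] [Algebra R A]

lemma exists_sub_aeval_mem_pow (hres : ∀ a : A, ∃ r : R, a - algebraMap R A r ∈ maximalIdeal A)
    {ϖ : A} (hϖ : Irreducible ϖ) (a : A) (k : ℕ) :
    ∃ q : Polynomial R, a - Polynomial.aeval ϖ q ∈ maximalIdeal A ^ k := by
  induction k with
  | zero => exact ⟨0, by simp⟩
  | succ k ih =>
    obtain ⟨q, hq⟩ := ih
    rw [hϖ.maximalIdeal_eq, Ideal.span_singleton_pow, Ideal.mem_span_singleton] at hq
    obtain ⟨b, hb⟩ := hq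
    obtain ⟨r, hr⟩ := hres b
    refine ⟨q + Polynomial.C r * Polynomial.X ^ k, ?_⟩
    have hdigit : a - Polynomial.aeval ϖ (q + Polynomial.C r * Polynomial.X ^ k) =
        ϖ ^ k * (b - algebraMap R A r) := by
      simp only [map_add, map_mul, map_pow, Polynomial.aeval_C, Polynomial.aeval_X]
      linear_combination hb
    have hϖm : ϖ ∈ maximalIdeal A := (mem_maximalIdeal ϖ).2 hϖ.not_isUnit
    rw [hdigit, pow_succ]
    exact Ideal.mul_mem_mul (Ideal.pow_mem_pow hϖm k) hr

lemma algHom_sub_mem_pow_of_irreducible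
    (hres : ∀ a : A, ∃ r : R, a - algebraMap R A r ∈ maximalIdeal A)
    {ϖ : A} (hϖ : Irreducible ϖ) {τ : A →ₐ[R] A} [IsLocalHom τ] {N : ℕ}
    (h : τ ϖ - ϖ ∈ maximalIdeal A ^ N) (a : A) : τ a - a ∈ maximalIdeal A ^ N := by
  obtain ⟨q, hq⟩ := exists_sub_aeval_mem_pow hres hϖ a N
  have hτq : τ (a - Polynomial.aeval ϖ q) ∈ maximalIdeal A ^ N := algHom_mem_maximalIdeal_pow τ hq
  have hϖq : Polynomial.aeval (τ ϖ) q - Polynomial.aeval ϖ q ∈ maximalIdeal A ^ N := by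
    have hdvd := Polynomial.sub_dvd_eval_sub (τ ϖ) ϖ (q.map (algebraMap R A))
    rw [Polynomial.eval_map_algebraMap, Polynomial.eval_map_algebraMap] at hdvd
    exact Ideal.mem_of_dvd _ hdvd h
  rw [map_sub, ← Polynomial.aeval_algHom_apply] at hτq
  convert add_mem (sub_mem hτq hq) hϖq using 1
  ring

lemma exists_pow_eq_pow_mul_irreducible {x y : A} {m q : ℕ} (hx : addVal A x = m)
    (hy : addVal A y = q) (hq : 1 < q) (hcop : m.Coprime q) :
    ∃ (α β : ℕ) (ϖ : A), α.Coprime q ∧ Irreducible ϖ ∧ x ^ α = y ^ β * ϖ := by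
  obtain ⟨α, -, hα⟩ := Nat.exists_mul_mod_eq_one_of_coprime hcop hq
  set β := m * α / q
  have hαβ : m * α = q * β + 1 := by rw [← hα, Nat.div_add_mod]
  have hαq : α.Coprime q := by
    refine Nat.Coprime.coprime_dvd_left (Dvd.intro_left m hαβ) ?_
    simp
  have hvx : addVal A (x ^ α) = (q * β : ℕ) + 1 := by
    rw [addVal_pow, hx, nsmul_eq_mul, mul_comm]
    exact_mod_cast hαβ
  have hvy : addVal A (y ^ β) = (q * β : ℕ) := by
    rw [addVal_pow, hy, nsmul_eq_mul, mul_comm]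
    norm_cast
  obtain ⟨ϖ, hϖ⟩ : y ^ β ∣ x ^ α := by
    rw [← addVal_le_iff_dvd, hvx, hvy]
    exact le_self_add
  refine ⟨α, β, ϖ, hαq, ?_, hϖ⟩
  obtain ⟨ϖ', hϖ'⟩ := exists_irreducible A
  have hϖ1 : addVal A ϖ = addVal A ϖ' := by
    rw [hϖ, addVal_mul, hvy] at hvx
    rw [addVal_uniformizer hϖ']
    exact WithTop.add_left_cancel (ENat.natCast_ne_top _) hvx
  exact ((addVal_eq_iff_associated _ _).1 hϖ1).symm.irreducible hϖ'

lemma addVal_one_add_pow_sub_one {ε : A} (hε : ε ∈ maximalIdeal A) {α : ℕ}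
    (hα : IsUnit (α : A)) : addVal A ((1 + ε) ^ α - 1) = addVal A ε := by
  obtain ⟨c, hc⟩ := Polynomial.binomExpansion (Polynomial.X ^ α : Polynomial A) 1 ε
  have hfactor : (1 + ε) ^ α - 1 = ε * (α + ε * c) := by
    simp only [Polynomial.eval_pow, Polynomial.eval_X, one_pow, Polynomial.derivative_X_pow,
      Polynomial.eval_mul, Polynomial.eval_C, mul_one] at hc
    linear_combination hc
  rw [hfactor, addVal_mul,
    addVal_eq_zero_iff.2 (isUnit_add_of_isUnit_of_mem hα (Ideal.mul_mem_right c _ hε)), add_zero]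

variable {q m d : ℕ} {π : R} {x : A} {τ : A →ₐ[R] A}

lemma exists_irreducible_addVal_algHom_sub (hqA : (q : A) ∈ maximalIdeal A) (hq : 1 < q)
    (hπ : addVal A (algebraMap R A π) = q) (hx : addVal A x = m) (hcop : m.Coprime q)
    (hd : addVal A (τ x - x) = d) (hmd : m < d) :
    ∃ ϖ, Irreducible ϖ ∧ addVal A (τ ϖ - ϖ) = (d - m + 1 : ℕ) := by
  obtain ⟨α, β, ϖ, hα, hϖ, hxϖ⟩ := exists_pow_eq_pow_mul_irreducible hx hπ hq hcop
  refine ⟨ϖ, hϖ, ?_⟩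
  obtain ⟨ε, hε⟩ : x ∣ τ x - x := by
    rw [← addVal_le_iff_dvd, hx, hd]
    exact_mod_cast hmd.le
  have hvε : addVal A ε = (d - m : ℕ) := by
    rw [hε, addVal_mul, hx, ← Nat.add_sub_cancel' hmd.le, Nat.cast_add] at hd
    exact WithTop.add_left_cancel (ENat.natCast_ne_top _) hd
  have hεm : ε ∈ maximalIdeal A := by
    rw [← one_le_addVal_iff, hvε]
    exact_mod_cast Nat.sub_pos_of_lt hmd
  have hπ0 : algebraMap R A π ^ β ≠ 0 := by
    refine pow_ne_zero β fun h => ?_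
    rw [h, addVal_zero] at hπ
    exact ENat.top_ne_natCast q hπ
  have hτϖ : τ ϖ = ϖ * (1 + ε) ^ α := by
    refine mul_left_cancel₀ hπ0 ?_
    calc algebraMap R A π ^ β * τ ϖ = τ (x ^ α) := by
          rw [hxϖ, map_mul, map_pow, AlgHom.commutes]
      _ = (x * (1 + ε)) ^ α := by
          rw [map_pow, mul_add, mul_one, ← hε, add_sub_cancel]
      _ = algebraMap R A π ^ β * (ϖ * (1 + ε) ^ α) := by
          rw [mul_pow, hxϖ, mul_assoc]
  have hαu : IsUnit (α : A) := isUnit_natCast_of_coprime hqA hα.symm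
  rw [hτϖ, ← mul_sub_one, addVal_mul, addVal_uniformizer hϖ, addVal_one_add_pow_sub_one hεm hαu,
    hvε, add_comm]
  norm_cast

lemma forall_algHom_sub_mem_pow_iff [IsLocalHom τ]
    (hres : ∀ a : A, ∃ r : R, a - algebraMap R A r ∈ maximalIdeal A)
    (hqA : (q : A) ∈ maximalIdeal A) (hq : 1 < q)
    (hπ : addVal A (algebraMap R A π) = q) (hx : addVal A x = m) (hcop : m.Coprime q)
    (hd : addVal A (τ x - x) = d) (hmd : m < d) (N : ℕ) :
    (∀ a, τ a - a ∈ maximalIdeal A ^ N) ↔ N ≤ d - m + 1 := by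
  obtain ⟨ϖ, hϖ, hτϖ⟩ := exists_irreducible_addVal_algHom_sub hqA hq hπ hx hcop hd hmd
  have hN : τ ϖ - ϖ ∈ maximalIdeal A ^ N ↔ N ≤ d - m + 1 := by
    rw [← natCast_le_addVal_iff, hτϖ, Nat.cast_le]
  exact ⟨fun h => hN.1 (h ϖ), fun h => algHom_sub_mem_pow_of_irreducible hres hϖ (hN.2 h)⟩

end RamificationNumber

/-! ### Herbrand functions and jumps -/

section Herbrand

open Finset

variable {n : ℕ} {l : ℕ → ℝ}

/-- The number of `j < n` with `l j < s`, i.e. the number of jumps that are passed before `s` by a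
filtration with jumps `l 0, …, l (n - 1)`. -/
def jumpCount (n : ℕ) (l : ℕ → ℝ) (s : ℝ) : ℕ := #{j ∈ range n | l j < s}

lemma jumpCount_mono : Monotone (jumpCount n l) :=
  fun _ _ hst => card_le_card (monotone_filter_right _ fun _ _ h => h.trans_le hst)

lemma jumpCount_le (s : ℝ) : jumpCount n l s ≤ n :=
  (card_filter_le _ _).trans (card_range n).le

lemma jumpCount_eq {j : ℕ} {s : ℝ} (hj : j ≤ n) (hlt : ∀ i < j, l i < s)
    (hle : ∀ i, j ≤ i → i < n → s ≤ l i) : jumpCount n l s = j := by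
  have hrange : {i ∈ range n | l i < s} = range j := by
    ext i
    simp only [mem_filter, mem_range]
    refine ⟨fun ⟨hin, his⟩ => ?_, fun hij => ⟨hij.trans_le hj, hlt i hij⟩⟩
    by_contra hji
    exact (hle i (not_lt.1 hji) hin).not_gt his
  rw [jumpCount, hrange, card_range]

lemma jumpCount_eq_zero {s : ℝ} (h : ∀ j < n, s ≤ l j) : jumpCount n l s = 0 :=
  jumpCount_eq n.zero_le (by simp) fun i _ => h i

lemma jumpCount_eq_of_mem_Ioc (hl : StrictMonoOn l (Set.Iio n)) {j : ℕ} (hj : j + 1 < n) {s : ℝ}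
    (hs : s ∈ Set.Ioc (l j) (l (j + 1))) : jumpCount n l s = j + 1 := by
  refine jumpCount_eq hj.le (fun i hi => ?_) fun i hi hin => hs.2.trans ?_
  · exact (hl.monotoneOn (hi.trans hj) (j.lt_succ_self.trans hj) (Nat.lt_succ_iff.1 hi)).trans_lt
      hs.1
  · exact hl.monotoneOn hj hin hi

lemma jumpCount_apply (hl : StrictMonoOn l (Set.Iio n)) {j : ℕ} (hj : j < n) :
    jumpCount n l (l j) = j :=
  jumpCount_eq hj.le (fun _ hi => hl (hi.trans hj) hj hi) fun _ hi hin => hl.monotoneOn hj hin hi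

lemma lt_jumpCount (hl : StrictMonoOn l (Set.Iio n)) {j : ℕ} (hj : j < n) {s : ℝ} (hs : l j < s) :
    j < jumpCount n l s := by
  have hsub : range (j + 1) ⊆ {i ∈ range n | l i < s} := fun i hi => by
    rw [mem_range, Nat.lt_succ_iff] at hi
    exact mem_filter.2 ⟨mem_range.2 (hi.trans_lt hj),
      (hl.monotoneOn (hi.trans_lt hj) hj hi).trans_lt hs⟩
  exact (card_range (j + 1)).ge.trans (card_le_card hsub)

lemma jumpCount_le_iff (hl : StrictMonoOn l (Set.Iio n)) {j : ℕ} (hj : j < n) {s : ℝ} :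
    jumpCount n l s ≤ j ↔ s ≤ l j :=
  ⟨fun h => not_lt.1 fun hs => h.not_gt (lt_jumpCount hl hj hs),
    fun h => (jumpCount_mono h).trans (jumpCount_apply hl hj).le⟩

lemma exists_gt_jumpCount_eq {s : ℝ} (hs : ∀ j < n, l j ≠ s) :
    ∃ s', s < s' ∧ jumpCount n l s' = jumpCount n l s := by
  have hev : ∀ᶠ s' in nhdsWithin s (Set.Ioi s), ∀ j ∈ range n, (l j < s' ↔ l j < s) := by
    rw [Finset.eventually_all]
    intro j hj
    rcases (hs j (mem_range.1 hj)).lt_or_gt with h | h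
    · filter_upwards [self_mem_nhdsWithin] with s' hs'
      exact iff_of_true (h.trans hs') h
    · filter_upwards [mem_nhdsWithin_of_mem_nhds (Iio_mem_nhds h)] with s' hs'
      exact iff_of_false (not_lt.2 (le_of_lt hs')) (not_lt.2 h.le)
  obtain ⟨s', hiff, hs'⟩ := (hev.and self_mem_nhdsWithin).exists
  exact ⟨s', hs', congrArg card (filter_congr hiff)⟩

/-- The Herbrand function of a group of order `p ^ n` whose lower ramification filtration has jumps
`l 0 < ⋯ < l (n - 1)`, each of index `p`. -/
def herbrandOfJumps (p n : ℕ) (l : ℕ → ℝ) (u : ℝ) : ℝ :=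
  ∫ s in (0 : ℝ)..u, ((p : ℝ) ^ jumpCount n l s)⁻¹

variable (p : ℕ) [NeZero p]

lemma inv_pow_jumpCount_antitone : Antitone fun s => ((p : ℝ) ^ jumpCount n l s)⁻¹ :=
  fun _ _ hst => inv_anti₀ (pow_pos (Nat.cast_pos.2 (NeZero.pos p)) _)
    (pow_le_pow_right₀ (Nat.one_le_cast.2 NeZero.one_le) (jumpCount_mono hst))

lemma herbrandOfJumps_sub (a b : ℝ) : herbrandOfJumps p n l b - herbrandOfJumps p n l a =
    ∫ s in a..b, ((p : ℝ) ^ jumpCount n l s)⁻¹ :=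
  intervalIntegral.integral_interval_sub_left (inv_pow_jumpCount_antitone p).intervalIntegrable
    (inv_pow_jumpCount_antitone p).intervalIntegrable

lemma herbrandOfJumps_strictMono : StrictMono (herbrandOfJumps p n l) := by
  intro a b hab
  rw [← sub_pos, herbrandOfJumps_sub p]
  exact intervalIntegral.intervalIntegral_pos_of_pos
    (inv_pow_jumpCount_antitone p).intervalIntegrable
    (fun _ => inv_pos.2 (pow_pos (Nat.cast_pos.2 (NeZero.pos p)) _)) hab

lemma herbrandOfJumps_continuous : Continuous (herbrandOfJumps p n l) :=
  intervalIntegral.continuous_primitive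
    (fun _ _ => (inv_pow_jumpCount_antitone p).intervalIntegrable) 0

lemma herbrandOfJumps_sub_eq_of_jumpCount_eq {a b : ℝ} {k : ℕ} (hab : a ≤ b)
    (h : ∀ s ∈ Set.Ioc a b, jumpCount n l s = k) :
    herbrandOfJumps p n l b - herbrandOfJumps p n l a = (b - a) * ((p : ℝ) ^ k)⁻¹ := by
  rw [herbrandOfJumps_sub p,
    intervalIntegral.integral_congr_ae (g := fun _ => ((p : ℝ) ^ k)⁻¹),
    intervalIntegral.integral_const, smul_eq_mul]
  refine MeasureTheory.ae_of_all _ fun s hs => ?_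
  rw [Set.uIoc_of_le hab] at hs
  rw [h s hs]

lemma herbrandOfJumps_of_le {u : ℝ} (h0 : ∀ j < n, 0 < l j) (hu : ∀ j < n, u ≤ l j) :
    herbrandOfJumps p n l u = u := by
  have hzero : herbrandOfJumps p n l 0 = 0 := intervalIntegral.integral_same
  rcases le_total 0 u with h | h
  · have := herbrandOfJumps_sub_eq_of_jumpCount_eq p h (n := n) (l := l) fun s hs =>
      jumpCount_eq_zero fun j hj => hs.2.trans (hu j hj)
    simpa [hzero] using this
  · have := herbrandOfJumps_sub_eq_of_jumpCount_eq p h (n := n) (l := l) fun s hs =>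
      jumpCount_eq_zero fun j hj => hs.2.trans (h0 j hj).le
    simpa [hzero] using this

lemma herbrandOfJumps_succ (hl : StrictMonoOn l (Set.Iio n)) {j : ℕ} (hj : j + 1 < n) :
    herbrandOfJumps p n l (l (j + 1)) =
      herbrandOfJumps p n l (l j) + (l (j + 1) - l j) * ((p : ℝ) ^ (j + 1))⁻¹ := by
  rw [← herbrandOfJumps_sub_eq_of_jumpCount_eq p (hl (j.lt_succ_self.trans hj) hj j.lt_succ_self).le
    fun s hs => jumpCount_eq_of_mem_Ioc hl hj hs, add_sub_cancel]

lemma mul_inv_pow_le_herbrandOfJumps {u : ℝ} (hu : 0 ≤ u) :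
    u * ((p : ℝ) ^ n)⁻¹ ≤ herbrandOfJumps p n l u := by
  calc u * ((p : ℝ) ^ n)⁻¹ = ∫ _ in (0 : ℝ)..u, ((p : ℝ) ^ n)⁻¹ := by simp
    _ ≤ herbrandOfJumps p n l u := by
      refine intervalIntegral.integral_mono_on hu intervalIntegrable_const
        (inv_pow_jumpCount_antitone p).intervalIntegrable fun s _ => ?_
      exact inv_anti₀ (pow_pos (Nat.cast_pos.2 (NeZero.pos p)) _)
        (pow_le_pow_right₀ (Nat.one_le_cast.2 NeZero.one_le) (jumpCount_le s))

lemma herbrandOfJumps_surjOn (h0 : ∀ j < n, 0 < l j) :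
    Set.SurjOn (herbrandOfJumps p n l) (Set.Ici (-1)) (Set.Ici (-1)) := by
  intro v hv
  have hneg : herbrandOfJumps p n l (-1) = -1 :=
    herbrandOfJumps_of_le p h0 fun j hj => by linarith [h0 j hj]
  have hp : (0 : ℝ) < (p : ℝ) ^ n := pow_pos (Nat.cast_pos.2 (NeZero.pos p)) n
  have hb : v ≤ herbrandOfJumps p n l (|v| * (p : ℝ) ^ n) := by
    refine (le_abs_self v).trans ((le_of_eq ?_).trans (mul_inv_pow_le_herbrandOfJumps p ?_))
    · rw [mul_inv_cancel_right₀ hp.ne']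
    · positivity
  have hle : -1 ≤ |v| * (p : ℝ) ^ n := neg_one_lt_zero.le.trans (by positivity)
  obtain ⟨u, hu, huv⟩ := intermediate_value_Icc hle (herbrandOfJumps_continuous p).continuousOn
    (show v ∈ Set.Icc _ _ from ⟨hneg.le.trans hv, hb⟩)
  exact ⟨u, hu.1, huv⟩

end Herbrand

section Jumps

variable (R K L : Type*) [CommRing R] [Field K] [Algebra R K] [Field L] [Algebra K L] [Algebra R L]
  [IsScalarTower R K L]

lemma lowerRamificationGroup_antitone : Antitone (lowerRamificationGroup R K L) := by
  intro u v huv σ hσ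
  rw [lowerRamificationGroup, AddSubgroup.mem_inertia] at hσ ⊢
  have hexp : (⌈u⌉ + 1).toNat ≤ (⌈v⌉ + 1).toNat :=
    Int.toNat_le_toNat (Int.add_le_add_right (Int.ceil_mono huv) 1)
  exact fun a => Ideal.pow_le_pow_right hexp (hσ a)

lemma lowerRamificationGroup_neg_one : lowerRamificationGroup R K L (-1) = ⊤ := by
  refine eq_top_iff.2 fun σ _ => ?_
  rw [lowerRamificationGroup, AddSubgroup.mem_inertia, Int.ceil_neg, Int.floor_one]
  exact fun _ => Submodule.mem_toAddSubgroup _ |>.2 (by simp)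

/-- `Gal(L / K)` has order `p ^ n`, and the jumps of its lower ramification filtration are
`l 0 < ⋯ < l (n - 1)`, each of index `p`. -/
structure HasLowerJumps (p n : ℕ) (l : ℕ → ℝ) : Prop where
  strictMonoOn : StrictMonoOn l (Set.Iio n)
  pos : ∀ j < n, 0 < l j
  natCard : ∀ u, Nat.card (lowerRamificationGroup R K L u) = p ^ (n - jumpCount n l u)

namespace HasLowerJumps

variable {R K L} {p n : ℕ} {l : ℕ → ℝ} (H : HasLowerJumps R K L p n l)
include H

lemma natCard_gal : Nat.card (L ≃ₐ[K] L) = p ^ n := by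
  have h := H.natCard (-1)
  rwa [lowerRamificationGroup_neg_one, Subgroup.card_top,
    jumpCount_eq_zero fun j hj => by linarith [H.pos j hj], tsub_zero] at h

lemma finite [NeZero p] : Finite (L ≃ₐ[K] L) :=
  Nat.finite_of_card_ne_zero (H.natCard_gal ▸ pow_ne_zero n (NeZero.ne p))

lemma lowerRamificationGroup_zero [NeZero p] : lowerRamificationGroup R K L 0 = ⊤ := by
  have := H.finite
  refine Subgroup.eq_top_of_card_eq _ ?_
  rw [H.natCard, H.natCard_gal, jumpCount_eq_zero fun j hj => (H.pos j hj).le, tsub_zero]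

lemma index_lowerRamificationGroup [NeZero p] (u : ℝ) :
    (lowerRamificationGroup R K L u).index = p ^ jumpCount n l u := by
  have h := (lowerRamificationGroup R K L u).card_mul_index
  rw [H.natCard, H.natCard_gal, ← Nat.sub_add_cancel (jumpCount_le (n := n) (l := l) u), pow_add,
    Nat.sub_add_cancel (jumpCount_le u)] at h
  exact Nat.eq_of_mul_eq_mul_left (pow_pos (NeZero.pos p) _) h

lemma lowerRamificationGroup_eq_of_jumpCount_eq [NeZero p] {u u' : ℝ} (huu' : u ≤ u')
    (h : jumpCount n l u' = jumpCount n l u) :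
    lowerRamificationGroup R K L u' = lowerRamificationGroup R K L u := by
  have := H.finite
  refine Subgroup.eq_of_le_of_card_ge (lowerRamificationGroup_antitone R K L huu') ?_
  rw [H.natCard, H.natCard, h]

lemma herbrand_eq [NeZero p] : herbrand R K L = herbrandOfJumps p n l := by
  funext u
  simp only [herbrand, herbrandOfJumps, H.lowerRamificationGroup_zero, Subgroup.relIndex_top_right,
    H.index_lowerRamificationGroup, Nat.cast_pow]

lemma upperRamificationGroup_herbrandOfJumps [NeZero p] {u : ℝ} (hu : -1 ≤ u) :
    upperRamificationGroup R K L (herbrandOfJumps p n l u) = lowerRamificationGroup R K L u := by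
  rw [upperRamificationGroup, H.herbrand_eq]
  congr 1
  exact (herbrandOfJumps_strictMono p).injective (Function.invFunOn_eq ⟨u, hu, rfl⟩)

lemma lowerRamificationGroup_ne_of_lt (hp : 1 < p) {j : ℕ} (hj : j < n) {u : ℝ} (hu : l j < u) :
    lowerRamificationGroup R K L u ≠ lowerRamificationGroup R K L (l j) := by
  intro h
  have hcard := H.natCard u
  rw [h, H.natCard, jumpCount_apply H.strictMonoOn hj] at hcard
  have hexp := Nat.pow_right_injective hp hcard
  have hlt := lt_jumpCount H.strictMonoOn hj hu
  have hle := jumpCount_le (n := n) (l := l) u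
  omega

theorem upperJumps_eq (hp : 1 < p) :
    upperJumps R K L = {v | ∃ j < n, v = herbrandOfJumps p n l (l j)} := by
  have : NeZero p := ⟨(zero_lt_one.trans hp).ne'⟩
  have hmono : StrictMono (herbrandOfJumps p n l) := herbrandOfJumps_strictMono p
  ext v
  constructor
  · rintro ⟨hv, hjump⟩
    obtain ⟨u, hu, rfl⟩ := herbrandOfJumps_surjOn p H.pos hv
    by_contra hne
    obtain ⟨u', huu', hcount⟩ := exists_gt_jumpCount_eq (n := n) (l := l) (s := u)
      fun j hj hju => hne ⟨j, hj, by rw [hju]⟩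
    apply hjump _ (sub_pos.2 (hmono huu'))
    rw [add_sub_cancel, H.upperRamificationGroup_herbrandOfJumps hu,
      H.upperRamificationGroup_herbrandOfJumps (hu.trans huu'.le),
      H.lowerRamificationGroup_eq_of_jumpCount_eq huu'.le hcount]
  · rintro ⟨j, hj, rfl⟩
    have hlj : -1 ≤ l j := by linarith [H.pos j hj]
    have hv : -1 ≤ herbrandOfJumps p n l (l j) := by
      rw [← herbrandOfJumps_of_le p H.pos (u := -1) fun i hi => by linarith [H.pos i hi]]
      exact hmono.monotone hlj
    refine ⟨hv, fun ε hε heq => ?_⟩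
    obtain ⟨u, hu, huv⟩ := herbrandOfJumps_surjOn p H.pos
      (show -1 ≤ herbrandOfJumps p n l (l j) + ε by linarith)
    have hlt : l j < u := hmono.lt_iff_lt.1 (by linarith)
    rw [← huv, H.upperRamificationGroup_herbrandOfJumps hlj,
      H.upperRamificationGroup_herbrandOfJumps hu] at heq
    exact H.lowerRamificationGroup_ne_of_lt hp hj hlt heq.symm

theorem upperRamificationGroup_ne_bot (hp : 1 < p) {j : ℕ} (hj : j < n) :
    upperRamificationGroup R K L (herbrandOfJumps p n l (l j)) ≠ ⊥ := by
  have : NeZero p := ⟨(zero_lt_one.trans hp).ne'⟩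
  rw [H.upperRamificationGroup_herbrandOfJumps (by linarith [H.pos j hj])]
  intro h
  refine H.lowerRamificationGroup_ne_of_lt hp hj (lt_add_one (l j)) ?_
  rw [h, eq_bot_iff, ← h]
  exact lowerRamificationGroup_antitone R K L (lt_add_one (l j)).le

end HasLowerJumps

end Jumps

/-! ### Extensions generated by a preimage under an isogeny -/

section Field

open Polynomial

variable {K L : Type*} [Field K] [Field L] [Algebra K L] [FiniteDimensional K L] {ξ : L}
  (hξ : IntermediateField.adjoin K {ξ} = ⊤)
include hξ

lemma finrank_le_natDegree_of_aeval_eq_zero {P : K[X]} (hP : P ≠ 0) (hr : aeval ξ P = 0) :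
    Module.finrank K L ≤ P.natDegree := by
  rw [← (Field.primitive_element_iff_minpoly_natDegree_eq K ξ).1 hξ]
  exact natDegree_le_of_dvd (minpoly.dvd K ξ hr) hP

lemma algebra_adjoin_eq_top : Algebra.adjoin K {ξ} = ⊤ := by
  rw [← IntermediateField.adjoin_simple_toSubalgebra_of_isAlgebraic
    (Algebra.IsAlgebraic.isAlgebraic ξ), hξ, IntermediateField.top_toSubalgebra]

lemma algEquiv_eq_of_apply_eq {σ τ : L ≃ₐ[K] L} (h : σ ξ = τ ξ) : σ = τ := by
  have hhom : (σ : L →ₐ[K] L) = τ := by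
    refine AlgHom.ext_of_adjoin_eq_top (algebra_adjoin_eq_top hξ) ?_
    rintro _ rfl
    exact h
  exact AlgEquiv.coe_toAlgHom_injective hhom

lemma isGalois_of_natDegree_le_card {P : K[X]} (hP : P ≠ 0) (hr : aeval ξ P = 0) {s : Finset L}
    (hroot : ∀ x ∈ s, aeval x P = 0) (hd : P.natDegree ≤ s.card) : IsGalois K L := by
  have hle : s.val ≤ P.aroots L :=
    (Multiset.le_iff_subset s.nodup).2 fun x hx => mem_aroots.2 ⟨hP, hroot x hx⟩
  have hcard : (P.aroots L).card ≤ P.natDegree := by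
    simpa only [natDegree_map] using card_roots' (P.map (algebraMap K L))
  have hroots : s.val = P.aroots L := Multiset.eq_of_le_of_card_le hle (hcard.trans hd)
  have hsplits : (P.map (algebraMap K L)).Splits := by
    rw [splits_iff_card_roots, natDegree_map]
    exact le_antisymm hcard (hd.trans (Multiset.card_le_card hle))
  have hsep : P.Separable := (nodup_aroots_iff_of_splits hP hsplits).1 (hroots ▸ s.nodup)
  have : IsSplittingField K L P := by
    refine ⟨hsplits, eq_top_iff.2 ?_⟩
    rw [← algebra_adjoin_eq_top hξ]
    exact Algebra.adjoin_mono (Set.singleton_subset_iff.2 (mem_rootSet.2 ⟨hP, hr⟩))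
  exact IsGalois.of_separable_splitting_field hsep

end Field

section Cokernel

open IsDiscreteValuationRing hiding maximalIdeal

variable {R : Type*} [CommRing R] [IsDomain R] [IsDiscreteValuationRing R]
  [IsAdicComplete (maximalIdeal R) R] {F G : FormalGroup R} {φ : PowerSeries R}

lemma exists_add_onPoints_eq_of_mem_cokernelFiltration (hφ : IsHom F G φ) {m : ℕ} (hm : m ≠ 0)
    {y : R} (hy : y ∈ cokernelFiltration G φ m) (hy' : y ∉ cokernelFiltration G φ (m + 1)) :
    ∃ (u : Points R G) (z : Points R F), addVal R u.1 = m ∧ (u + hφ.onPoints z).1 = y := by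
  obtain ⟨hym, u, hu, z, hz, w, hw, hs⟩ := hy
  obtain rfl : w = ev φ z := (hasValue_map_iff (AlgHom.id R R) hz).1 hw
  let u' : Points R G := ⟨u, Ideal.pow_le_self hm hu⟩
  let z' : Points R F := ⟨z, hz⟩
  refine ⟨u', z', le_antisymm ?_ (natCast_le_addVal_iff.2 hu),
    ((hasFormalSum_map_iff (AlgHom.id R R) u' (hφ.onPoints z')).1 hs).symm⟩
  refine Order.le_of_lt_add_one (not_le.1 fun hlt => hy' ⟨hym, u, ?_, z, hz, _, hw, hs⟩)
  rw [← natCast_le_addVal_iff]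
  exact_mod_cast hlt

end Cokernel

section Extension

variable {R : Type*} [CommRing R] [IsLocalRing R] [IsAdicComplete (maximalIdeal R) R]
  {F G : FormalGroup R} {φ : PowerSeries R}

section OnPoints

variable {A B : Type*} [CommRing A] [IsLocalRing A] [Algebra R A]
  [IsAdicComplete (maximalIdeal A) A] [CommRing B] [IsLocalRing B] [Algebra R B]
  [IsAdicComplete (maximalIdeal B) B]

omit [IsLocalRing R] [IsAdicComplete (maximalIdeal R) R] in
lemma IsHom.onPoints_map (hφ : IsHom F G φ) (θ : A →ₐ[R] B) [IsLocalHom θ] (x : Points A F) :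
    hφ.onPoints (Points.map θ x) = Points.map θ (hφ.onPoints x) :=
  Points.ext (map_ev x.2 θ φ).symm

end OnPoints

namespace IsIsogeny

variable {A : Type*} [CommRing A] [IsDomain A] [IsLocalRing A] [Algebra R A]
  [IsAdicComplete (maximalIdeal A) A] [IsLocalHom (algebraMap R A)]
  {p n : ℕ} (hφ : IsIsogeny p n F G φ) (hp : p ≠ 0)
include hφ hp

lemma exists_map_nsmul_eq [IsDomain R] {z : Points R F} (hz : addOrderOf z = p ^ n)
    (hz0 : hφ.isHom.onPoints z = 0) {d : Points A F} (hd : hφ.isHom.onPoints d = 0) :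
    ∃ k < p ^ n, d = Points.map (Algebra.ofId R A) (k • z) := by
  obtain ⟨f, hf, hφf⟩ := hφ.exists_eq_prod hp (hz ▸ nsmul_injOn_Iio_addOrderOf)
    (Points.val_eq_zero.2 hz0)
  have hev : ev φ d.1 = 0 := Points.val_eq_zero.2 hd
  rw [hφf, ev_mul d.2, (isUnit_ev d.2 hf).mul_left_eq_zero, ev_coe d.2, map_prod,
    Finset.prod_eq_zero_iff] at hev
  obtain ⟨k, hk, hk0⟩ := hev
  rw [map_sub, Polynomial.aeval_X, Polynomial.aeval_C, sub_eq_zero] at hk0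
  exact ⟨k, Finset.mem_range.1 hk, Points.ext hk0⟩

omit [IsDomain A] in
lemma exists_monic_aeval_eq_zero (y : Points R G) : ∃ f : Polynomial R, f.Monic ∧
    f.natDegree = p ^ n ∧ ∀ a : Points A F,
      hφ.isHom.onPoints a = Points.map (Algebra.ofId R A) y → Polynomial.aeval a.1 f = 0 := by
  have hpn : p ^ n ≠ 0 := pow_ne_zero n hp
  have hcoeff : PowerSeries.coeff (p ^ n) (φ - PowerSeries.C y.1) ∉ maximalIdeal R := by
    rw [map_sub, PowerSeries.coeff_C_of_ne_zero hpn, sub_zero]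
    exact hφ.hasHeight.coeff_pow_notMem hp
  have hlt : ∀ i < p ^ n, PowerSeries.coeff i (φ - PowerSeries.C y.1) ∈ maximalIdeal R := by
    intro i hi
    rw [map_sub, PowerSeries.coeff_C]
    refine sub_mem (hφ.hasHeight.coeff_mem_of_lt hφ.isHom.constantCoeff_eq_zero hi) ?_
    split_ifs
    exacts [y.2, zero_mem _]
  obtain ⟨f, h, hf, hdeg, -, hu, hfh⟩ := exists_weierstrass hcoeff hlt
  refine ⟨f, hf, hdeg, fun a ha => ?_⟩
  have hev : ev (φ - PowerSeries.C y.1) a.1 = 0 := by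
    have ha' : ev φ a.1 = algebraMap R A y.1 := congrArg Points.val ha
    rw [← evHom_apply a.1 a.2, map_sub, evHom_apply, evHom_apply, ha', ← Polynomial.coe_C,
      ev_coe a.2, Polynomial.aeval_C, sub_self]
  rwa [hfh, ev_mul a.2, (isUnit_ev a.2 hu).mul_left_eq_zero, ev_coe a.2] at hev

lemma exists_map_eq_add_map_nsmul [IsDomain R] {z : Points R F} (hz : addOrderOf z = p ^ n)
    (hz0 : hφ.isHom.onPoints z = 0) {x : Points A F} {y : Points R G}
    (hxy : hφ.isHom.onPoints x = Points.map (Algebra.ofId R A) y) (τ : A →ₐ[R] A)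
    [IsLocalHom τ] :
    ∃ k < p ^ n, Points.map τ x = x + Points.map (Algebra.ofId R A) (k • z) := by
  have hker : hφ.isHom.onPoints (-x + Points.map τ x) = 0 := by
    have hτy : Points.map τ (Points.map (Algebra.ofId R A) y) = Points.map (Algebra.ofId R A) y :=
      Points.ext (τ.commutes _)
    rw [map_add, map_neg, hφ.isHom.onPoints_map, hxy, hτy, neg_add_cancel]
  obtain ⟨k, hk, hxk⟩ := hφ.exists_map_nsmul_eq hp hz hz0 hker
  exact ⟨k, hk, neg_add_eq_iff_eq_add.1 hxk⟩

end IsIsogeny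

end Extension

section Galois

variable {R : Type*} [CommRing R]

instance isLocalHom_toAlgHom {Γ A : Type*} [Group Γ] [CommRing A] [Algebra R A]
    [MulSemiringAction Γ A] [SMulCommClass Γ R A] (σ : Γ) :
    IsLocalHom (MulSemiringAction.toAlgHom R A σ) where
  map_nonunit a ha := by
    simpa using ha.map (MulSemiringAction.toAlgHom R A σ⁻¹)

variable {K L : Type*} [Field K] [Algebra R K] [Field L] [Algebra K L] [Algebra R L]
  [IsScalarTower R K L]

lemma mem_lowerRamificationGroup_iff [IsLocalRing (integralClosure R L)] {σ : L ≃ₐ[K] L} {u : ℝ} :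
    σ ∈ lowerRamificationGroup R K L u ↔
      ∀ a, MulSemiringAction.toAlgHom R (integralClosure R L) σ a - a ∈
        maximalIdeal (integralClosure R L) ^ (⌈u⌉ + 1).toNat := by
  rw [lowerRamificationGroup, ringJacobson_eq_maximalIdeal]
  exact AddSubgroup.mem_inertia

variable [IsDomain R] [IsLocalRing R] [IsAdicComplete (maximalIdeal R) R]
  [IsFractionRing R K] [FiniteDimensional K L]
  [IsLocalRing (integralClosure R L)]
  [IsAdicComplete (maximalIdeal (integralClosure R L)) (integralClosure R L)]
  [IsLocalHom (algebraMap R (integralClosure R L))]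
  {F G : FormalGroup R} {φ : PowerSeries R} {p n : ℕ} (hφ : IsIsogeny p n F G φ) (hp : p ≠ 0)
  {ξ : Points (integralClosure R L) F} (hξ : IntermediateField.adjoin K {(ξ.1 : L)} = ⊤)
  {y : Points R G} (hξy : hφ.isHom.onPoints ξ = Points.map (Algebra.ofId R _) y)

include hp hξ hξy

omit [IsDomain R] [IsFractionRing R K] in
lemma IsIsogeny.finrank_le : Module.finrank K L ≤ p ^ n := by
  obtain ⟨f, hf, hdeg, hroot⟩ := hφ.exists_monic_aeval_eq_zero (A := integralClosure R L) hp y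
  rw [← hdeg, ← hf.natDegree_map (algebraMap R K)]
  refine finrank_le_natDegree_of_aeval_eq_zero hξ (hf.map _).ne_zero ?_
  rw [Polynomial.aeval_map_algebraMap, Subalgebra.aeval_coe, hroot ξ hξy, ZeroMemClass.coe_zero]

lemma IsIsogeny.isGalois {z : Points R F} (hz : addOrderOf z = p ^ n)
    (hz0 : hφ.isHom.onPoints z = 0) : IsGalois K L := by
  classical
  have := faithfulSMul_of_isFractionRing R K L
  obtain ⟨f, hf, hdeg, hroot⟩ := hφ.exists_monic_aeval_eq_zero (A := integralClosure R L) hp y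
  let r : ℕ → L := fun k => (ξ + Points.map (Algebra.ofId R _) (k • z)).1
  have hr : ∀ k, Polynomial.aeval (r k) (f.map (algebraMap R K)) = 0 := by
    intro k
    rw [Polynomial.aeval_map_algebraMap, Subalgebra.aeval_coe, hroot, ZeroMemClass.coe_zero]
    rw [map_add, hφ.isHom.onPoints_map, map_nsmul, hz0, nsmul_zero, map_zero, add_zero, hξy]
  have hinj : Set.InjOn r (Finset.range (p ^ n)) := by
    intro k hk l hl hkl
    have hval : Points.map (Algebra.ofId R (integralClosure R L)) (k • z) =
        Points.map (Algebra.ofId R _) (l • z) := add_left_cancel (Points.ext (Subtype.ext hkl))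
    refine nsmul_injOn_Iio_addOrderOf (x := z) (by simpa [hz] using hk) (by simpa [hz] using hl) ?_
    exact Points.ext (FaithfulSMul.algebraMap_injective R (integralClosure R L)
      (congrArg Points.val hval))
  refine isGalois_of_natDegree_le_card hξ (s := (Finset.range (p ^ n)).image r)
    (hf.map (algebraMap R K)).ne_zero ?_ (by simpa using fun k _ => hr k) ?_
  · rw [Polynomial.aeval_map_algebraMap, Subalgebra.aeval_coe, hroot ξ hξy, ZeroMemClass.coe_zero]
  · rw [Finset.card_image_of_injOn hinj, Finset.card_range, hf.natDegree_map, hdeg]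

omit [IsFractionRing R K] hξ in
lemma IsIsogeny.exists_equiv_fin [IsGalois K L] {z : Points R F} (hz : addOrderOf z = p ^ n)
    (hz0 : hφ.isHom.onPoints z = 0) (hgen : ∀ σ τ : L ≃ₐ[K] L, σ ξ.1 = τ ξ.1 → σ = τ)
    (hfin : Module.finrank K L = p ^ n) :
    ∃ κ : (L ≃ₐ[K] L) ≃ Fin (p ^ n), ∀ σ,
      Points.map (MulSemiringAction.toAlgHom R (integralClosure R L) σ) ξ =
        ξ + Points.map (Algebra.ofId R _) ((κ σ : ℕ) • z) := by
  choose κ hκ hκξ using fun σ : L ≃ₐ[K] L => hφ.exists_map_eq_add_map_nsmul hp hz hz0 hξy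
    (MulSemiringAction.toAlgHom R (integralClosure R L) σ)
  have hinj : Function.Injective fun σ => (⟨κ σ, hκ σ⟩ : Fin (p ^ n)) := by
    intro σ τ h
    have hk : κ σ = κ τ := congrArg Fin.val h
    have hστ := (hκξ σ).trans (hk ▸ (hκξ τ).symm)
    exact hgen σ τ (congrArg (fun x : Points (integralClosure R L) F => (x.1 : L)) hστ)
  refine ⟨Equiv.ofBijective _ (hinj.bijective_of_nat_card_le ?_), hκξ⟩
  rw [IsGalois.card_aut_eq_finrank, hfin, Nat.card_fin]

end Galois

section Ramification

open IsDiscreteValuationRing hiding maximalIdeal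

variable {R : Type*} [CommRing R] [IsDomain R] [IsDiscreteValuationRing R]
  [IsAdicComplete (maximalIdeal R) R] {p n : ℕ}
  {Gs : ℕ → FormalGroup R} {φs : ℕ → PowerSeries R} {x₀ : Points R (Gs n)}

namespace IsKernelGenerator

variable (H : IsKernelGenerator p n Gs φs x₀)
include H

lemma addOrderOf_eq [Fact p.Prime] : addOrderOf x₀ = p ^ n := by
  cases n with
  | zero => simpa only [pow_zero, one_smul, AddMonoid.addOrderOf_eq_one_iff] using H.pow_nsmul
  | succ n =>
    refine addOrderOf_eq_prime_pow (fun h => ?_) H.pow_nsmul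
    refine H.chain_ne_zero n n.lt_succ_self ?_
    rw [chain_self, h, Points.val_zero]

lemma ev_comp_eq_zero : ev (comp φs 0 n) x₀.1 = 0 := by
  cases n with
  | zero =>
    have h := H.pow_nsmul
    rw [pow_zero, one_smul] at h
    rw [h, Points.val_zero]
    exact ev_X _
  | succ n =>
    have h := H.chain_eq_zero 0 n.succ_pos
    rwa [pow_zero, one_smul, chain, tsub_zero] at h

variable [Fact p.Prime] [CharP (ResidueField R) p]

section

variable {A : Type*} [CommRing A] [IsDomain A] [IsDiscreteValuationRing A] [Algebra R A]
  [FaithfulSMul R A] [IsLocalHom (algebraMap R A)] [IsAdicComplete (maximalIdeal A) A]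

lemma natCast_ramificationIdx_mul {m : ℕ} (hm : m < p * level p φs x₀ 0) {u : R}
    (hu : addVal R u = m) {x : Points A (Gs n)}
    (hxu : ev (comp φs 0 n) x.1 = algebraMap R A u) :
    (((maximalIdeal A).ramificationIdx R * m : ℕ) : ℕ∞) =
      (p ^ n : ℕ) * addVal A x.1 := by
  have he : ∀ r, _ := fun r => addVal_algebraMap (R := R) (A := A) r
  have he0 := ramificationIdx_maximalIdeal_ne_zero R A
  set e := (maximalIdeal A).ramificationIdx R
  have hchain : addVal A (chain φs n 0 x.1) = (e * m : ℕ) := by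
    rw [chain, tsub_zero, hxu, he, hu, Nat.cast_mul]
  have hadd := (H.addVal_chain_add he he0 x.2 (i := 0) (l := n)
    (fun _ => by
      rw [hchain, Nat.cast_lt, Nat.mul_left_comm]
      exact Nat.mul_lt_mul_of_pos_left hm (Nat.pos_of_ne_zero he0)) (zero_add n).le).1
  rwa [hchain, zero_add, chain_self] at hadd

end

variable {K L : Type*} [Field K] [CharZero K] [Algebra R K]
  [IsFractionRing R K] [Field L] [Algebra K L] [Algebra R L] [IsScalarTower R K L]
  [FiniteDimensional K L] [IsDiscreteValuationRing (integralClosure R L)]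
  [IsAdicComplete (maximalIdeal (integralClosure R L)) (integralClosure R L)]

lemma ramificationIdx_eq (hle : Module.finrank K L ≤ p ^ n) {m : ℕ} (hmp : ¬ p ∣ m)
    (hm : m < p * level p φs x₀ 0) {u : R} (hu : addVal R u = m)
    {x : Points (integralClosure R L) (Gs n)}
    (hxu : ev (comp φs 0 n) x.1 = algebraMap R (integralClosure R L) u) :
    Module.finrank K L = p ^ n ∧ (maximalIdeal (integralClosure R L)).ramificationIdx R = p ^ n ∧
      addVal (integralClosure R L) x.1 = m := by
  have hp := (Fact.out : p.Prime)
  have := faithfulSMul_of_isFractionRing R K L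
  have he0 := ramificationIdx_maximalIdeal_ne_zero R (integralClosure R L)
  have hef := ramificationIdx_mul_inertiaDeg_integralClosure R K L
  have hval := H.natCast_ramificationIdx_mul hm hu hxu
  set e := (maximalIdeal (integralClosure R L)).ramificationIdx R
  have hpn : p ^ n ≠ 0 := pow_ne_zero n hp.ne_zero
  have hcop : (p ^ n).Coprime m := ((Nat.Prime.coprime_iff_not_dvd hp).2 hmp).pow_left n
  obtain ⟨v, hv⟩ : ∃ v : ℕ, addVal (integralClosure R L) x.1 = v := by
    refine ENat.ne_top_iff_exists.1 (fun htop => ?_) |>.imp fun _ => Eq.symm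
    rw [htop, ENat.mul_top (Nat.cast_ne_zero.2 hpn)] at hval
    exact ENat.natCast_ne_top _ hval
  have hev : e * m = p ^ n * v := by rw [hv] at hval; exact_mod_cast hval
  have hge : p ^ n ≤ e :=
    Nat.le_of_dvd (Nat.pos_of_ne_zero he0) (hcop.dvd_of_dvd_mul_right (hev ▸ dvd_mul_right _ _))
  have hle' : e ≤ Module.finrank K L := Nat.le_of_dvd Module.finrank_pos (Dvd.intro _ hef)
  have hpe : e = p ^ n := le_antisymm (hle'.trans hle) hge
  refine ⟨le_antisymm hle (hge.trans hle'), hpe, ?_⟩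
  rw [hpe] at hev
  rw [hv, ← Nat.eq_of_mul_eq_mul_left (Nat.pos_of_ne_zero hpn) hev]

end IsKernelGenerator

end Ramification

lemma natCard_fin_dvd {r N : ℕ} (hr : 0 < r) (hN : r ∣ N) :
    Nat.card {k : Fin N // r ∣ k} = N / r := by
  have hcount := Nat.count_modEq_card N hr 0
  simp only [Nat.zero_mod, Nat.mod_eq_zero_of_dvd hN, lt_irrefl, if_false, add_zero] at hcount
  rw [← hcount, Nat.card_eq_fintype_card, Fintype.card_subtype, Finset.card_filter,
    Fin.sum_univ_eq_sum_range fun k => if r ∣ k then 1 else 0, ← Finset.card_filter,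
    Nat.count_eq_card_filter_range]
  simp only [Nat.modEq_zero_iff_dvd]

lemma toNat_ceil_add_one_le_iff {u : ℝ} {m d : ℕ} (hmd : m < d) :
    (⌈u⌉ + 1).toNat ≤ d - m + 1 ↔ u ≤ (d : ℝ) - m := by
  have hceil : u ≤ (d : ℝ) - m ↔ ⌈u⌉ ≤ (d : ℤ) - m := by
    rw [Int.ceil_le]
    push_cast
    rfl
  rw [hceil]
  omega

namespace IsKernelGenerator

open IsDiscreteValuationRing hiding maximalIdeal

variable {R : Type*} [CommRing R] [IsDomain R] [IsDiscreteValuationRing R]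
  [IsAdicComplete (maximalIdeal R) R] {p n : ℕ} {Gs : ℕ → FormalGroup R}
  {φs : ℕ → PowerSeries R}

/-- The `j`-th lower jump of the extension generated by a preimage of a point of valuation `m`:
since the extension has ramification index `p ^ n`, the valuation of `[k pʲ] x₀` in it is
`p ^ (j + 1) * level p φs x₀ j` for `k` prime to `p`. -/
def lowerJump (p : ℕ) (φs : ℕ → PowerSeries R) (x₀ : Points R (Gs n)) (m j : ℕ) : ℝ :=
  (p ^ (j + 1) * level p φs x₀ j : ℕ) - m

variable [Fact p.Prime] [CharP (ResidueField R) p] {x₀ : Points R (Gs n)}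
  (H : IsKernelGenerator p n Gs φs x₀) {m j : ℕ}
include H

lemma cast_t_eq (hj : j < n) : (t φs (j + 1) : ℝ) = (p - 1) * level p φs x₀ j := by
  rw [H.t_eq hj, Nat.cast_mul, Nat.cast_sub (Fact.out : p.Prime).one_lt.le, Nat.cast_one]

lemma c_one (hn : 0 < n) : c p φs 1 = (p * level p φs x₀ 0 : ℕ) := by
  have hp1 : (p : ℝ) - 1 ≠ 0 := sub_ne_zero.2 (by exact_mod_cast (Fact.out : p.Prime).one_lt.ne')
  rw [c, Finset.Icc_self, Finset.sum_singleton, H.cast_t_eq hn, mul_div_cancel_left₀ _ hp1]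
  push_cast
  ring

lemma lowerJump_strictMonoOn : StrictMonoOn (lowerJump p φs x₀ m) (Set.Iio n) := by
  refine strictMonoOn_of_lt_succ Set.ordConnected_Iio fun j _ _ hj => ?_
  have hlt : p ^ (j + 1) * level p φs x₀ j < p ^ (j + 1 + 1) * level p φs x₀ (j + 1) := by
    rw [pow_succ p (j + 1), mul_assoc]
    exact Nat.mul_lt_mul_of_pos_left (H.level_lt hj) (pow_pos (Fact.out : p.Prime).pos _)
  exact sub_lt_sub_right (Nat.cast_lt.2 hlt) _

lemma lowerJump_pos (hm : m < p * level p φs x₀ 0) (hj : j < n) : 0 < lowerJump p φs x₀ m j := by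
  refine lt_of_lt_of_le ?_ (H.lowerJump_strictMonoOn.monotoneOn (j.zero_le.trans_lt hj) hj
    j.zero_le)
  rw [lowerJump, zero_add, pow_one]
  exact sub_pos.2 (Nat.cast_lt.2 hm)

lemma herbrandOfJumps_lowerJump (hm : m < p * level p φs x₀ 0) (hj : j < n) :
    herbrandOfJumps p n (lowerJump p φs x₀ m) (lowerJump p φs x₀ m j) = c p φs (j + 1) - m := by
  have hp : p.Prime := Fact.out
  have : NeZero p := ⟨hp.ne_zero⟩
  have hp0 : (p : ℝ) ≠ 0 := Nat.cast_ne_zero.2 hp.ne_zero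
  have hp1 : (p : ℝ) - 1 ≠ 0 := sub_ne_zero.2 (by exact_mod_cast hp.one_lt.ne')
  have hl := H.lowerJump_strictMonoOn (m := m)
  induction j with
  | zero =>
    rw [herbrandOfJumps_of_le p (fun _ => H.lowerJump_pos hm)
      fun i hi => hl.monotoneOn hj hi i.zero_le, lowerJump, zero_add, pow_one, H.c_one hj]
  | succ j ih =>
    have hj' : j < n := j.lt_succ_self.trans hj
    rw [herbrandOfJumps_succ p hl hj, ih hj', c, c, Finset.sum_Icc_succ_top (by omega : 1 ≤ j + 2),
      H.cast_t_eq hj', H.cast_t_eq hj, lowerJump, lowerJump]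
    push_cast
    field_simp
    ring

lemma pow_mul_addVal_nsmul (hj : j < n) {k : ℕ} (hk : p.Coprime k) :
    (p ^ n : ℕ) * addVal R ((p ^ j * k) • x₀).1 = (p ^ (j + 1) * level p φs x₀ j : ℕ) := by
  have hpow : p ^ n = p ^ (j + 1) * p ^ (n - (j + 1)) := by
    rw [← pow_add, Nat.add_sub_cancel' hj]
  rw [mul_nsmul, Points.addVal_nsmul_of_isUnit _
    (isUnit_natCast_of_coprime (natCast_mem_maximalIdeal R p) hk), Nat.cast_mul, H.level_eq hj,
    hpow, Nat.cast_mul, mul_assoc]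

section Automorphism

variable {A : Type*} [CommRing A] [IsDomain A] [IsDiscreteValuationRing A] [Algebra R A]
  [IsAdicComplete (maximalIdeal A) A] [IsLocalHom (algebraMap R A)]

lemma forall_algHom_sub_mem_pow_iff_dvd (hn : n ≠ 0) (hmp : ¬ p ∣ m)
    (hm : m < p * level p φs x₀ 0)
    (he : ∀ r : R, addVal A (algebraMap R A r) = (p ^ n : ℕ) * addVal R r)
    (hres : ∀ a : A, ∃ r : R, a - algebraMap R A r ∈ maximalIdeal A)
    {x : Points A (Gs n)} (hx : addVal A x.1 = m) {τ : A →ₐ[R] A} [IsLocalHom τ] {k : ℕ}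
    (hk0 : k ≠ 0) (hk : k < p ^ n)
    (hτ : Points.map τ x = x + Points.map (Algebra.ofId R A) (k • x₀)) (u : ℝ) :
    (∀ a, τ a - a ∈ maximalIdeal A ^ (⌈u⌉ + 1).toNat) ↔
      p ^ jumpCount n (lowerJump p φs x₀ m) u ∣ k := by
  have hp : p.Prime := Fact.out
  obtain ⟨j, k, hpk, rfl⟩ := Nat.exists_eq_pow_mul_and_not_dvd hk0 p hp.ne_one
  have hj : j < n := (Nat.pow_lt_pow_iff_right hp.one_lt).1
    ((Nat.le_mul_of_pos_right _ (Nat.pos_of_ne_zero (right_ne_zero_of_mul hk0))).trans_lt hk)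
  have hcop : p.Coprime k := (Nat.Prime.coprime_iff_not_dvd hp).2 hpk
  have hd : addVal A (τ x.1 - x.1) = (p ^ (j + 1) * level p φs x₀ j : ℕ) := by
    rw [← Points.val_map τ x, hτ, Points.addVal_val_add_sub, Points.val_map]
    exact (he _).trans (H.pow_mul_addVal_nsmul hj hcop)
  have hmd : m < p ^ (j + 1) * level p φs x₀ j :=
    Nat.cast_lt.1 (sub_pos.1 (H.lowerJump_pos hm hj))
  obtain ⟨π, hπ⟩ := exists_irreducible R
  have hπq : addVal A (algebraMap R A π) = (p ^ n : ℕ) := by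
    rw [he, addVal_uniformizer hπ, mul_one]
  have hqA : ((p ^ n : ℕ) : A) ∈ maximalIdeal A := by
    rw [Nat.cast_pow]
    refine Ideal.pow_mem_of_mem _ ?_ n (Nat.pos_of_ne_zero hn)
    simpa only [map_natCast] using
      algHom_mem_maximalIdeal (Algebra.ofId R A) (natCast_mem_maximalIdeal R p)
  rw [forall_algHom_sub_mem_pow_iff hres hqA (Nat.one_lt_pow hn hp.one_lt) hπq hx
    (((Nat.Prime.coprime_iff_not_dvd hp).2 hmp).symm.pow_right n) hd hmd,
    toNat_ceil_add_one_le_iff hmd, (Nat.Coprime.pow_left _ hcop).dvd_mul_right,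
    Nat.pow_dvd_pow_iff_le_right hp.one_lt, jumpCount_le_iff H.lowerJump_strictMonoOn hj, lowerJump]

end Automorphism

section Galois

variable {K L : Type*} [Field K] [Algebra R K] [Field L] [Algebra K L]
  [Algebra R L] [IsScalarTower R K L] [FiniteDimensional K L]
  [IsDiscreteValuationRing (integralClosure R L)]
  [IsAdicComplete (maximalIdeal (integralClosure R L)) (integralClosure R L)]
  [IsLocalHom (algebraMap R (integralClosure R L))]

lemma hasLowerJumps [IsGalois K L] (hφ : IsIsogeny p n (Gs n) (Gs 0) (comp φs 0 n))
    (hfin : Module.finrank K L = p ^ n) {x : Points (integralClosure R L) (Gs n)}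
    (hgen : ∀ σ τ : L ≃ₐ[K] L, σ x.1 = τ x.1 → σ = τ) {u : Points R (Gs 0)}
    (hxu : hφ.isHom.onPoints x = Points.map (Algebra.ofId R _) u) (hn : n ≠ 0) (hmp : ¬ p ∣ m)
    (hm : m < p * level p φs x₀ 0) (hx : addVal (integralClosure R L) x.1 = m)
    (he : ∀ r : R, addVal (integralClosure R L) (algebraMap R _ r) = (p ^ n : ℕ) * addVal R r)
    (hres : ∀ a : integralClosure R L, ∃ r : R,
      a - algebraMap R _ r ∈ maximalIdeal (integralClosure R L)) :
    HasLowerJumps R K L p n (lowerJump p φs x₀ m) := by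
  refine ⟨H.lowerJump_strictMonoOn, fun j => H.lowerJump_pos hm, fun s => ?_⟩
  obtain ⟨κ, hκ⟩ := hφ.exists_equiv_fin (Fact.out : p.Prime).ne_zero
    hxu H.addOrderOf_eq (Points.val_eq_zero.1 H.ev_comp_eq_zero) hgen hfin
  have hmem : ∀ σ, σ ∈ lowerRamificationGroup R K L s ↔
      p ^ jumpCount n (lowerJump p φs x₀ m) s ∣ (κ σ : ℕ) := by
    intro σ
    rcases eq_or_ne (κ σ : ℕ) 0 with h0 | h0
    · have hσ : σ = 1 := hgen σ 1 (by
        have h := hκ σ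
        rw [h0, zero_nsmul, map_zero, add_zero] at h
        exact congrArg (fun z : Points (integralClosure R L) (Gs n) => (z.1 : L)) h)
      exact iff_of_true (hσ ▸ one_mem _) (h0 ▸ dvd_zero _)
    · rw [mem_lowerRamificationGroup_iff, H.forall_algHom_sub_mem_pow_iff_dvd hn hmp hm he hres hx
        h0 (κ σ).2 (hκ σ)]
  rw [Nat.card_congr (κ.subtypeEquiv (q := fun k : Fin (p ^ n) => _ ∣ (k : ℕ)) hmem),
    natCard_fin_dvd (pow_pos (Fact.out : p.Prime).pos _) (pow_dvd_pow p (jumpCount_le s)),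
    Nat.pow_div (jumpCount_le s) (Fact.out : p.Prime).pos]

end Galois

end IsKernelGenerator

section Descent

variable {R : Type*} [CommRing R] [IsDomain R] [IsDiscreteValuationRing R] {K : Type*} [Field K]
  [Algebra R K] [IsFractionRing R K] {Kbar : Type*} [Field Kbar] [Algebra K Kbar]
  [Algebra R Kbar] [IsScalarTower R K Kbar] {F : FormalGroup R} {φ : PowerSeries R}

lemma exists_points_adjoin_eq_top {x : integralClosure R Kbar}
    (hx : x ∈ Ring.jacobson (integralClosure R Kbar)) {y : R}
    (hxy : HasValue φ x (algebraMap R (integralClosure R Kbar) y))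
    [IsDiscreteValuationRing (integralClosure R (IntermediateField.adjoin K {(x : Kbar)}))]
    [IsAdicComplete (maximalIdeal (integralClosure R (IntermediateField.adjoin K {(x : Kbar)})))
      (integralClosure R (IntermediateField.adjoin K {(x : Kbar)}))] :
    ∃ ξ : Points (integralClosure R (IntermediateField.adjoin K {(x : Kbar)})) F,
      IntermediateField.adjoin K {(ξ.1 : IntermediateField.adjoin K {(x : Kbar)})} = ⊤ ∧
        ev φ ξ.1 = algebraMap R _ y := by
  set L := IntermediateField.adjoin K {(x : Kbar)}
  have := faithfulSMul_of_isFractionRing R K Kbar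
  have := faithfulSMul_of_isFractionRing R K L
  obtain ⟨ξ, hξx⟩ := exists_integralInclusion_eq L (IntermediateField.mem_adjoin_simple_self K _)
  have hξ : ξ ∈ maximalIdeal (integralClosure R L) :=
    (map_mem_ringJacobson_iff (integralInclusion L)).1 (hξx ▸ hx)
  refine ⟨⟨ξ, hξ⟩, ?_, integralInclusion_injective L ?_⟩
  · apply IntermediateField.lift_injective
    rw [IntermediateField.lift_adjoin_simple, IntermediateField.lift_top,
      ← coe_integralInclusion, hξx]
  · rw [← hξx, hasValue_map_iff (integralInclusion L) hξ] at hxy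
    rw [AlgHom.commutes, hxy]

end Descent

section Translate

variable {R : Type*} [CommRing R] {K L : Type*} [Field K] [Algebra R K] [Field L] [Algebra K L]
  [Algebra R L] [IsScalarTower R K L] [FiniteDimensional K L] [IsLocalRing R]
  [IsAdicComplete (maximalIdeal R) R] [IsLocalRing (integralClosure R L)]
  [IsAdicComplete (maximalIdeal (integralClosure R L)) (integralClosure R L)]
  [IsLocalHom (algebraMap R (integralClosure R L))] {F : FormalGroup R}

lemma algEquiv_eq_of_apply_sub_map_eq {ξ : Points (integralClosure R L) F}
    (hξ : IntermediateField.adjoin K {(ξ.1 : L)} = ⊤) (z : Points R F) {σ τ : L ≃ₐ[K] L}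
    (h : σ (ξ - Points.map (Algebra.ofId R (integralClosure R L)) z).1 =
      τ (ξ - Points.map (Algebra.ofId R (integralClosure R L)) z).1) : σ = τ := by
  let act (ρ : L ≃ₐ[K] L) : Points (integralClosure R L) F →+ Points (integralClosure R L) F :=
    Points.map (MulSemiringAction.toAlgHom R (integralClosure R L) ρ)
  let z' := Points.map (Algebra.ofId R (integralClosure R L)) z
  have hz (ρ) : act ρ z' = z' := Points.ext (AlgHom.commutes _ _)
  have hsub : act σ (ξ - z') = act τ (ξ - z') := Points.ext (Subtype.ext h)
  rw [map_sub, map_sub, hz, hz, sub_left_inj] at hsub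
  exact algEquiv_eq_of_apply_eq hξ
    (congrArg (fun x : Points (integralClosure R L) F => (x.1 : L)) hsub)

end Translate

namespace IsKernelGenerator

open IsDiscreteValuationRing hiding maximalIdeal

variable {R : Type*} [CommRing R] [IsDomain R] [IsDiscreteValuationRing R]
  [IsAdicComplete (maximalIdeal R) R] {p n : ℕ} [Fact p.Prime] [CharP (ResidueField R) p]
  {Gs : ℕ → FormalGroup R} {φs : ℕ → PowerSeries R} {x₀ : Points R (Gs n)}
  {K L : Type*} [Field K] [Algebra R K] [Field L] [Algebra K L] [Algebra R L]
  [IsScalarTower R K L]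

lemma upperJumps_eq (H : IsKernelGenerator p n Gs φs x₀) {m : ℕ} (hm : m < p * level p φs x₀ 0)
    (HJ : HasLowerJumps R K L p n (lowerJump p φs x₀ m)) :
    upperJumps R K L = {v : ℝ | ∃ i : ℕ, 1 ≤ i ∧ i ≤ n ∧ v = c p φs i - m} := by
  rw [HJ.upperJumps_eq (Fact.out : p.Prime).one_lt]
  ext v
  constructor
  · rintro ⟨j, hj, rfl⟩
    exact ⟨j + 1, j.succ_pos, hj, H.herbrandOfJumps_lowerJump hm hj⟩
  · rintro ⟨i, hi, hin, rfl⟩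
    obtain ⟨j, rfl⟩ := Nat.exists_eq_add_of_le' hi
    exact ⟨j, hin, (H.herbrandOfJumps_lowerJump hm hin).symm⟩

lemma upperRamificationGroup_ne_bot (H : IsKernelGenerator p n Gs φs x₀) (hn : n ≠ 0) {m : ℕ}
    (hm : m < p * level p φs x₀ 0) (HJ : HasLowerJumps R K L p n (lowerJump p φs x₀ m)) :
    upperRamificationGroup R K L (c p φs n - m) ≠ ⊥ := by
  obtain ⟨j, rfl⟩ := Nat.exists_eq_succ_of_ne_zero hn
  rw [← H.herbrandOfJumps_lowerJump hm j.lt_succ_self]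
  exact HJ.upperRamificationGroup_ne_bot (Fact.out : p.Prime).one_lt j.lt_succ_self

variable [CharZero K] [IsFractionRing R K] [FiniteDimensional K L]
  [IsDiscreteValuationRing (integralClosure R L)]
  [IsAdicComplete (maximalIdeal (integralClosure R L)) (integralClosure R L)]
  [IsLocalHom (algebraMap R (integralClosure R L))]

lemma isGalois_and_hasLowerJumps (H : IsKernelGenerator p n Gs φs x₀) (hn : n ≠ 0)
    (hφ : IsIsogeny p n (Gs n) (Gs 0) (comp φs 0 n)) {m : ℕ} (hmp : ¬ p ∣ m)
    (hm : m < p * level p φs x₀ 0) {u : Points R (Gs 0)} (hu : addVal R u.1 = m)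
    {z : Points R (Gs n)} {ξ : Points (integralClosure R L) (Gs n)}
    (hξ : IntermediateField.adjoin K {(ξ.1 : L)} = ⊤)
    (hξuz : hφ.isHom.onPoints ξ = Points.map (Algebra.ofId R _) (u + hφ.isHom.onPoints z)) :
    Module.finrank K L = p ^ n ∧ IsGalois K L ∧ IsTotallyRamified R K L ∧
      HasLowerJumps R K L p n (lowerJump p φs x₀ m) := by
  have hp := (Fact.out : p.Prime).ne_zero
  have := faithfulSMul_of_isFractionRing R K L
  set x := ξ - Points.map (Algebra.ofId R (integralClosure R L)) z
  have hxu : hφ.isHom.onPoints x = Points.map (Algebra.ofId R _) u := by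
    rw [map_sub, hξuz, map_add, hφ.isHom.onPoints_map, add_sub_cancel_right]
  obtain ⟨hfin, he, hx⟩ := H.ramificationIdx_eq (hφ.finrank_le hp hξ hξuz) hmp hm hu
    (congrArg Points.val hxu)
  have hgal : IsGalois K L := hφ.isGalois hp hξ hξuz H.addOrderOf_eq
    (Points.val_eq_zero.1 H.ev_comp_eq_zero)
  have hgen : ∀ σ τ : L ≃ₐ[K] L, σ x.1 = τ x.1 → σ = τ := fun σ τ =>
    algEquiv_eq_of_apply_sub_map_eq hξ z
  have hf : (maximalIdeal (integralClosure R L)).inertiaDeg R = 1 := by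
    have h := ramificationIdx_mul_inertiaDeg_integralClosure R K L
    rwa [he, hfin, Nat.mul_eq_left (pow_ne_zero n hp)] at h
  refine ⟨hfin, hgal, ⟨maximalIdeal _, inferInstance, ?_⟩, ?_⟩
  · rw [hfin, ← he, map_maximalIdeal_eq_pow_ramificationIdx]
  · exact H.hasLowerJumps hφ hfin hgen hxu hn hmp hm hx
      (fun r => by rw [addVal_algebraMap, he]) (exists_sub_algebraMap_mem_of_inertiaDeg_eq_one hf)

end IsKernelGenerator

end FormalIsogeny

end

theorem proposition2p9_general
    {R : Type*} [CommRing R] [IsDomain R] [IsDiscreteValuationRing R]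
    [IsAdicComplete (IsLocalRing.maximalIdeal R) R]
    {p : ℕ} [Fact p.Prime] [CharP (IsLocalRing.ResidueField R) p]
    {K : Type*} [Field K] [CharZero K] [Algebra R K] [IsFractionRing R K]
    {Kbar : Type*} [Field Kbar] [Algebra K Kbar] [Algebra R Kbar] [IsScalarTower R K Kbar]
    [IsAlgClosure K Kbar]
    {n : ℕ} (hn : 1 ≤ n)
    {F G : FormalGroup R} {φ : PowerSeries R}
    (hφ : FormalIsogeny.IsIsogeny p n F G φ)
    (hker : FormalIsogeny.HasRationalCyclicKernel (integralClosure R Kbar) F φ)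
    {Gs : ℕ → FormalGroup R} {φs : ℕ → PowerSeries R}
    (hfac : FormalIsogeny.IsFactorization (integralClosure R Kbar) p n F G φ Gs φs)
    {m : ℕ} (hmc : (m : ℝ) < FormalIsogeny.c p φs 1) (hpm : ¬ p ∣ m)
    {y : R} (hy : y ∈ FormalIsogeny.cokernelFiltration G φ m)
    (hy' : y ∉ FormalIsogeny.cokernelFiltration G φ (m + 1))
    {x : integralClosure R Kbar} (hx : x ∈ Ring.jacobson (integralClosure R Kbar))
    (hxy : FormalIsogeny.HasValue φ x (algebraMap R (integralClosure R Kbar) y)) :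
    let L := IntermediateField.adjoin K {(x : Kbar)}
    Module.finrank K L = p ^ n ∧
    IsGalois K L ∧
    FormalIsogeny.IsTotallyRamified R K L ∧
    FormalIsogeny.upperJumps R K L =
      {v : ℝ | ∃ i : ℕ, 1 ≤ i ∧ i ≤ n ∧ v = FormalIsogeny.c p φs i - m} ∧
    FormalIsogeny.upperRamificationGroup R K L (FormalIsogeny.c p φs n - m) ≠ ⊥ := by
  intro L
  have hn0 : n ≠ 0 := Nat.one_le_iff_ne_zero.1 hn
  obtain rfl := hfac.source
  obtain rfl := hfac.target
  obtain rfl := hfac.comp_eq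
  obtain ⟨x₀, H⟩ := hfac.exists_isKernelGenerator K hker
  have := (IsAlgClosure.isAlgebraic : Algebra.IsAlgebraic K Kbar)
  have : FiniteDimensional K L :=
    IntermediateField.adjoin.finiteDimensional (Algebra.IsIntegral.isIntegral _)
  have := FormalIsogeny.isDiscreteValuationRing_integralClosure R K L
  have := FormalIsogeny.isAdicComplete_integralClosure R K L
  have := FormalIsogeny.faithfulSMul_of_isFractionRing R K L
  have hm : m < p * FormalIsogeny.level p φs x₀ 0 := by
    rwa [H.c_one hn, Nat.cast_lt] at hmc
  have hm0 : m ≠ 0 := fun h => hpm (h ▸ dvd_zero p)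
  obtain ⟨u, z, hu, rfl⟩ :=
    FormalIsogeny.exists_add_onPoints_eq_of_mem_cokernelFiltration hφ.isHom hm0 hy hy'
  obtain ⟨ξ, hξ, hξy⟩ := FormalIsogeny.exists_points_adjoin_eq_top (K := K) (F := Gs n) hx hxy
  obtain ⟨hfin, hgal, htot, HJ⟩ := H.isGalois_and_hasLowerJumps hn0 hφ hpm hm hu hξ
    (FormalIsogeny.Points.ext hξy)
  exact ⟨hfin, hgal, htot, H.upperJumps_eq hm HJ,
    H.upperRamificationGroup_ne_bot hn0 hm HJ⟩

theorem proposition2p9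
    {R : Type*} [CommRing R] [IsDomain R] [IsDiscreteValuationRing R]
    [IsAdicComplete (IsLocalRing.maximalIdeal R) R]
    {p : ℕ} [Fact p.Prime] [CharP (IsLocalRing.ResidueField R) p]
    [PerfectField (IsLocalRing.ResidueField R)]
    {K : Type*} [Field K] [CharZero K] [Algebra R K] [IsFractionRing R K]
    {Kbar : Type*} [Field Kbar] [Algebra K Kbar] [Algebra R Kbar] [IsScalarTower R K Kbar]
    [IsAlgClosure K Kbar]
    {n : ℕ} (hn : 1 ≤ n)
    {F G : FormalGroup R} [F.IsComm] [G.IsComm] {φ : PowerSeries R}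
    (hφ : FormalIsogeny.IsIsogeny p n F G φ)
    (hker : FormalIsogeny.HasRationalCyclicKernel (integralClosure R Kbar) F φ)
    {Gs : ℕ → FormalGroup R} {φs : ℕ → PowerSeries R}
    (hfac : FormalIsogeny.IsFactorization (integralClosure R Kbar) p n F G φ Gs φs)
    {m : ℕ} (hm : 1 ≤ m) (hmc : (m : ℝ) < FormalIsogeny.c p φs 1) (hpm : ¬ p ∣ m)
    {y : R} (hy : y ∈ FormalIsogeny.cokernelFiltration G φ m)
    (hy' : y ∉ FormalIsogeny.cokernelFiltration G φ (m + 1))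
    {x : integralClosure R Kbar} (hx : x ∈ Ring.jacobson (integralClosure R Kbar))
    (hxy : FormalIsogeny.HasValue φ x (algebraMap R (integralClosure R Kbar) y)) :
    let L := IntermediateField.adjoin K {(x : Kbar)}
    Module.finrank K L = p ^ n ∧
    IsGalois K L ∧
    FormalIsogeny.IsTotallyRamified R K L ∧
    FormalIsogeny.upperJumps R K L =
      {v : ℝ | ∃ i : ℕ, 1 ≤ i ∧ i ≤ n ∧ v = FormalIsogeny.c p φs i - m} ∧
    FormalIsogeny.upperRamificationGroup R K L (FormalIsogeny.c p φs n - m) ≠ ⊥ :=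
  proposition2p9_general hn hφ hker hfac hmc hpm hy hy' hx hxy
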